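/- **Theorem 2.1.** For an integer $n \ge 1$, $\lambda \ge 0$ and $\rho \in [0,1]$, let $\theta \in \{0,1\}^n$ have i.i.d. $\mathrm{Ber}(\rho)$ entries, let $Z$ be an independent symmetric $n \times n$ matrix whose entries $Z_{ij} = Z_{ji}$, $i \le j$ (diagonal included), are i.i.d. $\mathcal N(0,1)$, and let $Y = \lambda\theta\theta^\top + Z$ (planted submatrix model). Put $x = \theta_1$ and, for an integer $D \ge 0$, $$\mathrm{Corr}_{\le D} = \mathrm{Corr}_{\le D}(n,\lambda,\rho) := \sup_{f} \frac{\mathbb E[f(Y)\, x]}{\sqrt{\mathbb E[f(Y)^2]\;\mathbb E[x^2]}},$$ where the supremum is over all real polynomials $f$ of total degree at most $D$ in the entries of $Y$ (a polynomial with $\mathbb E[f(Y)^2]=0$ contributes $0$). For every $\varepsilon > 0$ there is a constant $C = C(\varepsilon) > 0$ such that both of the following hold. (a) (Lower bound.) For all $n \ge 1$, $\lambda \ge 0$, $\rho \in (0,1)$ and integers $D \ge 0$: if $$\lambda \le (1-\varepsilon)\,(\rho\sqrt{en})^{-1}\sqrt{1-\rho} \qquad\text{and}\qquad D \le \lambda^{-2}/C$$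 (where the condition on $D$ is void if $\lambda = 0$), then $$\mathrm{Corr}_{\le D} \le C\sqrt{\frac{\rho}{1-\rho}}.$$ (b) (Upper bound.) Let $(\lambda_n)$ and $(\rho_n)$ be sequences with $\rho_n \in [0,1]$ such that, as $n \to \infty$, $\rho_n = \omega(n^{-1}\log^{12} n)$, $\rho_n = o(\log^{-12} n)$, and $\lambda_n \ge (1+\varepsilon)(\rho_n\sqrt{en})^{-1}$ for all sufficiently large $n$. Then $$\mathrm{Corr}_{\le \lfloor C\log n\rfloor}(n,\lambda_n,\rho_n) \to 1 \qquad (n \to \infty).$$ -/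

import Mathlib

open MeasureTheory ProbabilityTheory Filter Asymptotics Topology

namespace PlantedSubmatrix

noncomputable section

/-- The sample space for size `n`: a signal `θ ∈ ℝⁿ` and a noise value for every unordered pair
`{i, j}` of indices, `i = j` allowed. -/
abbrev Sample (n : ℕ) : Type := (Fin n → ℝ) × (Sym2 (Fin n) → ℝ)

/-- The joint law of signal and noise: the entries of `θ` are i.i.d. `Ber(ρ)` (value `1` with
probability `ρ`, value `0` with probability `1 - ρ`), the noise values are i.i.d. `N(0, 1)`,
and signal and noise are independent. -/
def law (n : ℕ) (rho : unitInterval) : Measure (Sample n) :=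
  (Measure.pi fun _ : Fin n => bernoulliMeasure (1 : ℝ) 0 rho).prod
    (Measure.pi fun _ : Sym2 (Fin n) => gaussianReal 0 1)

instance (n : ℕ) (rho : unitInterval) : IsProbabilityMeasure (law n rho) := by
  unfold law; infer_instance

/-- The symmetric noise matrix, `Z i j = Z j i`. -/
def noise {n : ℕ} (w : Sample n) : Matrix (Fin n) (Fin n) ℝ :=
  Matrix.of fun i j => w.2 s(i, j)

/-- The observation `Y = λ θ θᵀ + Z`. -/
def obs {n : ℕ} (lam : ℝ) (w : Sample n) : Matrix (Fin n) (Fin n) ℝ :=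
  lam • Matrix.vecMulVec w.1 w.1 + noise w

/-- The quantity to be estimated: the first entry of `θ` (set to `0` if `n = 0`). -/
def estimand {n : ℕ} (w : Sample n) : ℝ :=
  if h : 0 < n then w.1 ⟨0, h⟩ else 0

/-- The value `f(Y)` of a polynomial `f` in the entries of the matrix `Y`. -/
def evalMatrix {n : ℕ} (f : MvPolynomial (Fin n × Fin n) ℝ) (Y : Matrix (Fin n) (Fin n) ℝ) : ℝ :=
  MvPolynomial.eval (fun p => Y p.1 p.2) f

/-- The normalized correlation `E[f(Y) x] / √(E[f(Y)²] E[x²])` of the estimator `f(Y)` with the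
estimand `x`. -/
def corrOf (n : ℕ) (lam : ℝ) (rho : unitInterval) (f : MvPolynomial (Fin n × Fin n) ℝ) : ℝ :=
  (∫ w, evalMatrix f (obs lam w) * estimand w ∂(law n rho)) /
    √((∫ w, evalMatrix f (obs lam w) ^ 2 ∂(law n rho)) * ∫ w, estimand w ^ 2 ∂(law n rho))

/-- `Corr_{≤ D}`: the supremum of the normalized correlation over all polynomials of total degree
at most `D`. (Polynomials with `E[f(Y)²] = 0` contribute the value `0`, which does not affect
the supremum, since `f = 1` has nonnegative correlation with `x`.) -/
def corr (n : ℕ) (lam : ℝ) (rho : unitInterval) (D : ℕ) : ℝ :=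
  ⨆ f : {f : MvPolynomial (Fin n × Fin n) ℝ // f.totalDegree ≤ D}, corrOf n lam rho f

theorem integral_mul_div_le_one {Ω : Type*} [MeasurableSpace Ω] (μ : Measure Ω) {f g : Ω → ℝ}
    (hf : AEStronglyMeasurable f μ) (hg : AEStronglyMeasurable g μ) :
    (∫ w, f w * g w ∂μ) / √((∫ w, f w ^ 2 ∂μ) * ∫ w, g w ^ 2 ∂μ) ≤ 1 := by
  by_cases hfi : Integrable (fun w => f w ^ 2) μ
  swap
  · simp [integral_undef hfi]
  by_cases hgi : Integrable (fun w => g w ^ 2) μ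
  swap
  · simp [integral_undef hgi]
  have hf2 : MemLp f 2 μ := (memLp_two_iff_integrable_sq hf).2 hfi
  have hg2 : MemLp g 2 μ := (memLp_two_iff_integrable_sq hg).2 hgi
  have hfg : Integrable (fun w => f w * g w) μ := hf2.integrable_mul hg2
  set A := ∫ w, f w ^ 2 ∂μ
  set B := ∫ w, g w ^ 2 ∂μ
  set P := ∫ w, f w * g w ∂μ
  have key : ∀ s : ℝ, 0 ≤ A * (s * s) + (2 * P) * s + B := by
    intro s
    have h : ∫ w, (s * f w + g w) ^ 2 ∂μ = A * (s * s) + (2 * P) * s + B := by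
      have : ∀ w, (s * f w + g w) ^ 2
          = ((s * s) * f w ^ 2 + (2 * s) * (f w * g w)) + g w ^ 2 := by
        intro w; ring
      simp_rw [this]
      have h1 : Integrable (fun w => (s * s) * f w ^ 2) μ := hfi.const_mul _
      have h2 : Integrable (fun w => (2 * s) * (f w * g w)) μ := hfg.const_mul _
      have h12 : Integrable (fun w => (s * s) * f w ^ 2 + (2 * s) * (f w * g w)) μ := h1.add h2
      rw [integral_add h12 hgi, integral_add h1 h2, integral_const_mul, integral_const_mul]
      ring
    rw [← h]
    exact integral_nonneg fun w => sq_nonneg _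
  have hd := discrim_le_zero key
  have hP : P ^ 2 ≤ A * B := by
    unfold discrim at hd; nlinarith
  refine div_le_one_of_le₀ ?_ (Real.sqrt_nonneg _)
  exact Real.le_sqrt_of_sq_le hP

theorem measurable_estimand {n : ℕ} : Measurable (estimand (n := n)) := by
  unfold estimand
  split_ifs <;> fun_prop

theorem measurable_evalMatrix_obs {n : ℕ} (lam : ℝ) (f : MvPolynomial (Fin n × Fin n) ℝ) :
    Measurable fun w : Sample n => evalMatrix f (obs lam w) := by
  have h : Measurable fun (w : Sample n) (p : Fin n × Fin n) => obs lam w p.1 p.2 := by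
    refine measurable_pi_lambda _ fun p => ?_
    simp only [obs, noise, Matrix.add_apply, Matrix.smul_apply, Matrix.vecMulVec_apply,
      Matrix.of_apply, smul_eq_mul]
    fun_prop
  exact (MvPolynomial.continuous_eval f).measurable.comp h

/-- By the Cauchy-Schwarz inequality the correlations are at most `1`, so that the supremum which
defines `corr` is over a set that is bounded above (and contains `0`). -/
theorem corrOf_le_one (n : ℕ) (lam : ℝ) (rho : unitInterval)
    (f : MvPolynomial (Fin n × Fin n) ℝ) : corrOf n lam rho f ≤ 1 :=
  integral_mul_div_le_one _ (measurable_evalMatrix_obs lam f).aestronglyMeasurable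
    measurable_estimand.aestronglyMeasurable

theorem bddAbove_range_corrOf (n : ℕ) (lam : ℝ) (rho : unitInterval) (D : ℕ) :
    BddAbove (Set.range fun f : {f : MvPolynomial (Fin n × Fin n) ℝ // f.totalDegree ≤ D} =>
      corrOf n lam rho f) :=
  ⟨1, by rintro _ ⟨f, rfl⟩; exact corrOf_le_one n lam rho f⟩

end

end PlantedSubmatrix

/-!
Both halves rest on expanding in Hermite polynomials of the noise and counting labelled trees.

**Below the threshold.** If a square integrable function `u` of signal and noise satisfies
`E[u f(Y)] = E[x f(Y)]` for all polynomials `f` of degree at most `D`, then the Cauchy-Schwarz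
inequality gives `Corr ≤ √(E[u²] / E[x²])` (`corrOf_le_sqrt_cert`). Such a `u` is explicit: the sum,
over the multigraphs `β` with at most `D` edges that are connected to the vertex `o` of the
estimand, of `λ^|β| / β! ⋅ He_β(Z) ⋅ ∏ ρ (1 - θ_v) / (1 - ρ)`, with `v` running over `o` and the
vertices of `β` (`cert`). The factor `1 - θ_v` vanishes on planted vertices. So when `u` is paired
with a monomial of the observation, the term of a multigraph `β` inside the multigraph `γ` of a
signal monomial vanishes unless no edge of `γ - β` touches `β`, that is, unless `β` is the component
of `o` in `γ` (`sum_connGraphs_eq`), and this one term is the pairing of the monomial with the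
estimand. By orthogonality `E[u²] = ∑ λ^(2|β|) / β! ⋅ (ρ² / (1 - ρ))^|V(β) ∪ {o}|`. Summing over
spanning trees of `β`, given by parent functions, the part with `v` further vertices is at most
`n^v / v! ⋅ (v + 1)^v ⋅ (λ² ρ² / (1 - ρ))^v`, up to factors controlled by `λ² D ≤ 1 / C`; this is a
geometric series of ratio about `e n λ² ρ² / (1 - ρ)`, which is less than `1` (`sum_connGraphs_le`,
`corr_le_of_below_threshold`).

**Above the threshold.** The estimator is the sum of the tree monomials `∏ Y_e` over the trees in
which `o` has two children, the tops of two disjoint branches with `d` vertices each (`branchPoly`),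
with `d` of order `log n`; each tree occurs twice, once for each order of the branches. Given the
planted set `S`, the coefficient of `∏_{e ∈ B} Z_e` is `λ^(2d - |B|)` times the number of these
trees `T ⊇ B` with `T \ B` inside `S`, so the second moment is a weighted sum of the squares of
these numbers (`integral_branchPoly_sq`). Group the edge sets `B` by `b = |B|`, the number `q` of
covered vertices other than `o` without a parent edge in `B`, and the number `a` of planted vertices
with a parent edge in `B`. Counting parent functions shows that, relative to the square of the mean
given that `o` is planted, a group contributes at most `d^8 α^q β^a γ^b` up to a constant, with `α`
of order `d² / (n ρ)`, `β` of order `d ρ` and `γ = 1 / (e n λ² ρ²) < 1` (`card_goodParts_le`,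
`card_goodPairs_le`, `sum_plantWeight_mul_sum_goodParts_le`). The two branches make this enough. If
`o` is planted and `0 < b < d`, then `q ≥ 1` or `a ≥ 1`, which makes the contribution small. If `o`
is not planted, both edges at `o` belong to `B`, and for `b < d` each branch contains a planted
vertex with a parent edge in `B`; so `a ≥ 2`, and `β²` is small even compared with `ρ`, the
probability that `o` is planted. The groups with `b ≥ d` are bounded by `γ^d ≤ n⁻²`. What remains is
the group `B = ∅`, which contributes the square of this mean up to a factor tending to `1`. Hence
the correlation tends to `1` (`integral_branchPoly_sq_le_mul`, `tendsto_corr_of_above_threshold`).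
-/

namespace PlantedSubmatrix

/-! ### Hermite polynomials and Gaussian integrals -/

open Polynomial in
theorem integrable_eval_gaussianReal (p : ℝ[X]) :
    Integrable (fun z => p.eval z) (gaussianReal 0 1) := by
  induction p using Polynomial.induction_on' with
  | add p q hp hq => exact (hp.add hq).congr (ae_of_all _ fun z => by simp)
  | monomial n a =>
    simp only [eval_monomial]
    refine Integrable.const_mul ?_ a
    have h := (memLp_id_gaussianReal (μ := 0) (v := 1) n).integrable_norm_pow'
    rw [← integrable_norm_iff (by fun_prop)]
    simpa using h

open Polynomial in
theorem integrable_gaussianReal_of_eval_eq (p : ℝ[X]) {f : ℝ → ℝ} (h : ∀ z, p.eval z = f z) :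
    Integrable f (gaussianReal 0 1) :=
  (integrable_eval_gaussianReal p).congr (ae_of_all _ h)

open Polynomial in
/-- Stein's identity for polynomials. -/
theorem integral_mul_eval_gaussianReal (p : ℝ[X]) :
    ∫ z, z * p.eval z ∂(gaussianReal 0 1) = ∫ z, p.derivative.eval z ∂(gaussianReal 0 1) := by
  have hint : ∀ q : ℝ[X], Integrable fun z => gaussianPDFReal 0 1 z * q.eval z := by
    intro q
    have h := integrable_eval_gaussianReal q
    rw [gaussianReal_of_var_ne_zero _ one_ne_zero,
      integrable_withDensity_iff_integrable_smul₀' (by fun_prop)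
        (ae_of_all _ fun _ => gaussianPDF_lt_top)] at h
    simpa using h
  have hd : ∀ z : ℝ, HasDerivAt (fun z => gaussianPDFReal 0 1 z * p.eval z)
      (gaussianPDFReal 0 1 z * (p.derivative - X * p).eval z) z := by
    intro z
    have h1 : HasDerivAt (gaussianPDFReal 0 1) (gaussianPDFReal 0 1 z * (-z)) z := by
      have h : HasDerivAt (fun z : ℝ => (√(2 * Real.pi * 1))⁻¹ * Real.exp (-(z - 0) ^ 2 / (2 * 1)))
          ((√(2 * Real.pi * 1))⁻¹ * (Real.exp (-(z - 0) ^ 2 / (2 * 1)) * (-z))) z := by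
        refine HasDerivAt.const_mul _ (HasDerivAt.exp ?_)
        refine ((((hasDerivAt_id z).sub_const 0).pow 2).neg.div_const (2 * 1)).congr_deriv ?_
        norm_num; ring
      unfold gaussianPDFReal
      simpa [mul_assoc] using h
    refine (h1.mul (p.hasDerivAt z)).congr_deriv ?_
    rw [eval_sub, eval_mul, eval_X]; ring
  have h0 := integral_eq_zero_of_hasDerivAt_of_integrable hd (hint _) (hint _)
  have e : ∀ q : ℝ[X], ∫ z, q.eval z ∂(gaussianReal 0 1)
      = ∫ z, gaussianPDFReal 0 1 z * q.eval z := by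
    intro q
    rw [integral_gaussianReal_eq_integral_smul one_ne_zero]
    simp
  have h1 := e (p.derivative - X * p)
  rw [h0] at h1
  simp only [eval_sub, eval_mul, eval_X] at h1
  rw [integral_sub (integrable_eval_gaussianReal _)
    (integrable_gaussianReal_of_eval_eq (X * p) fun z => by simp)] at h1
  linarith

/-- The probabilists' Hermite polynomial with real coefficients. -/
noncomputable def realHermite (b : ℕ) : Polynomial ℝ :=
  (Polynomial.hermite b).map (Int.castRingHom ℝ)

open Polynomial in
theorem integral_realHermite_mul (b : ℕ) (p : ℝ[X]) :
    ∫ z, (realHermite b).eval z * p.eval z ∂(gaussianReal 0 1)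
      = ∫ z, (derivative^[b] p).eval z ∂(gaussianReal 0 1) := by
  induction b generalizing p with
  | zero => simp [realHermite]
  | succ b ih =>
    have h1 : ∀ z, (realHermite (b + 1)).eval z * p.eval z
        = z * (realHermite b * p).eval z - ((derivative (realHermite b)) * p).eval z := by
      intro z
      simp [realHermite, hermite_succ, derivative_map]; ring
    simp_rw [h1]
    rw [integral_sub (integrable_gaussianReal_of_eval_eq (X * (realHermite b * p)) fun z => by simp)
      (integrable_eval_gaussianReal _), integral_mul_eval_gaussianReal]
    rw [← integral_sub (integrable_eval_gaussianReal _) (integrable_eval_gaussianReal _)]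
    rw [Function.iterate_succ_apply, ← ih]
    congr 1; ext z
    simp [derivative_mul]

theorem integral_realHermite_mul_realHermite (b c : ℕ) :
    ∫ z, (realHermite b).eval z * (realHermite c).eval z ∂(gaussianReal 0 1)
      = if b = c then (b.factorial : ℝ) else 0 := by
  have hdeg : ∀ b, (realHermite b).natDegree = b := fun b => by
    rw [realHermite, (Polynomial.hermite_monic b).natDegree_map, Polynomial.natDegree_hermite]
  have hlt : ∀ b c, c < b →
      ∫ z, (realHermite b).eval z * (realHermite c).eval z ∂(gaussianReal 0 1) = 0 := by
    intro b c h
    rw [integral_realHermite_mul,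
      Polynomial.iterate_derivative_eq_zero (by rw [hdeg]; exact h)]
    simp
  rcases lt_trichotomy b c with h | h | h
  · rw [if_neg h.ne]
    simp_rw [mul_comm ((realHermite b).eval _)]
    exact hlt c b h
  · subst h
    rw [if_pos rfl, integral_realHermite_mul]
    have h3 : Polynomial.derivative^[b] (realHermite b) = Polynomial.C (b.factorial : ℝ) := by
      have hd0 : (Polynomial.derivative^[b] (realHermite b)).natDegree = 0 := by
        have := Polynomial.natDegree_iterate_derivative (realHermite b) b
        rw [hdeg] at this; omega
      rw [Polynomial.eq_C_of_natDegree_eq_zero hd0, Polynomial.coeff_iterate_derivative]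
      have : (realHermite b).coeff b = 1 := by simp [realHermite]
      simp [this, Nat.descFactorial_self]
    rw [h3]; simp
  · rw [if_neg h.ne', hlt b c h]

open Polynomial in
/-- Pairing with the `b`-th Hermite polynomial acts on the shifted monomial `(z + t) ^ a` as the
`b`-th derivative acts on one fixed polynomial in `t`, whose coefficients do not depend on `b`. -/
theorem exists_integral_realHermite_mul_add_pow (a : ℕ) : ∃ κ : ℕ → ℝ, ∀ (b : ℕ) (t : ℝ),
    ∫ z, (realHermite b).eval z * (t + z) ^ a ∂(gaussianReal 0 1)
      = ∑ c ∈ Finset.range (a + 1), κ c * ((c.descFactorial b : ℝ) * t ^ (c - b)) := by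
  let m : ℕ → ℝ := fun j => ∫ z, z ^ j ∂(gaussianReal 0 1)
  have hm : ∀ (j : ℕ) (t : ℝ), ∫ z, (t + z) ^ j ∂(gaussianReal 0 1)
      = ∑ c ∈ Finset.range (j + 1), t ^ c * m (j - c) * (j.choose c) := by
    intro j t
    simp_rw [add_pow]
    rw [integral_finsetSum]
    · refine Finset.sum_congr rfl fun c _ => ?_
      rw [integral_mul_const, integral_const_mul]
    · intro c _
      exact integrable_gaussianReal_of_eval_eq (C (t ^ c) * X ^ (j - c) * C (j.choose c : ℝ))
        fun z => by simp
  refine ⟨fun c => (a.choose c : ℝ) * m (a - c), fun b t => ?_⟩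
  have h1 : ∀ z : ℝ, (t + z) ^ a = ((X + C t) ^ a : ℝ[X]).eval z := by intro z; simp [add_comm]
  simp_rw [h1]
  rw [integral_realHermite_mul, iterate_derivative_X_add_pow]
  have h2 : ∀ z : ℝ, (a.descFactorial b • (X + C t) ^ (a - b) : ℝ[X]).eval z
      = (a.descFactorial b : ℝ) * (t + z) ^ (a - b) := by intro z; simp [add_comm]
  simp_rw [h2]
  rw [integral_const_mul, hm]
  rcases lt_or_ge a b with hab | hab
  · rw [Nat.descFactorial_of_lt hab]
    rw [Nat.cast_zero, zero_mul, Finset.sum_eq_zero]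
    · intro c hc
      rw [Nat.descFactorial_of_lt (by have := Finset.mem_range.1 hc; omega)]
      simp
  · obtain ⟨j, rfl⟩ := Nat.exists_eq_add_of_le hab
    rw [show b + j + 1 = b + (j + 1) by ring, Finset.sum_range_add _ b (j + 1),
      Finset.sum_eq_zero (s := Finset.range b), zero_add, Finset.mul_sum]
    · have : b + j - b = j := by omega
      rw [this]
      refine Finset.sum_congr rfl fun c hc => ?_
      have h3 : ((b + j).descFactorial b : ℝ) * (j.choose c)
          = ((b + j).choose (b + c)) * ((b + c).descFactorial b) := by
        rw [Nat.descFactorial_eq_factorial_mul_choose, Nat.descFactorial_eq_factorial_mul_choose]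
        have := Nat.choose_mul (n := b + j) (k := b + c) (s := b) (by omega)
        simp only [Nat.add_sub_cancel_left] at this
        have h4 : ((b + j).choose (b + c) : ℝ) * ((b + c).choose b)
          = ((b + j).choose b) * (j.choose c) := by exact_mod_cast this
        push_cast
        linear_combination (-(b.factorial : ℝ)) * h4
      have e1 : b + c - b = c := by omega
      have e2 : b + j - (b + c) = j - c := by omega
      simp only [e1, e2]
      linear_combination (t ^ c * m (j - c)) * h3
    · intro c hc
      rw [Nat.descFactorial_of_lt (Finset.mem_range.1 hc)]
      simp

/-! ### Expectations as sums over the planted set -/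

/-- The `0`-`1` vector with support `S`. -/
noncomputable def plant {n : ℕ} (S : Finset (Fin n)) : Fin n → ℝ := fun i => if i ∈ S then 1 else 0

/-- The probability that the planted set of a `Ber(ρ)` signal is `S`. -/
noncomputable def plantWeight {n : ℕ} (rho : unitInterval) (S : Finset (Fin n)) : ℝ :=
  (∏ _i ∈ S, (rho : ℝ)) * ∏ _i ∈ Sᶜ, (1 - (rho : ℝ))

theorem plantWeight_nonneg {n : ℕ} (rho : unitInterval) (S : Finset (Fin n)) :
    0 ≤ plantWeight rho S :=
  mul_nonneg (Finset.prod_nonneg fun _ _ => rho.2.1)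
    (Finset.prod_nonneg fun _ _ => sub_nonneg.2 rho.2.2)

/-- The law of the noise. -/
noncomputable abbrev noiseLaw (n : ℕ) : Measure (Sym2 (Fin n) → ℝ) :=
  Measure.pi fun _ : Sym2 (Fin n) => gaussianReal 0 1

theorem pi_bernoulliMeasure_eq_sum (n : ℕ) (rho : unitInterval) :
    (Measure.pi fun _ : Fin n => bernoulliMeasure (1 : ℝ) 0 rho)
      = Measure.sum fun S : Finset (Fin n) =>
          ENNReal.ofReal (plantWeight rho S) • Measure.dirac (plant S) := by
  refine Measure.pi_eq fun s hs => ?_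
  have h1 : ∀ i, bernoulliMeasure (1 : ℝ) 0 rho (s i)
      = ENNReal.ofReal rho * (s i).indicator 1 1
        + ENNReal.ofReal (1 - rho) * (s i).indicator 1 0 := by
    intro i
    rw [bernoulliMeasure_def, Measure.add_apply, Measure.smul_apply, Measure.smul_apply,
      Measure.dirac_apply' _ (hs i), Measure.dirac_apply' _ (hs i)]
    congr 2
    · exact (Real.toNNReal_of_nonneg rho.2.1).symm
    · exact (Real.toNNReal_of_nonneg (unitInterval.symm rho).2.1).symm
  simp_rw [h1]
  rw [Fintype.prod_add, Measure.sum_apply _ (MeasurableSet.univ_pi hs), tsum_fintype]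
  refine Finset.sum_congr rfl fun S _ => ?_
  rw [Measure.smul_apply, Measure.dirac_apply' _ (MeasurableSet.univ_pi hs), smul_eq_mul,
    plantWeight, ENNReal.ofReal_mul (Finset.prod_nonneg fun _ _ => rho.2.1),
    ENNReal.ofReal_prod_of_nonneg (fun _ _ => rho.2.1),
    ENNReal.ofReal_prod_of_nonneg (fun _ _ => sub_nonneg.2 rho.2.2)]
  rw [Finset.prod_mul_distrib, Finset.prod_mul_distrib]
  have h2 : (Set.pi Set.univ s).indicator (1 : (Fin n → ℝ) → ENNReal) (plant S)
      = (∏ i ∈ S, (s i).indicator 1 (1 : ℝ)) * ∏ i ∈ Sᶜ, (s i).indicator 1 (0 : ℝ) := by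
    have h3 : (Set.pi Set.univ s).indicator (1 : (Fin n → ℝ) → ENNReal) (plant S)
        = ∏ i, (s i).indicator 1 (plant S i) := by
      by_cases h : plant S ∈ Set.pi Set.univ s
      · rw [Set.indicator_of_mem h, Finset.prod_eq_one]
        · simp
        · intro i _
          rw [Set.indicator_of_mem (h i trivial)]; simp
      · rw [Set.indicator_of_notMem h]
        simp only [Set.mem_pi, Set.mem_univ, true_implies, not_forall] at h
        obtain ⟨i, hi⟩ := h
        exact (Finset.prod_eq_zero (Finset.mem_univ i) (Set.indicator_of_notMem hi _)).symm
    rw [h3, ← Finset.prod_mul_prod_compl S]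
    congr 1
    · exact Finset.prod_congr rfl fun i hi => by simp [plant, hi]
    · exact Finset.prod_congr rfl fun i hi => by simp [plant, Finset.mem_compl.1 hi]
  rw [h2]
  ring

theorem law_eq_sum (n : ℕ) (rho : unitInterval) :
    law n rho = Measure.sum fun S : Finset (Fin n) =>
      ENNReal.ofReal (plantWeight rho S) • (noiseLaw n).map (Prod.mk (plant S)) := by
  rw [law, pi_bernoulliMeasure_eq_sum, Measure.prod_sum_left]
  congr 1
  ext1 S
  rw [Measure.prod_smul_left, Measure.dirac_prod]

theorem integrable_law {n : ℕ} {rho : unitInterval} {F : Sample n → ℝ} (hF : Measurable F)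
    (h : ∀ S : Finset (Fin n), Integrable (fun z => F (plant S, z)) (noiseLaw n)) :
    Integrable F (law n rho) := by
  rw [law_eq_sum, Measure.sum_fintype, integrable_finsetSum_measure]
  intro S _
  refine Integrable.smul_measure ?_ ENNReal.ofReal_ne_top
  rw [integrable_map_measure hF.aestronglyMeasurable (by fun_prop)]
  exact h S

/-- The expectation over signal and noise, as a finite sum over the planted set. -/
theorem integral_law {n : ℕ} {rho : unitInterval} {F : Sample n → ℝ} (hF : Measurable F)
    (h : ∀ S : Finset (Fin n), Integrable (fun z => F (plant S, z)) (noiseLaw n)) :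
    ∫ w, F w ∂(law n rho)
      = ∑ S : Finset (Fin n), plantWeight rho S * ∫ z, F (plant S, z) ∂(noiseLaw n) := by
  have hi : ∀ S : Finset (Fin n), Integrable F
      (ENNReal.ofReal (plantWeight rho S) • (noiseLaw n).map (Prod.mk (plant S))) := by
    intro S
    refine Integrable.smul_measure ?_ ENNReal.ofReal_ne_top
    rw [integrable_map_measure hF.aestronglyMeasurable (by fun_prop)]
    exact h S
  rw [law_eq_sum, Measure.sum_fintype, integral_finsetSum_measure fun S _ => hi S]
  refine Finset.sum_congr rfl fun S _ => ?_
  rw [integral_smul_measure, integral_map (by fun_prop) hF.aestronglyMeasurable,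
    ENNReal.toReal_ofReal (plantWeight_nonneg rho S), smul_eq_mul]

theorem sum_plantWeight_mul_prod {n : ℕ} (rho : unitInterval) (g : Fin n → ℝ → ℝ) :
    ∑ S : Finset (Fin n), plantWeight rho S * ∏ i, g i (plant S i)
      = ∏ i, ((rho : ℝ) * g i 1 + (1 - (rho : ℝ)) * g i 0) := by
  rw [Fintype.prod_add]
  refine Finset.sum_congr rfl fun S _ => ?_
  rw [Finset.prod_mul_distrib, Finset.prod_mul_distrib, plantWeight, ← Finset.prod_mul_prod_compl S]
  have h1 : ∏ i ∈ S, g i (plant S i) = ∏ i ∈ S, g i 1 :=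
    Finset.prod_congr rfl fun i hi => by simp [plant, hi]
  have h2 : ∏ i ∈ Sᶜ, g i (plant S i) = ∏ i ∈ Sᶜ, g i 0 :=
    Finset.prod_congr rfl fun i hi => by simp [plant, Finset.mem_compl.1 hi]
  rw [h1, h2]; ring

theorem obs_apply {n : ℕ} (lam : ℝ) (w : Sample n) (i j : Fin n) :
    obs lam w i j = lam * (w.1 i * w.1 j) + w.2 s(i, j) := by
  simp [obs, noise, Matrix.vecMulVec_apply]

theorem integral_estimand_sq {n : ℕ} (hn : 0 < n) (rho : unitInterval) :
    ∫ w, estimand w ^ 2 ∂(law n rho) = rho := by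
  rw [integral_law (measurable_estimand.pow_const 2)
    (fun S => by simp only [estimand, hn, dif_pos]; exact integrable_const _)]
  have h := sum_plantWeight_mul_prod rho
    (fun (i : Fin n) x => if i = ⟨0, hn⟩ then x ^ 2 else 1)
  have h2 : ∀ S : Finset (Fin n), ∫ z, estimand (plant S, z) ^ 2 ∂(noiseLaw n)
      = ∏ i, (if i = ⟨0, hn⟩ then plant S i ^ 2 else 1) := by
    intro S
    simp [estimand, hn]
  simp_rw [h2]
  rw [h, Finset.prod_eq_single ⟨0, hn⟩]
  · simp
  · intro i _ hi; simp [hi]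
  · simp

/-! ### Connected components of multigraphs -/

/-- The vertices covered by the edges of the multigraph with edge multiplicities `β`. -/
def verts {n : ℕ} (β : Sym2 (Fin n) → ℕ) : Finset (Fin n) :=
  Finset.univ.filter fun v => ∃ e, β e ≠ 0 ∧ v ∈ e

/-- The vertex `v` can be reached from `o` along edges of the multigraph `β`. -/
def Reach {n : ℕ} (β : Sym2 (Fin n) → ℕ) (o v : Fin n) : Prop :=
  Relation.ReflTransGen (fun u v => β s(u, v) ≠ 0) o v

/-- All edges of the multigraph `β` lie in the connected component of `o`. -/
def Conn {n : ℕ} (β : Sym2 (Fin n) → ℕ) (o : Fin n) : Prop :=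
  ∀ e, β e ≠ 0 → ∀ v ∈ e, Reach β o v

open Classical in
/-- The part of the multigraph `γ` that lies in the connected component of `o`. -/
noncomputable def compAt {n : ℕ} (γ : Sym2 (Fin n) → ℕ) (o : Fin n) : Sym2 (Fin n) → ℕ :=
  fun e => if ∃ v ∈ e, Reach γ o v then γ e else 0

theorem mem_verts {n : ℕ} {β : Sym2 (Fin n) → ℕ} {v : Fin n} :
    v ∈ verts β ↔ ∃ e, β e ≠ 0 ∧ v ∈ e := by simp [verts]

theorem Reach.mono {n : ℕ} {β γ : Sym2 (Fin n) → ℕ} {o v : Fin n} (h : Reach β o v)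
    (hle : ∀ e, β e ≤ γ e) : Reach γ o v :=
  Relation.ReflTransGen.mono (fun u v (huv : β s(u, v) ≠ 0) => by
    have := hle s(u, v); omega) _ _ h

theorem compAt_le {n : ℕ} (γ : Sym2 (Fin n) → ℕ) (o : Fin n) (e : Sym2 (Fin n)) :
    compAt γ o e ≤ γ e := by
  unfold compAt; split_ifs <;> simp

theorem reach_compAt {n : ℕ} {γ : Sym2 (Fin n) → ℕ} {o v : Fin n} (h : Reach γ o v) :
    Reach (compAt γ o) o v := by
  induction h with
  | refl => exact Relation.ReflTransGen.refl
  | @tail u v hu huv ih =>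
    refine ih.tail ?_
    rw [compAt, if_pos ⟨u, Sym2.mem_mk_left u v, hu⟩]
    exact huv

theorem conn_compAt {n : ℕ} (γ : Sym2 (Fin n) → ℕ) (o : Fin n) : Conn (compAt γ o) o := by
  intro e he v hv
  refine reach_compAt ?_
  unfold compAt at he
  split_ifs at he with h
  · obtain ⟨u, hu, hr⟩ := h
    by_cases huv : u = v
    · exact huv ▸ hr
    · have : e = s(u, v) := (Sym2.mem_and_mem_iff huv).1 ⟨hu, hv⟩
      subst this
      exact hr.tail he
  · exact absurd rfl he

theorem disjoint_compAt {n : ℕ} (γ : Sym2 (Fin n) → ℕ) (o : Fin n) :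
    Disjoint (insert o (verts (compAt γ o))) (verts fun e => γ e - compAt γ o e) := by
  rw [Finset.disjoint_left]
  intro v hv hv'
  have hr : Reach γ o v := by
    rcases Finset.mem_insert.1 hv with rfl | h
    · exact Relation.ReflTransGen.refl
    · obtain ⟨e, he, hve⟩ := mem_verts.1 h
      exact (conn_compAt γ o e he v hve).mono (compAt_le γ o)
  obtain ⟨e, he, hve⟩ := mem_verts.1 hv'
  refine he ?_
  rw [compAt, if_pos ⟨v, hve, hr⟩, Nat.sub_self]

/-- The component of `o` is the only sub-multigraph of `γ`, connected to `o`, whose vertices are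
not touched by the remaining edges. -/
theorem eq_compAt {n : ℕ} {β γ : Sym2 (Fin n) → ℕ} {o : Fin n} (hc : Conn β o)
    (hle : ∀ e, β e ≤ γ e) (hd : Disjoint (insert o (verts β)) (verts fun e => γ e - β e)) :
    β = compAt γ o := by
  have h0 : ∀ v ∈ insert o (verts β), ∀ e, v ∈ e → β e = γ e := by
    intro v hv e hve
    by_contra hne
    refine Finset.disjoint_left.1 hd hv (mem_verts.2 ⟨e, ?_, hve⟩)
    have := hle e; omega
  have h1 : ∀ v, Reach γ o v → v ∈ insert o (verts β) := by
    intro v h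
    induction h with
    | refl => exact Finset.mem_insert_self _ _
    | @tail u v _ huv ih =>
      refine Finset.mem_insert_of_mem (mem_verts.2 ⟨s(u, v), ?_, Sym2.mem_mk_right u v⟩)
      rw [h0 u ih _ (Sym2.mem_mk_left u v)]
      exact huv
  funext e
  unfold compAt
  split_ifs with h
  · obtain ⟨v, hv, hr⟩ := h
    exact h0 v (h1 v hr) e hv
  · by_contra hne
    induction e with
    | _ u v =>
      exact h ⟨u, Sym2.mem_mk_left u v, (hc _ hne u (Sym2.mem_mk_left u v)).mono hle⟩

/-- The product of the two entries of `θ` at the ends of an edge. -/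
def pairProd {n : ℕ} (θ : Fin n → ℝ) (e : Sym2 (Fin n)) : ℝ := (e.map θ).mul

theorem pairProd_plant_eq_one {n : ℕ} {S : Finset (Fin n)} {e : Sym2 (Fin n)}
    (h : ∀ v ∈ e, v ∈ S) : pairProd (plant S) e = 1 := by
  induction e with
  | _ u v => simp_all [pairProd, plant]

theorem pairProd_plant_eq_zero {n : ℕ} {S : Finset (Fin n)} {e : Sym2 (Fin n)} {v : Fin n}
    (hv : v ∈ e) (h : v ∉ S) : pairProd (plant S) e = 0 := by
  induction e with
  | _ u w => rcases Sym2.mem_iff.1 hv with rfl | rfl <;> simp [pairProd, plant, h]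

theorem prod_pairProd_plant_pow {n : ℕ} (S : Finset (Fin n)) (lam : ℝ) (m : Sym2 (Fin n) → ℕ) :
    ∏ e, (lam * pairProd (plant S) e) ^ m e
      = lam ^ (∑ e, m e) * ∏ v ∈ verts m, plant S v := by
  classical
  simp_rw [mul_pow]
  rw [Finset.prod_mul_distrib, Finset.prod_pow_eq_pow_sum]
  congr 1
  by_cases h : verts m ⊆ S
  · rw [Finset.prod_eq_one, Finset.prod_eq_one]
    · intro v hv; simp [plant, h hv]
    · intro e _
      by_cases he : m e = 0
      · simp [he]
      · rw [pairProd_plant_eq_one fun v hv => h (mem_verts.2 ⟨e, he, hv⟩), one_pow]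
  · obtain ⟨v, hv, hvS⟩ := Finset.not_subset.1 h
    rw [Finset.prod_eq_zero hv (by simp [plant, hvS])]
    obtain ⟨e, he, hve⟩ := mem_verts.1 hv
    refine Finset.prod_eq_zero (Finset.mem_univ e) ?_
    rw [pairProd_plant_eq_zero hve hvS, zero_pow he]

theorem sum_plantWeight_mul_prod_mul_prod {n : ℕ} (rho : unitInterval) (h1 : (rho : ℝ) < 1)
    (A B : Finset (Fin n)) :
    ∑ S : Finset (Fin n), plantWeight rho S *
      ((∏ v ∈ A, ((rho : ℝ) * (1 - plant S v) / (1 - rho))) * ∏ v ∈ B, plant S v)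
      = if Disjoint A B then (rho : ℝ) ^ (A ∪ B).card else 0 := by
  have hne : (1 - (rho : ℝ)) ≠ 0 := (sub_pos.2 h1).ne'
  have := sum_plantWeight_mul_prod rho fun (i : Fin n) x =>
    (if i ∈ A then (rho : ℝ) * (1 - x) / (1 - rho) else 1) * (if i ∈ B then x else 1)
  simp only [Finset.prod_mul_distrib, Finset.prod_ite_mem, Finset.univ_inter] at this
  rw [this]
  split_ifs with hd
  · rw [← Finset.prod_const, ← Finset.univ_inter (A ∪ B), ← Finset.prod_ite_mem]
    refine Finset.prod_congr rfl fun i _ => ?_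
    by_cases hA : i ∈ A
    · have hB : i ∉ B := Finset.disjoint_left.1 hd hA
      simp [hA, hB]; field_simp
    · by_cases hB : i ∈ B <;> simp [hA, hB]
  · rw [Finset.not_disjoint_iff] at hd
    obtain ⟨i, hA, hB⟩ := hd
    exact Finset.prod_eq_zero (Finset.mem_univ i) (by simp [hA, hB])

open Classical in
/-- The multigraphs with at most `D` edges, all in the connected component of `o`. -/
noncomputable def connGraphs (n D : ℕ) (o : Fin n) : Finset (Sym2 (Fin n) → ℕ) :=
  (Fintype.piFinset fun _ => Finset.range (D + 1)).filter fun β => ∑ e, β e ≤ D ∧ Conn β o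

theorem mem_connGraphs {n D : ℕ} {o : Fin n} {β : Sym2 (Fin n) → ℕ} :
    β ∈ connGraphs n D o ↔ ∑ e, β e ≤ D ∧ Conn β o := by
  classical
  rw [connGraphs, Finset.mem_filter, and_iff_right_iff_imp]
  refine fun h => Fintype.mem_piFinset.2 fun e => Finset.mem_range.2 ?_
  have : β e ≤ ∑ e, β e := Finset.single_le_sum (fun _ _ => Nat.zero_le _) (Finset.mem_univ e)
  omega

/-- The coefficient identity behind the dual certificate: of all connected multigraphs `β ≤ γ` only
the component of `o` contributes, since the factors `1 - θ_v` vanish when a vertex of `β` is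
touched by `γ - β`. -/
theorem sum_connGraphs_eq {n D : ℕ} (o : Fin n) (lam : ℝ) (rho : unitInterval)
    (h1 : (rho : ℝ) < 1) (γ : Sym2 (Fin n) → ℕ) (hγ : ∑ e, γ e ≤ D) :
    ∑ β ∈ connGraphs n D o, lam ^ (∑ e, β e) / (∏ e, ((β e).factorial : ℝ)) *
      ∑ S : Finset (Fin n), plantWeight rho S *
        ((∏ v ∈ insert o (verts β), ((rho : ℝ) * (1 - plant S v) / (1 - rho))) *
          ∏ e, (((γ e).descFactorial (β e) : ℝ) *
            (lam * pairProd (plant S) e) ^ (γ e - β e)))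
      = ∑ S : Finset (Fin n), plantWeight rho S *
        (plant S o * ∏ e, (lam * pairProd (plant S) e) ^ γ e) := by
  have hterm : ∀ β : Sym2 (Fin n) → ℕ,
      ∑ S : Finset (Fin n), plantWeight rho S *
        ((∏ v ∈ insert o (verts β), ((rho : ℝ) * (1 - plant S v) / (1 - rho))) *
          ∏ e, (((γ e).descFactorial (β e) : ℝ) *
            (lam * pairProd (plant S) e) ^ (γ e - β e)))
      = (∏ e, ((γ e).descFactorial (β e) : ℝ)) * lam ^ (∑ e, (γ e - β e)) *
        if Disjoint (insert o (verts β)) (verts fun e => γ e - β e) then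
          (rho : ℝ) ^ (insert o (verts β) ∪ verts fun e => γ e - β e).card else 0 := by
    intro β
    rw [← sum_plantWeight_mul_prod_mul_prod rho h1, Finset.mul_sum]
    refine Finset.sum_congr rfl fun S _ => ?_
    rw [Finset.prod_mul_distrib, prod_pairProd_plant_pow S lam fun e => γ e - β e]
    ring
  simp_rw [hterm]
  have hrhs : ∑ S : Finset (Fin n), plantWeight rho S *
        (plant S o * ∏ e, (lam * pairProd (plant S) e) ^ γ e)
      = lam ^ (∑ e, γ e) * (rho : ℝ) ^ (insert o (verts γ)).card := by
    have := sum_plantWeight_mul_prod_mul_prod rho h1 ∅ (insert o (verts γ))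
    simp only [Finset.prod_empty, one_mul, Finset.disjoint_empty_left, if_true,
      Finset.empty_union] at this
    rw [← this, Finset.mul_sum]
    refine Finset.sum_congr rfl fun S _ => ?_
    rw [prod_pairProd_plant_pow]
    have : plant S o * ∏ v ∈ verts γ, plant S v = ∏ v ∈ insert o (verts γ), plant S v := by
      by_cases ho : o ∈ verts γ
      · rw [Finset.insert_eq_of_mem ho, ← Finset.mul_prod_erase _ _ ho, ← mul_assoc]
        congr 1
        unfold plant; split_ifs <;> simp
      · rw [Finset.prod_insert ho]
    rw [← this]; ring
  rw [hrhs, Finset.sum_eq_single (compAt γ o)]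
  · rw [if_pos (disjoint_compAt γ o)]
    have hcase : ∀ e, compAt γ o e = 0 ∨ compAt γ o e = γ e := by
      intro e; unfold compAt; split_ifs <;> simp
    have e1 : (∏ e, ((γ e).descFactorial (compAt γ o e) : ℝ))
        = ∏ e, ((compAt γ o e).factorial : ℝ) := by
      refine Finset.prod_congr rfl fun e _ => ?_
      rcases hcase e with h | h
      · simp [h]
      · simp [h, Nat.descFactorial_self]
    have e2 : ∑ e, compAt γ o e + ∑ e, (γ e - compAt γ o e) = ∑ e, γ e := by
      rw [← Finset.sum_add_distrib]
      exact Finset.sum_congr rfl fun e _ => by have := compAt_le γ o e; omega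
    have e3 : insert o (verts (compAt γ o)) ∪ verts (fun e => γ e - compAt γ o e)
        = insert o (verts γ) := by
      ext v
      simp only [Finset.mem_union, Finset.mem_insert, mem_verts]
      constructor
      · rintro ((h | ⟨e, he, hv⟩) | ⟨e, he, hv⟩)
        · exact Or.inl h
        · exact Or.inr ⟨e, by have := compAt_le γ o e; omega, hv⟩
        · exact Or.inr ⟨e, by omega, hv⟩
      · rintro (h | ⟨e, he, hv⟩)
        · exact Or.inl (Or.inl h)
        · rcases hcase e with h | h
          · exact Or.inr ⟨e, by omega, hv⟩
          · exact Or.inl (Or.inr ⟨e, by omega, hv⟩)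
    rw [e1, e3, ← e2, pow_add]
    have hne : (∏ e, ((compAt γ o e).factorial : ℝ)) ≠ 0 :=
      Finset.prod_ne_zero_iff.2 fun e _ => by positivity
    field_simp
  · intro β hβ hne
    by_cases hle : ∀ e, β e ≤ γ e
    · rw [if_neg, mul_zero, mul_zero]
      exact fun hd => hne (eq_compAt (mem_connGraphs.1 hβ).2 hle hd)
    · push Not at hle
      obtain ⟨e, he⟩ := hle
      have h0 : (∏ e, ((γ e).descFactorial (β e) : ℝ)) = 0 :=
        Finset.prod_eq_zero (Finset.mem_univ e)
          (by rw [Nat.descFactorial_of_lt he, Nat.cast_zero])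
      rw [h0]
      ring
  · intro hnot
    exact absurd (mem_connGraphs.2 ⟨(Finset.sum_le_sum fun e _ => compAt_le γ o e).trans hγ,
      conn_compAt γ o⟩) hnot

/-! ### The dual certificate -/

/-- The coefficient of the Hermite product of index `β` in the dual certificate. -/
noncomputable def certCoeff {n : ℕ} (o : Fin n) (lam : ℝ) (rho : unitInterval)
    (β : Sym2 (Fin n) → ℕ) (θ : Fin n → ℝ) : ℝ :=
  lam ^ (∑ e, β e) / (∏ e, ((β e).factorial : ℝ)) *
    ∏ v ∈ insert o (verts β), ((rho : ℝ) * (1 - θ v) / (1 - rho))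

/-- The dual certificate: a function of signal and noise which has the same inner products with
low-degree polynomials in the observation as the estimand. -/
noncomputable def cert {n : ℕ} (D : ℕ) (o : Fin n) (lam : ℝ) (rho : unitInterval)
    (w : Sample n) : ℝ :=
  ∑ β ∈ connGraphs n D o, certCoeff o lam rho β w.1 * ∏ e, (realHermite (β e)).eval (w.2 e)

/-- The observation at an unordered pair. -/
noncomputable def obsEdge {n : ℕ} (lam : ℝ) (w : Sample n) (e : Sym2 (Fin n)) : ℝ :=
  lam * pairProd w.1 e + w.2 e

theorem obs_eq_obsEdge {n : ℕ} (lam : ℝ) (w : Sample n) (i j : Fin n) :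
    obs lam w i j = obsEdge lam w s(i, j) := by
  simp [obs_apply, obsEdge, pairProd]

theorem measurable_pairProd {n : ℕ} (e : Sym2 (Fin n)) :
    Measurable fun θ : Fin n → ℝ => pairProd θ e := by
  induction e with
  | _ u v => simp only [pairProd, Sym2.map_mk, Sym2.mul_mk]; fun_prop

@[fun_prop]
theorem measurable_obsEdge {n : ℕ} (lam : ℝ) (e : Sym2 (Fin n)) :
    Measurable fun w : Sample n => obsEdge lam w e := by
  unfold obsEdge
  exact (((measurable_pairProd e).comp measurable_fst).const_mul lam).add
    ((measurable_pi_apply e).comp measurable_snd)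

theorem measurable_cert {n : ℕ} (D : ℕ) (o : Fin n) (lam : ℝ) (rho : unitInterval) :
    Measurable (cert D o lam rho) := by
  unfold cert certCoeff
  refine Finset.measurable_fun_sum _ fun β _ => Measurable.mul ?_ ?_
  · fun_prop
  · refine Finset.measurable_fun_prod _ fun e _ => ?_
    exact (realHermite (β e)).continuous.measurable.comp (by fun_prop)

theorem integrable_prod_eval {n : ℕ} (p : Sym2 (Fin n) → Polynomial ℝ) :
    Integrable (fun z => ∏ e, (p e).eval (z e)) (noiseLaw n) :=
  Integrable.fintype_prod (f := fun e z => (p e).eval z) fun e => integrable_eval_gaussianReal (p e)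

theorem integral_prod_noiseLaw {n : ℕ} (f : Sym2 (Fin n) → ℝ → ℝ) :
    ∫ z, ∏ e, f e (z e) ∂(noiseLaw n) = ∏ e, ∫ x, f e x ∂(gaussianReal 0 1) :=
  integral_fintype_prod_eq_prod f

open Polynomial in
theorem integrable_hermite_mul_obsEdge {n : ℕ} (lam : ℝ) (S : Finset (Fin n))
    (β a : Sym2 (Fin n) → ℕ) :
    Integrable (fun z => (∏ e, (realHermite (β e)).eval (z e)) *
      ∏ e, obsEdge lam (plant S, z) e ^ a e) (noiseLaw n) := by
  have := integrable_prod_eval fun e : Sym2 (Fin n) =>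
    realHermite (β e) * (C (lam * pairProd (plant S) e) + X) ^ a e
  refine this.congr (ae_of_all _ fun z => ?_)
  simp [obsEdge, Finset.prod_mul_distrib]

theorem integrable_section_obsEdge_pow {n : ℕ} (lam : ℝ) (S : Finset (Fin n))
    (a : Sym2 (Fin n) → ℕ) (c : ℝ) :
    Integrable (fun z => c * ∏ e, obsEdge lam (plant S, z) e ^ a e) (noiseLaw n) := by
  refine ((integrable_hermite_mul_obsEdge lam S 0 a).const_mul c).congr (ae_of_all _ fun z => ?_)
  simp [realHermite]

theorem integrable_obsEdge_pow {n : ℕ} (lam : ℝ) (rho : unitInterval) (a : Sym2 (Fin n) → ℕ)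
    {G : (Fin n → ℝ) → ℝ} (hG : Measurable G) :
    Integrable (fun w => G w.1 * ∏ e, obsEdge lam w e ^ a e) (law n rho) := by
  refine integrable_law ?_ fun S => ?_
  · exact (hG.comp measurable_fst).mul
      (Finset.measurable_fun_prod _ fun e _ => (measurable_obsEdge lam e).pow_const _)
  · exact integrable_section_obsEdge_pow lam S a (G (plant S))

theorem cert_mul_obsEdge {n : ℕ} (D : ℕ) (o : Fin n) (lam : ℝ) (rho : unitInterval)
    (a : Sym2 (Fin n) → ℕ) (S : Finset (Fin n)) (z : Sym2 (Fin n) → ℝ) :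
    cert D o lam rho (plant S, z) * ∏ e, obsEdge lam (plant S, z) e ^ a e
      = ∑ β ∈ connGraphs n D o, certCoeff o lam rho β (plant S) *
        ((∏ e, (realHermite (β e)).eval (z e)) * ∏ e, obsEdge lam (plant S, z) e ^ a e) := by
  rw [cert, Finset.sum_mul]
  exact Finset.sum_congr rfl fun β _ => by ring

theorem integrable_cert_mul_obsEdge {n : ℕ} (D : ℕ) (o : Fin n) (lam : ℝ) (rho : unitInterval)
    (a : Sym2 (Fin n) → ℕ) :
    Integrable (fun w => cert D o lam rho w * ∏ e, obsEdge lam w e ^ a e) (law n rho) := by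
  refine integrable_law ?_ fun S => ?_
  · exact (measurable_cert D o lam rho).mul
      (Finset.measurable_fun_prod _ fun e _ => (measurable_obsEdge lam e).pow_const _)
  · simp_rw [cert_mul_obsEdge]
    exact integrable_finsetSum _ fun β _ =>
      (integrable_hermite_mul_obsEdge lam S β a).const_mul _

/-- The certificate and the estimand have the same inner product with every monomial of degree at
most `D`. -/
theorem integral_cert_mul_obsEdge {n : ℕ} (D : ℕ) (o : Fin n) (lam : ℝ) (rho : unitInterval)
    (h1 : (rho : ℝ) < 1) (a : Sym2 (Fin n) → ℕ) (ha : ∑ e, a e ≤ D) :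
    ∫ w, cert D o lam rho w * ∏ e, obsEdge lam w e ^ a e ∂(law n rho)
      = ∫ w, w.1 o * ∏ e, obsEdge lam w e ^ a e ∂(law n rho) := by
  choose κ hκ using exists_integral_realHermite_mul_add_pow
  have hz : ∀ (S : Finset (Fin n)) (β : Sym2 (Fin n) → ℕ),
      ∫ z, (∏ e, (realHermite (β e)).eval (z e)) * ∏ e, obsEdge lam (plant S, z) e ^ a e
        ∂(noiseLaw n)
      = ∑ γ ∈ Fintype.piFinset fun e => Finset.range (a e + 1), (∏ e, κ (a e) (γ e)) *
          ∏ e, (((γ e).descFactorial (β e) : ℝ) *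
            (lam * pairProd (plant S) e) ^ (γ e - β e)) := by
    intro S β
    simp_rw [← Finset.prod_mul_distrib, obsEdge]
    rw [integral_prod_noiseLaw fun e x => (realHermite (β e)).eval x *
      (lam * pairProd (plant S) e + x) ^ a e]
    simp_rw [hκ]
    rw [Finset.prod_univ_sum]
  have hz0 : ∀ (S : Finset (Fin n)),
      ∫ z, ∏ e, obsEdge lam (plant S, z) e ^ a e ∂(noiseLaw n)
      = ∑ γ ∈ Fintype.piFinset fun e => Finset.range (a e + 1), (∏ e, κ (a e) (γ e)) *
          ∏ e, (lam * pairProd (plant S) e) ^ γ e := by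
    intro S
    have := hz S 0
    simpa [realHermite] using this
  rw [integral_law (F := fun w => cert D o lam rho w * ∏ e, obsEdge lam w e ^ a e)
      ((measurable_cert D o lam rho).mul
      (Finset.measurable_fun_prod _ fun e _ => (measurable_obsEdge lam e).pow_const _))
      (fun S => ?_),
    integral_law (F := fun w => w.1 o * ∏ e, obsEdge lam w e ^ a e)
      (((measurable_pi_apply o).comp measurable_fst).mul
      (Finset.measurable_fun_prod _ fun e _ => (measurable_obsEdge lam e).pow_const _))
      (fun S => ?_)]
  · simp_rw [cert_mul_obsEdge]
    have e1 : ∀ S : Finset (Fin n), ∫ z, ∑ β ∈ connGraphs n D o, certCoeff o lam rho β (plant S) *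
        ((∏ e, (realHermite (β e)).eval (z e)) * ∏ e, obsEdge lam (plant S, z) e ^ a e)
          ∂(noiseLaw n)
        = ∑ β ∈ connGraphs n D o, certCoeff o lam rho β (plant S) *
          ∑ γ ∈ Fintype.piFinset fun e => Finset.range (a e + 1), (∏ e, κ (a e) (γ e)) *
          ∏ e, (((γ e).descFactorial (β e) : ℝ) *
            (lam * pairProd (plant S) e) ^ (γ e - β e)) := by
      intro S
      rw [integral_finsetSum _ fun β _ => (integrable_hermite_mul_obsEdge lam S β a).const_mul _]
      exact Finset.sum_congr rfl fun β _ => by rw [integral_const_mul, hz]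
    simp_rw [e1]
    have e2 : ∀ S : Finset (Fin n),
        ∫ z, plant S o * ∏ e, obsEdge lam (plant S, z) e ^ a e ∂(noiseLaw n)
        = ∑ γ ∈ Fintype.piFinset fun e => Finset.range (a e + 1), (∏ e, κ (a e) (γ e)) *
          (plant S o * ∏ e, (lam * pairProd (plant S) e) ^ γ e) := by
      intro S
      rw [integral_const_mul, hz0, Finset.mul_sum]
      exact Finset.sum_congr rfl fun γ _ => by ring
    simp_rw [e2, Finset.mul_sum]
    have e3 : ∀ γ ∈ Fintype.piFinset fun e => Finset.range (a e + 1), ∑ e, γ e ≤ D := by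
      intro γ hγ
      refine le_trans (Finset.sum_le_sum fun e _ => ?_) ha
      have := Finset.mem_range.1 (Fintype.mem_piFinset.1 hγ e)
      omega
    have e4 : ∀ γ ∈ Fintype.piFinset fun e => Finset.range (a e + 1),
        ∑ S : Finset (Fin n), plantWeight rho S * ((∏ e, κ (a e) (γ e)) *
          (plant S o * ∏ e, (lam * pairProd (plant S) e) ^ γ e))
        = ∑ β ∈ connGraphs n D o, ∑ S : Finset (Fin n), plantWeight rho S *
          (certCoeff o lam rho β (plant S) * ((∏ e, κ (a e) (γ e)) *
          ∏ e, (((γ e).descFactorial (β e) : ℝ) *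
            (lam * pairProd (plant S) e) ^ (γ e - β e)))) := by
      intro γ hγ
      have h := sum_connGraphs_eq o lam rho h1 γ (e3 γ hγ)
      calc _ = (∏ e, κ (a e) (γ e)) * ∑ S : Finset (Fin n), plantWeight rho S *
            (plant S o * ∏ e, (lam * pairProd (plant S) e) ^ γ e) := by
            rw [Finset.mul_sum]; exact Finset.sum_congr rfl fun S _ => by ring
        _ = _ := by
            rw [← h, Finset.mul_sum]
            refine Finset.sum_congr rfl fun β _ => ?_
            rw [Finset.mul_sum, Finset.mul_sum]
            refine Finset.sum_congr rfl fun S _ => ?_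
            rw [certCoeff]; ring
    refine (Finset.sum_comm.trans (Finset.sum_congr rfl fun β _ => Finset.sum_comm)).trans
      (Finset.sum_comm.trans ?_)
    refine Eq.trans ?_ Finset.sum_comm
    exact (Finset.sum_congr rfl e4).symm
  · exact integrable_section_obsEdge_pow lam S a (plant S o)
  · simp_rw [cert_mul_obsEdge]
    exact integrable_finsetSum _ fun β _ =>
      (integrable_hermite_mul_obsEdge lam S β a).const_mul _

theorem integrable_prod_realHermite_mul {n : ℕ} (β β' : Sym2 (Fin n) → ℕ) :
    Integrable (fun z => ∏ e, ((realHermite (β e)).eval (z e) * (realHermite (β' e)).eval (z e)))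
      (noiseLaw n) := by
  have := integrable_prod_eval fun e => realHermite (β e) * realHermite (β' e)
  simpa only [Polynomial.eval_mul] using this

/-- The orthogonality of products of Hermite polynomials in the noise. -/
theorem integral_prod_realHermite_mul {n : ℕ} (β β' : Sym2 (Fin n) → ℕ) :
    ∫ z, ∏ e, ((realHermite (β e)).eval (z e) * (realHermite (β' e)).eval (z e)) ∂(noiseLaw n)
      = if β = β' then ∏ e, ((β e).factorial : ℝ) else 0 := by
  rw [integral_prod_noiseLaw fun e x => (realHermite (β e)).eval x * (realHermite (β' e)).eval x]
  simp_rw [integral_realHermite_mul_realHermite]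
  split_ifs with h
  · subst h; simp
  · obtain ⟨e, he⟩ := Function.ne_iff.1 h
    exact Finset.prod_eq_zero (Finset.mem_univ e) (by simp [he])

theorem integral_cert_sq {n : ℕ} (D : ℕ) (o : Fin n) (lam : ℝ) (rho : unitInterval)
    (h1 : (rho : ℝ) < 1) :
    ∫ w, cert D o lam rho w ^ 2 ∂(law n rho)
      = ∑ β ∈ connGraphs n D o, (lam ^ 2) ^ (∑ e, β e) / (∏ e, ((β e).factorial : ℝ)) *
          ((rho : ℝ) ^ 2 / (1 - rho)) ^ (insert o (verts β)).card := by
  have hsq : ∀ S z, cert D o lam rho (plant S, z) ^ 2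
      = ∑ β ∈ connGraphs n D o, ∑ β' ∈ connGraphs n D o,
        (certCoeff o lam rho β (plant S) * certCoeff o lam rho β' (plant S)) *
          ∏ e, ((realHermite (β e)).eval (z e) * (realHermite (β' e)).eval (z e)) := by
    intro S z
    rw [sq, cert, Finset.sum_mul_sum]
    refine Finset.sum_congr rfl fun β _ => Finset.sum_congr rfl fun β' _ => ?_
    rw [Finset.prod_mul_distrib]; ring
  rw [integral_law ((measurable_cert D o lam rho).pow_const 2) fun S => ?_]
  · have hz : ∀ S : Finset (Fin n), ∫ z, cert D o lam rho (plant S, z) ^ 2 ∂(noiseLaw n)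
        = ∑ β ∈ connGraphs n D o, certCoeff o lam rho β (plant S) ^ 2
            * ∏ e, ((β e).factorial : ℝ) := by
      intro S
      simp_rw [hsq]
      rw [integral_finsetSum _ fun β _ => integrable_finsetSum _ fun β' _ =>
        (integrable_prod_realHermite_mul β β').const_mul _]
      refine Finset.sum_congr rfl fun β hβ => ?_
      rw [integral_finsetSum _ fun β' _ => (integrable_prod_realHermite_mul β β').const_mul _]
      simp_rw [integral_const_mul, integral_prod_realHermite_mul]
      rw [Finset.sum_eq_single β]
      · rw [if_pos rfl]; ring
      · intro β' _ hne; simp [Ne.symm hne]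
      · intro h; exact absurd hβ h
    simp_rw [hz, Finset.mul_sum]
    rw [Finset.sum_comm]
    refine Finset.sum_congr rfl fun β _ => ?_
    have hne : (1 - (rho : ℝ)) ≠ 0 := (sub_pos.2 h1).ne'
    have hp := sum_plantWeight_mul_prod rho fun (i : Fin n) x =>
      if i ∈ insert o (verts β) then ((rho : ℝ) * (1 - x) / (1 - rho)) ^ 2 else 1
    simp only [Finset.prod_ite_mem, Finset.univ_inter] at hp
    have hp2 : ∏ i : Fin n, ((rho : ℝ) * (if i ∈ insert o (verts β)
          then ((rho : ℝ) * (1 - 1) / (1 - rho)) ^ 2 else 1)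
        + (1 - (rho : ℝ)) * (if i ∈ insert o (verts β)
          then ((rho : ℝ) * (1 - 0) / (1 - rho)) ^ 2 else 1))
        = ((rho : ℝ) ^ 2 / (1 - rho)) ^ (insert o (verts β)).card := by
      have hA : ((rho : ℝ) ^ 2 / (1 - rho)) ^ (insert o (verts β)).card
          = ∏ i, if i ∈ insert o (verts β) then ((rho : ℝ) ^ 2 / (1 - rho)) else 1 := by
        rw [Finset.prod_ite_mem, Finset.univ_inter, Finset.prod_const]
      rw [hA]
      refine Finset.prod_congr rfl fun i _ => ?_
      by_cases hi : i ∈ insert o (verts β)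
      · simp only [hi, if_true]; field_simp; ring
      · simp only [hi, if_false]; ring
    rw [hp2] at hp
    rw [← hp, Finset.mul_sum]
    refine Finset.sum_congr rfl fun S _ => ?_
    rw [certCoeff, Finset.prod_pow, ← pow_mul, mul_comm 2, pow_mul]
    field_simp
  · simp_rw [hsq]
    exact integrable_finsetSum _ fun β _ => integrable_finsetSum _ fun β' _ =>
      (integrable_prod_realHermite_mul β β').const_mul _

theorem evalMatrix_obs_eq {n : ℕ} (lam : ℝ) (w : Sample n) (f : MvPolynomial (Fin n × Fin n) ℝ) :
    evalMatrix f (obs lam w) = ∑ d ∈ f.support, f.coeff d *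
      ∏ e, obsEdge lam w e ^ (∑ p with s(p.1, p.2) = e, d p) := by
  rw [evalMatrix, MvPolynomial.eval_eq']
  refine Finset.sum_congr rfl fun d _ => ?_
  congr 1
  rw [← Finset.prod_fiberwise (s := Finset.univ) (g := fun p : Fin n × Fin n => s(p.1, p.2))]
  refine Finset.prod_congr rfl fun e _ => ?_
  rw [← Finset.prod_pow_eq_pow_sum]
  refine Finset.prod_congr rfl fun p hp => ?_
  rw [obs_eq_obsEdge, (Finset.mem_filter.1 hp).2]

theorem integral_mul_cert_eq {n : ℕ} (hn : 0 < n) (D : ℕ) (lam : ℝ) (rho : unitInterval)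
    (h1 : (rho : ℝ) < 1) (f : MvPolynomial (Fin n × Fin n) ℝ) (hf : f.totalDegree ≤ D) :
    ∫ w, evalMatrix f (obs lam w) * estimand w ∂(law n rho)
      = ∫ w, evalMatrix f (obs lam w) * cert D ⟨0, hn⟩ lam rho w ∂(law n rho) := by
  simp_rw [evalMatrix_obs_eq, estimand, hn, dif_pos, Finset.sum_mul]
  have h3 : ∀ (d : Fin n × Fin n →₀ ℕ) (w : Sample n) (x : ℝ),
      f.coeff d * (∏ e, obsEdge lam w e ^ (∑ p with s(p.1, p.2) = e, d p)) * x
      = f.coeff d * (x * ∏ e, obsEdge lam w e ^ (∑ p with s(p.1, p.2) = e, d p)) := by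
    intros; ring
  simp_rw [h3]
  rw [integral_finsetSum _ fun d _ => (integrable_obsEdge_pow lam rho _
      (measurable_pi_apply (⟨0, hn⟩ : Fin n))).const_mul _,
    integral_finsetSum _ fun d _ => (integrable_cert_mul_obsEdge D _ lam rho _).const_mul _]
  refine Finset.sum_congr rfl fun d hd => ?_
  rw [integral_const_mul, integral_const_mul, integral_cert_mul_obsEdge D _ lam rho h1]
  refine le_trans (le_of_eq ?_) ((MvPolynomial.le_totalDegree hd).trans hf)
  rw [Finset.sum_fiberwise, Finsupp.sum_fintype]
  simp

/-- The squared norm of the dual certificate bounds all low-degree correlations. -/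
theorem corrOf_le_sqrt_cert {n : ℕ} (hn : 0 < n) (D : ℕ) (lam : ℝ) (rho : unitInterval)
    (h0 : 0 < (rho : ℝ)) (h1 : (rho : ℝ) < 1)
    (f : MvPolynomial (Fin n × Fin n) ℝ) (hf : f.totalDegree ≤ D) {U : ℝ} (hU : 0 < U)
    (hle : ∫ w, cert D (⟨0, hn⟩ : Fin n) lam rho w ^ 2 ∂(law n rho) ≤ U) :
    corrOf n lam rho f ≤ √(U / rho) := by
  rw [corrOf, integral_estimand_sq hn, integral_mul_cert_eq hn D lam rho h1 f hf]
  set A := ∫ w, evalMatrix f (obs lam w) ^ 2 ∂(law n rho) with hA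
  set B := ∫ w, cert D (⟨0, hn⟩ : Fin n) lam rho w ^ 2 ∂(law n rho) with hB
  have hA0 : 0 ≤ A := integral_nonneg fun w => sq_nonneg _
  rcases hA0.eq_or_lt with hA' | hApos
  · rw [← hA']; simp
  have hcs := integral_mul_div_le_one (law n rho)
    (measurable_evalMatrix_obs lam f).aestronglyMeasurable
    (measurable_cert D (⟨0, hn⟩ : Fin n) lam rho).aestronglyMeasurable
  have hBpos : 0 < B := by
    rw [hB, integral_cert_sq D _ lam rho h1]
    refine Finset.sum_pos' (fun β _ => ?_) ⟨0, ?_, ?_⟩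
    · have : 0 < 1 - (rho : ℝ) := sub_pos.2 h1
      positivity
    · exact mem_connGraphs.2 ⟨by simp, fun e he => absurd rfl he⟩
    · have : 0 < 1 - (rho : ℝ) := sub_pos.2 h1
      simp only [Pi.zero_apply, Finset.sum_const_zero, pow_zero, Nat.factorial_zero, Nat.cast_one,
        Finset.prod_const_one, div_one, one_mul]
      positivity
  rw [div_le_one (Real.sqrt_pos.2 (mul_pos hApos hBpos))] at hcs
  rw [div_le_iff₀ (Real.sqrt_pos.2 (mul_pos hApos h0)), ← Real.sqrt_mul (by positivity)]
  refine hcs.trans (Real.sqrt_le_sqrt ?_)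
  have : U / rho * (A * rho) = A * U := by field_simp
  rw [this]
  exact mul_le_mul_of_nonneg_left hle hA0

/-! ### The norm of the dual certificate below the threshold -/

theorem sum_le_sum_of_cover {α ι : Type*} {s : Finset α} {I : Finset ι} (t : ι → Finset α)
    (F : α → ℝ) (hF : ∀ a, 0 ≤ F a) (h : ∀ a ∈ s, ∃ i ∈ I, a ∈ t i) :
    ∑ a ∈ s, F a ≤ ∑ i ∈ I, ∑ a ∈ t i, F a := by
  classical
  calc ∑ a ∈ s, F a ≤ ∑ a ∈ s, ∑ i ∈ I, if a ∈ t i then F a else 0 := by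
        refine Finset.sum_le_sum fun a ha => ?_
        obtain ⟨i, hi, hai⟩ := h a ha
        refine le_trans (le_of_eq (if_pos hai).symm)
          (Finset.single_le_sum (f := fun i => if a ∈ t i then F a else 0) (fun j _ => ?_) hi)
        split_ifs
        exacts [hF a, le_rfl]
    _ = ∑ i ∈ I, ∑ a ∈ s, if a ∈ t i then F a else 0 := Finset.sum_comm
    _ ≤ ∑ i ∈ I, ∑ a ∈ t i, F a := by
        refine Finset.sum_le_sum fun i _ => ?_
        rw [← Finset.sum_filter]
        exact Finset.sum_le_sum_of_subset_of_nonneg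
          (fun a ha => (Finset.mem_filter.1 ha).2) fun a _ _ => hF a

/-- The vertex `v` is the end of a walk of length `k` from `o` in the multigraph `β`. -/
def ReachIn {n : ℕ} (β : Sym2 (Fin n) → ℕ) (o : Fin n) : ℕ → Fin n → Prop
  | 0, v => v = o
  | k + 1, v => ∃ u, ReachIn β o k u ∧ β s(u, v) ≠ 0

/-- Every multigraph in which all edges are connected to `o` has a spanning tree, given here by a
parent function along which some rank decreases. -/
theorem Conn.exists_parent {n : ℕ} {β : Sym2 (Fin n) → ℕ} {o : Fin n} (hc : Conn β o) :
    ∃ (par : Fin n → Fin n) (rank : Fin n → ℕ), ∀ x ∈ (verts β).erase o,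
      β s(x, par x) ≠ 0 ∧ rank (par x) < rank x := by
  classical
  have hR : ∀ v, Reach β o v → ∃ k, ReachIn β o k v := by
    intro v h
    induction h with
    | refl => exact ⟨0, rfl⟩
    | @tail u v _ huv ih =>
      obtain ⟨k, hk⟩ := ih
      exact ⟨k + 1, u, hk, huv⟩
  let rank : Fin n → ℕ := fun v => if h : ∃ k, ReachIn β o k v then Nat.find h else 0
  have hstep : ∀ x ∈ (verts β).erase o, ∃ u, β s(x, u) ≠ 0 ∧ rank u < rank x := by
    intro x hx
    obtain ⟨hxo, hx⟩ := Finset.mem_erase.1 hx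
    obtain ⟨e, he, hxe⟩ := mem_verts.1 hx
    have hk := hR x (hc e he x hxe)
    have hrx : rank x = Nat.find hk := dif_pos hk
    have hspec := Nat.find_spec hk
    rcases hm : Nat.find hk with _ | m
    · rw [hm] at hspec; exact absurd hspec hxo
    · rw [hm] at hspec
      obtain ⟨u, hu, hux⟩ := hspec
      refine ⟨u, by rwa [Sym2.eq_swap], ?_⟩
      have hu' : ∃ k, ReachIn β o k u := ⟨m, hu⟩
      have hru : rank u = Nat.find hu' := dif_pos hu'
      have := Nat.find_min' hu' hu
      omega
  choose! par hpar using hstep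
  exact ⟨par, rank, hpar⟩

/-- Parent functions on `A` with values in `A ∪ {o}`; the irrelevant values are set to `o`. -/
noncomputable def parents {n : ℕ} (o : Fin n) (A : Finset (Fin n)) : Finset (Fin n → Fin n) :=
  Fintype.piFinset fun x => if x ∈ A then insert o A else {o}

theorem card_parents {n : ℕ} (o : Fin n) (A : Finset (Fin n)) (ho : o ∉ A) :
    (parents o A).card = (A.card + 1) ^ A.card := by
  rw [parents, Fintype.card_piFinset]
  simp only [apply_ite Finset.card, Finset.card_insert_of_notMem ho, Finset.card_singleton,
    Finset.prod_ite_mem, Finset.univ_inter, Finset.prod_const]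

/-- The multigraphs on `A ∪ {o}` with edge multiplicities at most `D` that contain the edges of the
parent function `p`. -/
noncomputable def graphsAbove {n : ℕ} (D : ℕ) (o : Fin n) (A : Finset (Fin n)) (p : Fin n → Fin n) :
    Finset (Sym2 (Fin n) → ℕ) :=
  Fintype.piFinset fun e => if e ∈ A.image fun x => s(x, p x) then Finset.Icc 1 D
    else if e ∈ (insert o A).sym2 then Finset.range (D + 1) else {0}

theorem exists_mem_graphsAbove {n D : ℕ} {o : Fin n} {β : Sym2 (Fin n) → ℕ}
    (hβ : β ∈ connGraphs n D o) : ∃ p ∈ parents o ((verts β).erase o),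
      Set.InjOn (fun x => s(x, p x)) ((verts β).erase o : Set (Fin n)) ∧
      β ∈ graphsAbove D o ((verts β).erase o) p := by
  obtain ⟨hD, hc⟩ := mem_connGraphs.1 hβ
  obtain ⟨p, rank, hp⟩ := hc.exists_parent
  set A := (verts β).erase o with hA
  have hle : ∀ e, β e ≤ D := fun e =>
    (Finset.single_le_sum (fun _ _ => Nat.zero_le _) (Finset.mem_univ e)).trans hD
  have hsub : ∀ v e, β e ≠ 0 → v ∈ e → v ∈ insert o A := by
    intro v e he hv
    by_cases hvo : v = o
    · simp [hvo]
    · exact Finset.mem_insert_of_mem (Finset.mem_erase.2 ⟨hvo, mem_verts.2 ⟨e, he, hv⟩⟩)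
  refine ⟨fun x => if x ∈ A then p x else o, ?_, ?_, ?_⟩
  · refine Fintype.mem_piFinset.2 fun x => ?_
    split_ifs with hx
    · exact hsub _ _ (hp x hx).1 (Sym2.mem_mk_right _ _)
    · simp
  · intro x hx y hy hxy
    rw [Finset.mem_coe] at hx hy
    simp only [hx, hy, if_true] at hxy
    rcases Sym2.eq_iff.1 hxy with h | ⟨h1, h2⟩
    · exact h.1
    · have h3 := (hp x hx).2
      have h4 := (hp y hy).2
      rw [h2] at h3; rw [← h1] at h4; omega
  · refine Fintype.mem_piFinset.2 fun e => ?_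
    split_ifs with h1 h2
    · obtain ⟨x, hx, rfl⟩ := Finset.mem_image.1 h1
      simp only [hx, if_true]
      exact Finset.mem_Icc.2 ⟨Nat.one_le_iff_ne_zero.2 (hp x hx).1, hle _⟩
    · exact Finset.mem_range.2 (Nat.lt_succ_of_le (hle e))
    · rw [Finset.mem_singleton]
      by_contra hne
      exact h2 (Finset.mem_sym2_iff.2 fun v hv => hsub v e hne hv)

theorem sum_graphsAbove_le {n D : ℕ} (o : Fin n) (A : Finset (Fin n)) (p : Fin n → Fin n)
    (hinj : Set.InjOn (fun x => s(x, p x)) (A : Set (Fin n))) (ho : o ∉ A) {t : ℝ} (ht : 0 ≤ t) :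
    ∑ β ∈ graphsAbove D o A p, t ^ (∑ e, β e) / (∏ e, ((β e).factorial : ℝ))
      ≤ (t * Real.exp t) ^ A.card * Real.exp t ^ ((A.card + 2).choose 2) := by
  have h0 : ∀ β : Sym2 (Fin n) → ℕ, t ^ (∑ e, β e) / (∏ e, ((β e).factorial : ℝ))
      = ∏ e, t ^ β e / ((β e).factorial : ℝ) := by
    intro β
    rw [Finset.prod_div_distrib, Finset.prod_pow_eq_pow_sum]
  have hexp : ∀ N, ∑ m ∈ Finset.range N, t ^ m / (m.factorial : ℝ) ≤ Real.exp t :=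
    fun N => Real.sum_le_exp_of_nonneg ht N
  have hIcc : ∑ m ∈ Finset.Icc 1 D, t ^ m / (m.factorial : ℝ) ≤ t * Real.exp t := by
    have : ∑ m ∈ Finset.Icc 1 D, t ^ m / (m.factorial : ℝ)
        = ∑ m ∈ Finset.range D, t ^ (m + 1) / ((m + 1).factorial : ℝ) := by
      rw [Finset.range_eq_Ico, Finset.sum_Ico_add' (fun m => t ^ m / (m.factorial : ℝ)) 0 D 1]
      rfl
    rw [this]
    refine le_trans ?_ (mul_le_mul_of_nonneg_left (hexp D) ht)
    rw [Finset.mul_sum]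
    refine Finset.sum_le_sum fun m _ => ?_
    rw [pow_succ', mul_div_assoc]
    refine mul_le_mul_of_nonneg_left ?_ ht
    gcongr
    omega
  simp_rw [h0]
  rw [graphsAbove, ← Finset.prod_univ_sum
    (f := fun (_ : Sym2 (Fin n)) (m : ℕ) => t ^ m / (m.factorial : ℝ))]
  calc _ ≤ ∏ e : Sym2 (Fin n), (if e ∈ A.image (fun x => s(x, p x)) then t * Real.exp t else 1) *
        (if e ∈ (insert o A).sym2 then Real.exp t else 1) := by
        refine Finset.prod_le_prod (fun e _ => Finset.sum_nonneg fun m _ => by positivity)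
          fun e _ => ?_
        have h1 : (1 : ℝ) ≤ Real.exp t := Real.one_le_exp ht
        have h2 : 0 ≤ t * Real.exp t := by positivity
        split_ifs with h1 h2
        · exact hIcc.trans (le_mul_of_one_le_right (by positivity) (by assumption))
        · simpa using hIcc
        · simpa using hexp (D + 1)
        · simp
    _ = _ := by
        rw [Finset.prod_mul_distrib, Finset.prod_ite_mem, Finset.prod_ite_mem, Finset.univ_inter,
          Finset.univ_inter, Finset.prod_const, Finset.prod_const, Finset.card_image_of_injOn hinj,
          Finset.card_sym2, Finset.card_insert_of_notMem ho]

theorem add_pow_le_exp_mul_factorial (b c : ℕ) :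
    ((b + c : ℕ) : ℝ) ^ b ≤ Real.exp 1 ^ (b + c) * b.factorial := by
  have h := Real.pow_div_factorial_le_exp ((b + c : ℕ) : ℝ) (Nat.cast_nonneg _) b
  rw [div_le_iff₀ (by positivity)] at h
  rwa [← Real.exp_nat_mul, mul_one]

theorem sum_connGraphs_fiber_le {n D : ℕ} (o : Fin n) (A : Finset (Fin n)) (ho : o ∉ A) {t : ℝ}
    (ht : 0 ≤ t) :
    ∑ β ∈ connGraphs n D o with (verts β).erase o = A,
        t ^ (∑ e, β e) / (∏ e, ((β e).factorial : ℝ))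
      ≤ ((A.card : ℝ) + 1) ^ A.card *
        ((t * Real.exp t) ^ A.card * Real.exp t ^ ((A.card + 2).choose 2)) := by
  classical
  obtain ⟨P, hP⟩ : ∃ P : Finset (Fin n → Fin n), P = (parents o A).filter fun p =>
    Set.InjOn (fun x => s(x, p x)) (A : Set (Fin n)) := ⟨_, rfl⟩
  have hmemP : ∀ p, p ∈ P ↔ p ∈ parents o A ∧
      Set.InjOn (fun x => s(x, p x)) (A : Set (Fin n)) := fun p => by rw [hP, Finset.mem_filter]
  calc _ ≤ ∑ p ∈ P, ∑ β ∈ graphsAbove D o A p,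
          t ^ (∑ e, β e) / (∏ e, ((β e).factorial : ℝ)) := by
        refine sum_le_sum_of_cover (graphsAbove D o A)
          (fun β => t ^ (∑ e, β e) / (∏ e, ((β e).factorial : ℝ)))
          (fun β => by positivity) fun β hβ => ?_
        obtain ⟨hβ, hA⟩ := Finset.mem_filter.1 hβ
        obtain ⟨p, hp, hinj, hmem⟩ := exists_mem_graphsAbove hβ
        rw [hA] at hp hinj hmem
        exact ⟨p, (hmemP p).2 ⟨hp, hinj⟩, hmem⟩
    _ ≤ ∑ p ∈ P, ((t * Real.exp t) ^ A.card * Real.exp t ^ ((A.card + 2).choose 2)) :=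
        Finset.sum_le_sum fun p hp => sum_graphsAbove_le o A p ((hmemP p).1 hp).2 ho ht
    _ ≤ _ := by
        rw [Finset.sum_const, nsmul_eq_mul]
        refine mul_le_mul_of_nonneg_right ?_ (by positivity)
        have : P.card ≤ (A.card + 1) ^ A.card := by
          rw [hP]
          exact (Finset.card_filter_le _ _).trans (card_parents o A ho).le
        exact_mod_cast this

/-- The squared norm of the dual certificate: trees dominate, and their exponential growth rate
`e n` is beaten by the weight per edge. -/
theorem sum_connGraphs_le {n D : ℕ} (hn : 0 < n) (o : Fin n) {t κ η r : ℝ} (ht : 0 ≤ t) (hκ : 0 ≤ κ)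
    (hη : t ≤ η) (hD : t * D ≤ η)
    (hr : Real.exp 1 * n * κ * t * Real.exp (3 * η) ≤ r) (hr1 : r < 1) :
    ∑ β ∈ connGraphs n D o, t ^ (∑ e, β e) / (∏ e, ((β e).factorial : ℝ)) *
        κ ^ (insert o (verts β)).card
      ≤ κ * (Real.exp (1 + η) / (1 - r)) := by
  classical
  let F : (Sym2 (Fin n) → ℕ) → ℝ := fun β =>
    t ^ (∑ e, β e) / (∏ e, ((β e).factorial : ℝ))
  let V : Finset (Finset (Fin n)) := (Finset.univ.erase o).powerset
  let B : ℕ → ℝ := fun v => κ ^ (v + 1) * (((v : ℝ) + 1) ^ v *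
    ((t * Real.exp t) ^ v * Real.exp t ^ ((v + 2).choose 2)))
  have hle : ∀ β ∈ connGraphs n D o, ((verts β).erase o).card ≤ D := by
    intro β hβ
    obtain ⟨p, hp, hinj, hmem⟩ := exists_mem_graphsAbove hβ
    refine le_trans ?_ (mem_connGraphs.1 hβ).1
    rw [← Finset.card_image_of_injOn hinj, Finset.card_eq_sum_ones]
    refine le_trans (Finset.sum_le_sum fun e he => ?_)
      (Finset.sum_le_sum_of_subset (Finset.subset_univ _))
    have := Fintype.mem_piFinset.1 hmem e
    rw [if_pos he] at this
    exact (Finset.mem_Icc.1 this).1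
  have hcard : ∀ β, (insert o (verts β)).card = ((verts β).erase o).card + 1 := by
    intro β
    by_cases h : o ∈ verts β
    · rw [Finset.insert_eq_of_mem h, Finset.card_erase_add_one h]
    · rw [Finset.card_insert_of_notMem h, Finset.erase_eq_of_notMem h]
  have step1 : ∑ β ∈ connGraphs n D o, F β * κ ^ (insert o (verts β)).card
      ≤ ∑ A ∈ V.filter fun A => A.card ≤ D, B A.card := by
    rw [← Finset.sum_fiberwise_of_maps_to (t := V.filter fun A => A.card ≤ D)
      (g := fun β => (verts β).erase o)]
    · refine Finset.sum_le_sum fun A hA => ?_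
      have hoA : o ∉ A := fun h =>
        Finset.notMem_erase o _ (Finset.mem_powerset.1 (Finset.mem_filter.1 hA).1 h)
      refine le_trans (le_of_eq ?_)
        (mul_le_mul_of_nonneg_left (sum_connGraphs_fiber_le (D := D) o A hoA ht)
          (show (0 : ℝ) ≤ κ ^ (A.card + 1) by positivity))
      rw [Finset.mul_sum]
      refine Finset.sum_congr rfl fun β hβ => ?_
      rw [hcard, (Finset.mem_filter.1 hβ).2]; ring
    · intro β hβ
      exact Finset.mem_filter.2 ⟨Finset.mem_powerset.2
        (Finset.erase_subset_erase _ (Finset.subset_univ _)), hle β hβ⟩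
  have hr0 : 0 ≤ r := le_trans (by positivity) hr
  have step2 : ∀ v ≤ D, (n : ℝ) ^ v / v.factorial * B v ≤ κ * Real.exp (1 + η) * r ^ v := by
    intro v hv
    have hvD : (v : ℝ) ≤ D := by exact_mod_cast hv
    have htv : t * v ≤ η := (mul_le_mul_of_nonneg_left hvD ht).trans hD
    have hexp : Real.exp t ^ v * Real.exp t ^ ((v + 2).choose 2)
        ≤ Real.exp η * Real.exp (3 * η) ^ v := by
      rw [← pow_add, ← Real.exp_nat_mul, ← Real.exp_nat_mul, ← Real.exp_add]
      refine Real.exp_le_exp.2 ?_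
      have h2 : ((v + 2).choose 2 : ℝ) = ((v : ℝ) + 2) * (v + 1) / 2 := by
        rw [Nat.cast_choose_two]; push_cast; ring
      rw [Nat.cast_add, h2]
      have hv0 : (0 : ℝ) ≤ v := Nat.cast_nonneg v
      nlinarith [mul_le_mul_of_nonneg_right htv hv0, mul_le_mul_of_nonneg_right hη hv0]
    have hfac := add_pow_le_exp_mul_factorial v 1
    push_cast at hfac
    have hfpos : (0 : ℝ) < v.factorial := by positivity
    calc (n : ℝ) ^ v / v.factorial * B v
        = (((v : ℝ) + 1) ^ v / v.factorial) * (κ * (n * κ * t) ^ v) *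
          (Real.exp t ^ v * Real.exp t ^ ((v + 2).choose 2)) := by
          simp only [B, mul_pow, pow_succ]; ring
      _ ≤ (Real.exp 1 ^ (v + 1)) * (κ * (n * κ * t) ^ v) *
          (Real.exp η * Real.exp (3 * η) ^ v) := by
          refine mul_le_mul (mul_le_mul_of_nonneg_right ?_ (by positivity)) hexp (by positivity)
            (by positivity)
          rwa [div_le_iff₀ hfpos]
      _ = κ * Real.exp (1 + η) * (Real.exp 1 * n * κ * t * Real.exp (3 * η)) ^ v := by
          rw [Real.exp_add]; simp only [mul_pow, pow_succ]; ring
      _ ≤ κ * Real.exp (1 + η) * r ^ v := by gcongr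
  calc _ ≤ ∑ A ∈ V.filter fun A => A.card ≤ D, B A.card := step1
    _ = ∑ A ∈ V, if A.card ≤ D then B A.card else 0 := by rw [Finset.sum_filter]
    _ = ∑ v ∈ Finset.range (n - 1 + 1), (n - 1).choose v • (if v ≤ D then B v else 0) := by
        have := Finset.sum_powerset_apply_card (fun v => if v ≤ D then B v else 0)
          (x := Finset.univ.erase o)
        rw [Finset.card_erase_of_mem (Finset.mem_univ o), Finset.card_fin] at this
        exact this
    _ ≤ ∑ v ∈ Finset.range (n - 1 + 1), κ * Real.exp (1 + η) * r ^ v := by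
        refine Finset.sum_le_sum fun v _ => ?_
        split_ifs with hv
        · refine le_trans ?_ (step2 v hv)
          rw [nsmul_eq_mul]
          refine mul_le_mul_of_nonneg_right ?_ (by positivity)
          refine (Nat.choose_le_pow_div v (n - 1)).trans ?_
          gcongr
          omega
        · simp only [smul_zero]; positivity
    _ ≤ κ * (Real.exp (1 + η) / (1 - r)) := by
        rw [← Finset.mul_sum, mul_assoc, div_eq_mul_inv]
        refine mul_le_mul_of_nonneg_left (mul_le_mul_of_nonneg_left ?_ (Real.exp_pos _).le) hκ
        rw [← tsum_geometric_of_lt_one hr0 hr1]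
        exact (summable_geometric_of_lt_one hr0 hr1).sum_le_tsum _ fun v _ => by positivity

/-- Below the threshold, the correlation is of order `√(ρ / (1 - ρ))`. -/
theorem corr_le_of_below_threshold {n D : ℕ} (hn : 1 ≤ n) {lam : ℝ} {rho : unitInterval} {C r : ℝ}
    (h0 : 0 < (rho : ℝ)) (h1 : (rho : ℝ) < 1) (hC1 : 1 ≤ C) (hr1 : r < 1)
    (hr : Real.exp 1 * n * ((rho : ℝ) ^ 2 / (1 - rho)) * lam ^ 2 * Real.exp (3 * (1 / C)) ≤ r)
    (hC : Real.exp 2 / (1 - r) ≤ C ^ 2) (hD : lam = 0 ∨ (D : ℝ) ≤ (lam ^ 2)⁻¹ / C) :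
    corr n lam rho D ≤ C * √((rho : ℝ) / (1 - rho)) := by
  have hCpos : 0 < C := by linarith
  have hκ : 0 < (rho : ℝ) ^ 2 / (1 - rho) := by positivity
  -- the degree bound is needed only when `D ≥ 1`; for `D = 0` the sum does not depend on `lam`
  have hU : ∫ w, cert D (⟨0, hn⟩ : Fin n) lam rho w ^ 2 ∂(law n rho)
      ≤ (rho : ℝ) ^ 2 / (1 - rho) * (Real.exp (1 + 1 / C) / (1 - r)) := by
    rw [integral_cert_sq D _ lam rho h1]
    by_cases hD0 : D = 0
    · subst hD0
      have hr' : 0 ≤ r := le_trans (by positivity) hr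
      have := sum_connGraphs_le (D := 0) hn (⟨0, hn⟩ : Fin n) (t := 0) (η := 1 / C) (r := r) le_rfl
        hκ.le (by positivity) (by simp; positivity) (by simpa using hr') hr1
      refine le_trans (le_of_eq ?_) this
      refine Finset.sum_congr rfl fun β hβ => ?_
      have hz : ∑ e, β e = 0 := Nat.le_zero.1 (mem_connGraphs.1 hβ).1
      rw [hz]; simp
    · have hD1 : (1 : ℝ) ≤ D := by exact_mod_cast Nat.one_le_iff_ne_zero.2 hD0
      have hlD : lam ^ 2 * D ≤ 1 / C := by
        rcases hD with h | h
        · rw [h]; simp; positivity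
        · by_cases hl : lam = 0
          · rw [hl]; simp; positivity
          · have hl2 : 0 < lam ^ 2 := by positivity
            calc lam ^ 2 * D ≤ lam ^ 2 * ((lam ^ 2)⁻¹ / C) := by gcongr
              _ = 1 / C := by field_simp
      refine sum_connGraphs_le hn _ (sq_nonneg _) hκ.le ?_ hlD hr hr1
      exact (le_mul_of_one_le_right (sq_nonneg _) hD1).trans hlD
  have : Nonempty {f : MvPolynomial (Fin n × Fin n) ℝ // f.totalDegree ≤ D} := ⟨⟨0, by simp⟩⟩
  refine ciSup_le fun f => ?_
  refine (corrOf_le_sqrt_cert hn D lam rho h0 h1 f.1 f.2 (by positivity) hU).trans ?_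
  have e0 : C * √((rho : ℝ) / (1 - rho)) = √(C ^ 2 * ((rho : ℝ) / (1 - rho))) := by
    rw [Real.sqrt_mul (sq_nonneg _), Real.sqrt_sq hCpos.le]
  rw [e0]
  refine Real.sqrt_le_sqrt ?_
  have e1 : (rho : ℝ) ^ 2 / (1 - rho) * (Real.exp (1 + 1 / C) / (1 - r)) / rho
      = (Real.exp (1 + 1 / C) / (1 - r)) * (rho / (1 - rho)) := by field_simp
  rw [e1]
  refine mul_le_mul_of_nonneg_right (le_trans ?_ hC) (by positivity)
  gcongr
  have : 1 / C ≤ 1 := by rw [div_le_one hCpos]; exact hC1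
  linarith

/-! ### Counting rooted forests and pairs of branches -/

section Forests
variable {α : Type*} [Fintype α] [DecidableEq α]

open Classical in
/-- The forests with vertex set `M ∪ R` and root set `R`, as parent functions: every vertex of `M`
is sent to its parent, and all other elements are fixed. -/
noncomputable def forests (M R : Finset α) : Finset (α → α) :=
  Finset.univ.filter fun p => (∀ x ∉ M, p x = x) ∧ (∀ x ∈ M, p x ∈ M ∪ R) ∧
    ∀ x ∈ M, ∃ m, p^[m] x ∈ R

theorem mem_forests {M R : Finset α} {p : α → α} : p ∈ forests M R ↔
    (∀ x ∉ M, p x = x) ∧ (∀ x ∈ M, p x ∈ M ∪ R) ∧ ∀ x ∈ M, ∃ m, p^[m] x ∈ R := by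
  simp [forests]

theorem forests_empty (R : Finset α) : forests ∅ R = {id} := by
  ext p
  simp [mem_forests, funext_iff]

theorem forests_empty_right {M : Finset α} (hM : M.Nonempty) : forests M (∅ : Finset α) = ∅ := by
  ext p
  obtain ⟨x, hx⟩ := hM
  simp only [mem_forests, Finset.notMem_empty, iff_false, not_and]
  intro _ _ h
  obtain ⟨m, hm⟩ := h x hx
  exact hm.elim

/-- Removing the children `C` of the roots leaves a forest with root set `C`. -/
theorem card_forests_fiber {M R C : Finset α} (hMR : Disjoint M R) (hC : C ⊆ M) :
    ((forests M R).filter fun p => M.filter (fun x => p x ∈ R) = C).card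
      = R.card ^ C.card * (forests (M \ C) C).card := by
  have h1 : (Fintype.piFinset fun x => if x ∈ C then R else {x}).card = R.card ^ C.card := by
    rw [Fintype.card_piFinset]
    simp only [apply_ite Finset.card, Finset.card_singleton, Finset.prod_ite_mem,
      Finset.univ_inter, Finset.prod_const]
  rw [← h1, ← Finset.card_product]
  refine Finset.card_nbij' (fun p => (fun x => if x ∈ C then p x else x,
      fun x => if x ∈ M \ C then p x else x))
    (fun g x => if x ∈ C then g.1 x else g.2 x) ?_ ?_ ?_ ?_
  · intro p hp
    obtain ⟨hp, hpC⟩ := Finset.mem_filter.1 hp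
    obtain ⟨hoff, hmap, hreach⟩ := mem_forests.1 hp
    have hmemC : ∀ x, x ∈ C ↔ x ∈ M ∧ p x ∈ R := fun x => by rw [← hpC, Finset.mem_filter]
    refine Finset.mem_product.2 ⟨Fintype.mem_piFinset.2 fun x => ?_, mem_forests.2 ⟨?_, ?_, ?_⟩⟩
    · dsimp only
      split_ifs with hx
      · exact ((hmemC x).1 hx).2
      · exact Finset.mem_singleton_self x
    · intro x hx; exact if_neg hx
    · intro x hx
      dsimp only
      rw [if_pos hx]
      obtain ⟨hxM, hxC⟩ := Finset.mem_sdiff.1 hx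
      rcases Finset.mem_union.1 (hmap x hxM) with h | h
      · rw [Finset.sdiff_union_of_subset hC]; exact h
      · exact absurd ((hmemC x).2 ⟨hxM, h⟩) hxC
    · have key : ∀ m x, x ∈ M \ C → p^[m] x ∈ R →
          ∃ m', (fun x => if x ∈ M \ C then p x else x)^[m'] x ∈ C := by
        intro m
        induction m with
        | zero =>
          intro x hx h
          exact absurd h (Finset.disjoint_left.1 hMR (Finset.mem_sdiff.1 hx).1)
        | succ m ih =>
          intro x hx h
          rw [Function.iterate_succ_apply] at h
          obtain ⟨hxM, hxC⟩ := Finset.mem_sdiff.1 hx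
          by_cases hpx : p x ∈ C
          · exact ⟨1, by rw [Function.iterate_one, if_pos hx]; exact hpx⟩
          · have hpM : p x ∈ M := by
              rcases Finset.mem_union.1 (hmap x hxM) with h | h
              · exact h
              · exact absurd ((hmemC x).2 ⟨hxM, h⟩) hxC
            obtain ⟨m', hm'⟩ := ih (p x) (Finset.mem_sdiff.2 ⟨hpM, hpx⟩) h
            refine ⟨m' + 1, ?_⟩
            rw [Function.iterate_succ_apply, if_pos hx]
            exact hm'
      intro x hx
      obtain ⟨m, hm⟩ := hreach x (Finset.mem_sdiff.1 hx).1
      exact key m x hx hm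
  · rintro ⟨g, q⟩ hgq
    obtain ⟨hg, hq⟩ := Finset.mem_product.1 hgq
    obtain ⟨hoff, hmap, hreach⟩ := mem_forests.1 hq
    have hgC : ∀ x ∈ C, g x ∈ R := fun x hx => by
      have := Fintype.mem_piFinset.1 hg x; rwa [if_pos hx] at this
    refine Finset.mem_filter.2 ⟨mem_forests.2 ⟨?_, ?_, ?_⟩, ?_⟩
    · intro x hx
      dsimp only
      rw [if_neg fun h => hx (hC h)]
      exact hoff x fun h => hx (Finset.mem_sdiff.1 h).1
    · intro x hx
      dsimp only
      split_ifs with hxC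
      · exact Finset.mem_union_right _ (hgC x hxC)
      · have := hmap x (Finset.mem_sdiff.2 ⟨hx, hxC⟩)
        rw [Finset.sdiff_union_of_subset hC] at this
        exact Finset.mem_union_left _ this
    · have hone : ∀ x ∈ C, (fun x => if x ∈ C then g x else q x)^[1] x ∈ R := by
        intro x hx; simpa [hx] using hgC x hx
      have key : ∀ m x, q^[m] x ∈ C → ∃ m', (fun x => if x ∈ C then g x else q x)^[m'] x ∈ R := by
        intro m
        induction m with
        | zero => intro x h; exact ⟨1, hone x h⟩
        | succ m ih =>
          intro x h
          by_cases hxC : x ∈ C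
          · exact ⟨1, hone x hxC⟩
          · rw [Function.iterate_succ_apply] at h
            obtain ⟨m', hm'⟩ := ih (q x) h
            refine ⟨m' + 1, ?_⟩
            rw [Function.iterate_succ_apply, if_neg hxC]
            exact hm'
      intro x hx
      by_cases hxC : x ∈ C
      · exact ⟨1, hone x hxC⟩
      · obtain ⟨m, hm⟩ := hreach x (Finset.mem_sdiff.2 ⟨hx, hxC⟩)
        exact key m x hm
    · ext x
      rw [Finset.mem_filter]
      constructor
      · rintro ⟨hxM, h⟩
        by_contra hxC
        dsimp only at h
        rw [if_neg hxC] at h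
        have := hmap x (Finset.mem_sdiff.2 ⟨hxM, hxC⟩)
        rw [Finset.sdiff_union_of_subset hC] at this
        exact Finset.disjoint_left.1 hMR this h
      · intro hxC
        refine ⟨hC hxC, ?_⟩
        dsimp only
        rw [if_pos hxC]; exact hgC x hxC
  · intro p hp
    obtain ⟨hoff, -, -⟩ := mem_forests.1 (Finset.mem_filter.1 hp).1
    funext x
    by_cases hxC : x ∈ C
    · simp [hxC]
    · by_cases hxM : x ∈ M
      · simp [hxC, hxM]
      · simp [hxC, hxM, hoff x hxM]
  · rintro ⟨g, q⟩ hgq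
    obtain ⟨hg, hq⟩ := Finset.mem_product.1 hgq
    obtain ⟨hoff, -, -⟩ := mem_forests.1 hq
    refine Prod.ext (funext fun x => ?_) (funext fun x => ?_)
    · by_cases hxC : x ∈ C
      · simp [hxC]
      · have := Fintype.mem_piFinset.1 hg x
        rw [if_neg hxC, Finset.mem_singleton] at this
        simp only [hxC, if_false]
        exact this.symm
    · by_cases hx : x ∈ M \ C
      · have := (Finset.mem_sdiff.1 hx).2
        simp [hx, this]
      · simp only [hx, if_false]
        exact (hoff x hx).symm

/-- Cayley's formula for rooted forests. -/
theorem card_forests {M R : Finset α} (hMR : Disjoint M R) (hM : M.Nonempty) :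
    (forests M R).card = R.card * (M.card + R.card) ^ (M.card - 1) := by
  induction hm : M.card using Nat.strong_induction_on generalizing M R with
  | _ m ih =>
    have hm0 : 0 < m := by rw [← hm]; exact hM.card_pos
    have hrec : (forests M R).card
        = ∑ C ∈ M.powerset, R.card ^ C.card * (forests (M \ C) C).card := by
      rw [Finset.card_eq_sum_card_fiberwise (t := M.powerset)
        (f := fun p => M.filter fun x => p x ∈ R)]
      · exact Finset.sum_congr rfl fun C hC => card_forests_fiber hMR (Finset.mem_powerset.1 hC)
      · intro p _
        exact Finset.mem_coe.2 (Finset.mem_powerset.2 (Finset.filter_subset _ _))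
    -- multiplied by `m`, the induction hypothesis also covers the case `C = M`
    have hterm : ∀ C ∈ M.powerset, m * (R.card ^ C.card * (forests (M \ C) C).card)
        = R.card ^ C.card * (C.card * m ^ (m - C.card)) := by
      intro C hC
      have hCM := Finset.mem_powerset.1 hC
      have hcard : (M \ C).card = m - C.card := by rw [Finset.card_sdiff_of_subset hCM, hm]
      have hCm : C.card ≤ m := hm ▸ Finset.card_le_card hCM
      rcases C.eq_empty_or_nonempty with rfl | hCne
      · rw [Finset.sdiff_empty, forests_empty_right hM]; simp
      rcases (M \ C).eq_empty_or_nonempty with he | hne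
      · rw [he, forests_empty]
        rw [he, Finset.card_empty] at hcard
        have : C.card = m := by omega
        simp [this]; ring
      · have hC0 := hCne.card_pos
        rw [ih (M \ C).card (by omega) Finset.sdiff_disjoint hne rfl, hcard,
          Nat.sub_add_cancel hCm]
        have hpos : 0 < m - C.card := by rw [← hcard]; exact hne.card_pos
        obtain ⟨j, hj⟩ : ∃ j, m - C.card = j + 1 := ⟨m - C.card - 1, by omega⟩
        rw [hj, Nat.add_sub_cancel, pow_succ]; ring
    obtain ⟨j, rfl⟩ : ∃ j, m = j + 1 := ⟨m - 1, by omega⟩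
    refine Nat.eq_of_mul_eq_mul_left hm0 ?_
    rw [hrec, Finset.mul_sum, Finset.sum_congr rfl hterm,
      Finset.sum_powerset_apply_card (fun c => R.card ^ c * (c * (j + 1) ^ (j + 1 - c))), hm,
      Finset.sum_range_succ']
    simp only [Nat.zero_mul, mul_zero, add_zero, Nat.add_sub_cancel, smul_eq_mul]
    rw [add_comm (j + 1) R.card, add_pow, Finset.mul_sum, Finset.mul_sum]
    refine Finset.sum_congr rfl fun c hc => ?_
    have h2 := Nat.add_one_mul_choose_eq j c
    rw [show j + 1 - (c + 1) = j - c by omega, pow_succ]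
    calc (j + 1).choose (c + 1) * (R.card ^ c * R.card * ((c + 1) * (j + 1) ^ (j - c)))
        = ((j + 1).choose (c + 1) * (c + 1)) * (R.card ^ c * R.card * (j + 1) ^ (j - c)) := by ring
      _ = _ := by rw [← h2, Nat.cast_id]; ring

/-- The branches with `d` vertices in `U`: rooted trees, given by the vertex set, the root, and the
parent function on the other vertices. -/
noncomputable def branches (U : Finset α) (d : ℕ) :
    Finset ((_ : Finset α) × (_ : α) × (α → α)) :=
  (U.powersetCard d).sigma fun V => V.sigma fun r => forests (V.erase r) {r}

/-- The pairs of disjoint branches with `d` vertices each. -/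
noncomputable def branchPairs (U : Finset α) (d : ℕ) :
    Finset ((_ : (_ : Finset α) × (_ : α) × (α → α)) × ((_ : Finset α) × (_ : α) × (α → α))) :=
  (branches U d).sigma fun a => branches (U \ a.1) d

theorem card_branches (U : Finset α) {d : ℕ} (hd : 1 ≤ d) :
    (branches U d).card = U.card.choose d * d ^ (d - 1) := by
  rw [branches, Finset.card_sigma, ← Finset.card_powersetCard d U, ← smul_eq_mul,
    ← Finset.sum_const]
  refine Finset.sum_congr rfl fun V hV => ?_
  obtain ⟨-, hVd⟩ := Finset.mem_powersetCard.1 hV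
  rw [Finset.card_sigma]
  have : ∀ r ∈ V, (forests (V.erase r) {r}).card = d ^ (d - 2) := by
    intro r hr
    have hc : (V.erase r).card = d - 1 := by rw [Finset.card_erase_of_mem hr, hVd]
    rcases (V.erase r).eq_empty_or_nonempty with he | hne
    · rw [he, forests_empty]
      rw [he, Finset.card_empty] at hc
      rw [show d = 1 by omega]; simp
    · rw [card_forests (by simp) hne, hc, Finset.card_singleton, one_mul,
        Nat.sub_add_cancel hd, show d - 1 - 1 = d - 2 by omega]
  rw [Finset.sum_congr rfl this, Finset.sum_const, hVd, smul_eq_mul]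
  rcases hd.eq_or_lt with rfl | h
  · simp
  · rw [← pow_succ', show d - 2 + 1 = d - 1 by omega]

theorem card_branchPairs (U : Finset α) {d : ℕ} (hd : 1 ≤ d) :
    (branchPairs U d).card
      = (U.card.choose d * (U.card - d).choose d) * (d ^ (d - 1)) ^ 2 := by
  rw [branchPairs, Finset.card_sigma]
  have : ∀ a ∈ branches U d, (branches (U \ a.1) d).card
      = (U.card - d).choose d * d ^ (d - 1) := by
    intro a ha
    obtain ⟨haU, had⟩ := Finset.mem_powersetCard.1 (Finset.mem_sigma.1 ha).1
    rw [card_branches _ hd, Finset.card_sdiff_of_subset haU, had]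
  rw [Finset.sum_congr rfl this, Finset.sum_const, card_branches U hd, smul_eq_mul]
  ring
end Forests

/-! ### Trees and their good parts -/

section Trees
variable {α : Type*} [DecidableEq α]

/-- The function `p` is the parent function of a tree with root `o` and further vertices `V`. -/
structure IsTreeOn (o : α) (V : Finset α) (p : α → α) : Prop where
  root_notMem : o ∉ V
  map_mem : ∀ x ∈ V, p x ∈ insert o V
  reach : ∀ x ∈ V, ∃ m, p^[m] x = o

/-- The edges of the tree with parent function `p`. -/
def treeEdges (V : Finset α) (p : α → α) : Finset (Sym2 α) := V.image fun x => s(x, p x)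

/-- The vertices other than `o` that are covered by a set of edges. -/
def edgeVerts [Fintype α] (o : α) (B : Finset (Sym2 α)) : Finset α :=
  (Finset.univ.filter fun v => ∃ e ∈ B, v ∈ e).erase o

theorem mem_edgeVerts [Fintype α] {o : α} {B : Finset (Sym2 α)} {v : α} :
    v ∈ edgeVerts o B ↔ v ≠ o ∧ ∃ e ∈ B, v ∈ e := by
  simp [edgeVerts]

theorem IsTreeOn.ne_of_swap {o : α} {V : Finset α} {p : α → α} (h : IsTreeOn o V p) {x y : α}
    (hx : x ∈ V) (hy : y ∈ V) (hxy : p x = y) : p y ≠ x := by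
  intro hyx
  obtain ⟨m, hm⟩ := h.reach x hx
  have : ∀ i, p^[i] x = x ∨ p^[i] x = y := by
    intro i
    induction i with
    | zero => exact Or.inl rfl
    | succ i ih =>
      rw [Function.iterate_succ_apply']
      rcases ih with h | h <;> rw [h]
      exacts [Or.inr hxy, Or.inl hyx]
  rcases this m with h' | h'
  · exact h.root_notMem (by rw [← hm, h']; exact hx)
  · exact h.root_notMem (by rw [← hm, h']; exact hy)

theorem IsTreeOn.injOn {o : α} {V : Finset α} {p : α → α} (h : IsTreeOn o V p) :
    Set.InjOn (fun x => s(x, p x)) (V : Set α) := by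
  intro x hx y hy hxy
  rcases Sym2.eq_iff.1 hxy with h1 | ⟨h1, h2⟩
  · exact h1.1
  · exact absurd h1.symm (h.ne_of_swap hx hy h2)

theorem IsTreeOn.card_treeEdges {o : α} {V : Finset α} {p : α → α} (h : IsTreeOn o V p) :
    (treeEdges V p).card = V.card := Finset.card_image_of_injOn h.injOn

theorem IsTreeOn.edgeVerts_treeEdges [Fintype α] {o : α} {V : Finset α} {p : α → α}
    (h : IsTreeOn o V p) : edgeVerts o (treeEdges V p) = V := by
  ext v
  rw [mem_edgeVerts]
  constructor
  · rintro ⟨hvo, e, he, hv⟩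
    obtain ⟨x, hx, rfl⟩ := Finset.mem_image.1 he
    rcases Sym2.mem_iff.1 hv with rfl | rfl
    · exact hx
    · exact (Finset.mem_insert.1 (h.map_mem x hx)).resolve_left hvo
  · intro hv
    exact ⟨fun hvo => h.root_notMem (hvo ▸ hv), s(v, p v), Finset.mem_image_of_mem _ hv,
      Sym2.mem_mk_left _ _⟩

/-- The parent function of a tree is determined by the edges and the root. -/
theorem IsTreeOn.parent_unique {o : α} {V : Finset α} {p p' : α → α} (h : IsTreeOn o V p)
    (he : treeEdges V p = treeEdges V p') : ∀ x ∈ V, p x = p' x := by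
  have key : ∀ m, ∀ x ∈ V, p^[m] x = o → p x = p' x := by
    intro m
    induction m with
    | zero => intro x hx hm; exact absurd (show x = o from hm) fun h1 => h.root_notMem (h1 ▸ hx)
    | succ m ih =>
      intro x hx hm
      rw [Function.iterate_succ_apply] at hm
      have hmem : s(x, p x) ∈ treeEdges V p' := he ▸ Finset.mem_image_of_mem _ hx
      obtain ⟨y, hy, hyx⟩ := Finset.mem_image.1 hmem
      rcases Sym2.eq_iff.1 hyx with ⟨h1, h2⟩ | ⟨h1, h2⟩
      · rw [← h2, h1]
      · -- then `p' (p x) = x`, while `p (p x) = p' (p x)` by induction: a cycle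
        have hpx : p x ∈ V := h1 ▸ hy
        have h3 := ih (p x) hpx hm
        rw [h1] at h2
        exact absurd (h3.trans h2) (h.ne_of_swap hx hpx rfl)
  intro x hx
  obtain ⟨m, hm⟩ := h.reach x hx
  exact key m x hx hm

/-- The set `B` consists of edges of the tree, and the other edges of the tree lie inside `S`. For a
planted set `S`, these are the `B` for which the tree contributes to the coefficient of the noise
monomial of `B`. -/
def GoodPart (S V : Finset α) (p : α → α) (B : Finset (Sym2 α)) : Prop :=
  B ⊆ treeEdges V p ∧ ∀ e ∈ treeEdges V p, e ∉ B → ∀ v ∈ e, v ∈ S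

/-- The vertices whose parent edge belongs to `B`. -/
def lowVerts (V : Finset α) (p : α → α) (B : Finset (Sym2 α)) : Finset α :=
  V.filter fun x => s(x, p x) ∈ B

theorem mem_lowVerts {V : Finset α} {p : α → α} {B : Finset (Sym2 α)} {x : α} :
    x ∈ lowVerts V p B ↔ x ∈ V ∧ s(x, p x) ∈ B := Finset.mem_filter

theorem image_lowVerts {V : Finset α} {p : α → α} {B : Finset (Sym2 α)}
    (hB : B ⊆ treeEdges V p) : (lowVerts V p B).image (fun x => s(x, p x)) = B := by
  ext e
  rw [Finset.mem_image]
  constructor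
  · rintro ⟨x, hx, rfl⟩; exact (mem_lowVerts.1 hx).2
  · intro he
    obtain ⟨x, hx, rfl⟩ := Finset.mem_image.1 (hB he)
    exact ⟨x, mem_lowVerts.2 ⟨hx, he⟩, rfl⟩

variable {o : α} {S V : Finset α} {p : α → α} {B : Finset (Sym2 α)}

theorem IsTreeOn.card_lowVerts (h : IsTreeOn o V p) (hB : B ⊆ treeEdges V p) :
    (lowVerts V p B).card = B.card := by
  conv_rhs => rw [← image_lowVerts hB]
  exact (Finset.card_image_of_injOn
    (h.injOn.mono (Finset.coe_subset.2 (Finset.filter_subset _ _)))).symm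

theorem IsTreeOn.lowVerts_subset [Fintype α] (h : IsTreeOn o V p) :
    lowVerts V p B ⊆ edgeVerts o B := by
  intro x hx
  obtain ⟨hxV, hxB⟩ := mem_lowVerts.1 hx
  exact mem_edgeVerts.2 ⟨fun hxo => h.root_notMem (hxo ▸ hxV), _, hxB, Sym2.mem_mk_left _ _⟩

theorem IsTreeOn.edgeVerts_subset [Fintype α] (h : IsTreeOn o V p) (hB : B ⊆ treeEdges V p) :
    edgeVerts o B ⊆ V := by
  rw [← h.edgeVerts_treeEdges]
  intro x hx
  obtain ⟨hxo, e, he, hxe⟩ := mem_edgeVerts.1 hx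
  exact mem_edgeVerts.2 ⟨hxo, e, hB he, hxe⟩

theorem GoodPart.mem_of_notMem_lowVerts (hg : GoodPart S V p B) {x : α} (hx : x ∈ V)
    (hxJ : x ∉ lowVerts V p B) : x ∈ S ∧ p x ∈ S := by
  have h1 : s(x, p x) ∉ B := fun h => hxJ (mem_lowVerts.2 ⟨hx, h⟩)
  have h2 := hg.2 _ (Finset.mem_image_of_mem _ hx) h1
  exact ⟨h2 _ (Sym2.mem_mk_left _ _), h2 _ (Sym2.mem_mk_right _ _)⟩

theorem IsTreeOn.card_edgeVerts_sdiff [Fintype α] (h : IsTreeOn o V p) (hB : B ⊆ treeEdges V p) :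
    (edgeVerts o B \ lowVerts V p B).card + B.card = (edgeVerts o B).card := by
  rw [Finset.card_sdiff_of_subset h.lowVerts_subset, h.card_lowVerts hB]
  have := Finset.card_le_card (h.lowVerts_subset (B := B))
  rw [h.card_lowVerts hB] at this
  omega

theorem IsTreeOn.card_edgeVerts_inter [Fintype α] (h : IsTreeOn o V p) (hg : GoodPart S V p B) :
    (edgeVerts o B ∩ S).card + B.card = (lowVerts V p B ∩ S).card + (edgeVerts o B).card := by
  have h1 : edgeVerts o B ∩ S
      = (lowVerts V p B ∩ S) ∪ (edgeVerts o B \ lowVerts V p B) := by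
    ext x
    simp only [Finset.mem_inter, Finset.mem_union, Finset.mem_sdiff]
    constructor
    · rintro ⟨hx, hS⟩
      by_cases hJ : x ∈ lowVerts V p B
      exacts [Or.inl ⟨hJ, hS⟩, Or.inr ⟨hx, hJ⟩]
    · rintro (⟨hJ, hS⟩ | ⟨hx, hJ⟩)
      · exact ⟨h.lowVerts_subset hJ, hS⟩
      · exact ⟨hx, (hg.mem_of_notMem_lowVerts (h.edgeVerts_subset hg.1 hx) hJ).1⟩
  have hd : Disjoint (lowVerts V p B ∩ S) (edgeVerts o B \ lowVerts V p B) :=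
    Finset.disjoint_sdiff.mono_left Finset.inter_subset_left
  have h2 := h.card_edgeVerts_sdiff hg.1
  rw [h1, Finset.card_union_of_disjoint hd]
  omega

open Classical in
/-- The sets of `b` edges that are good parts of some tree, cover `b + q` vertices other than the
root, and cover `q + a` such vertices in `S`. In every such tree, `q` of the covered vertices have
no parent edge in the set (and are planted), and `a` planted vertices have a parent edge in the set.
-/
noncomputable def goodParts [Fintype α] (o : α) (S : Finset α) (b q a : ℕ) :
    Finset (Finset (Sym2 α)) :=
  Finset.univ.filter fun B => (∃ V p, IsTreeOn o V p ∧ GoodPart S V p B) ∧ B.card = b ∧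
    (edgeVerts o B).card = b + q ∧ (edgeVerts o B ∩ S).card = q + a

theorem mem_goodParts [Fintype α] {b q a : ℕ} : B ∈ goodParts o S b q a ↔
    (∃ V p, IsTreeOn o V p ∧ GoodPart S V p B) ∧ B.card = b ∧
    (edgeVerts o B).card = b + q ∧ (edgeVerts o B ∩ S).card = q + a := by
  simp [goodParts]

/-- A good part is determined by its vertices without parent edge, by its planted and its other
vertices with a parent edge, and by a parent function on the latter two sets. -/
theorem card_goodParts_le [Fintype α] (o : α) (S : Finset α) (b q a : ℕ) :
    (goodParts o S b q a).card
      ≤ (S.erase o).card.choose q * ((S.erase o).card.choose a *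
        (Fintype.card α).choose (b - a)) * (b + q + 1) ^ b := by
  rcases (goodParts o S b q a).eq_empty_or_nonempty with he | ⟨B₀, hB₀⟩
  · rw [he]; simp
  have hab : a ≤ b := by
    obtain ⟨⟨V, p, h, hg⟩, hb, hq, ha⟩ := mem_goodParts.1 hB₀
    have h1 := h.card_edgeVerts_inter hg
    have h2 := Finset.card_le_card (Finset.inter_subset_left (s₁ := lowVerts V p B₀) (s₂ := S))
    rw [h.card_lowVerts hg.1] at h2
    omega
  let I := (S.erase o).powersetCard q ×ˢ
    ((S.erase o).powersetCard a ×ˢ (Finset.univ : Finset α).powersetCard (b - a))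
  let F : Finset α × (Finset α × Finset α) → Finset (Finset (Sym2 α)) := fun t =>
    (Fintype.piFinset fun x =>
      if x ∈ t.2.1 ∪ t.2.2 then (t.2.1 ∪ t.2.2) ∪ insert o t.1 else {x}).image
      fun g => (t.2.1 ∪ t.2.2).image fun x => s(x, g x)
  have hsub : goodParts o S b q a ⊆ I.biUnion F := by
    intro B hB
    obtain ⟨⟨V, p, h, hg⟩, hb, hq, ha⟩ := mem_goodParts.1 hB
    have h1 := h.card_edgeVerts_inter hg
    have h2 := h.card_edgeVerts_sdiff hg.1
    have h3 := h.card_lowVerts hg.1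
    have hoJ : o ∉ lowVerts V p B := fun ho => h.root_notMem (mem_lowVerts.1 ho).1
    have hJ : (lowVerts V p B ∩ S) ∪ (lowVerts V p B \ S) = lowVerts V p B := by
      rw [Finset.union_comm, Finset.sdiff_union_inter]
    refine Finset.mem_biUnion.2 ⟨(edgeVerts o B \ lowVerts V p B,
      (lowVerts V p B ∩ S, lowVerts V p B \ S)), ?_, ?_⟩
    · refine Finset.mem_product.2 ⟨Finset.mem_powersetCard.2 ⟨?_, ?_⟩, Finset.mem_product.2
        ⟨Finset.mem_powersetCard.2 ⟨?_, ?_⟩, Finset.mem_powersetCard.2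
          ⟨Finset.subset_univ _, ?_⟩⟩⟩
      · intro x hx
        obtain ⟨hx, hxJ⟩ := Finset.mem_sdiff.1 hx
        exact Finset.mem_erase.2 ⟨(mem_edgeVerts.1 hx).1,
          (hg.mem_of_notMem_lowVerts (h.edgeVerts_subset hg.1 hx) hxJ).1⟩
      · dsimp only; omega
      · intro x hx
        obtain ⟨hx, hxS⟩ := Finset.mem_inter.1 hx
        exact Finset.mem_erase.2 ⟨fun hxo => hoJ (hxo ▸ hx), hxS⟩
      · dsimp only; omega
      · dsimp only
        have := Finset.card_sdiff_add_card_inter (lowVerts V p B) S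
        omega
    · simp only [F, hJ]
      refine Finset.mem_image.2 ⟨fun x => if x ∈ lowVerts V p B then p x else x,
        Fintype.mem_piFinset.2 fun x => ?_, ?_⟩
      · split_ifs with hx
        · by_cases hpo : p x = o
          · rw [hpo]; simp
          · have hpx : p x ∈ edgeVerts o B := mem_edgeVerts.2 ⟨hpo, _, (mem_lowVerts.1 hx).2,
              Sym2.mem_mk_right _ _⟩
            by_cases hpJ : p x ∈ lowVerts V p B
            · exact Finset.mem_union_left _ hpJ
            · exact Finset.mem_union_right _ (Finset.mem_insert_of_mem
                (Finset.mem_sdiff.2 ⟨hpx, hpJ⟩))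
        · simp
      · conv_rhs => rw [← image_lowVerts hg.1]
        exact Finset.image_congr fun x hx => by
          dsimp only
          rw [if_pos (Finset.mem_coe.1 hx)]
  refine (Finset.card_le_card hsub).trans ((Finset.card_biUnion_le_card_mul I F
    ((b + q + 1) ^ b) fun t ht => ?_).trans (le_of_eq ?_))
  · obtain ⟨h1, h2⟩ := Finset.mem_product.1 ht
    obtain ⟨h2, h3⟩ := Finset.mem_product.1 h2
    have h1 := (Finset.mem_powersetCard.1 h1).2
    have h2 := (Finset.mem_powersetCard.1 h2).2
    have h3 := (Finset.mem_powersetCard.1 h3).2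
    refine Finset.card_image_le.trans ?_
    rw [Fintype.card_piFinset]
    simp only [apply_ite Finset.card, Finset.card_singleton, Finset.prod_ite_mem,
      Finset.univ_inter, Finset.prod_const]
    have h4 : (t.2.1 ∪ t.2.2).card ≤ b := (Finset.card_union_le _ _).trans (by omega)
    have h5 : ((t.2.1 ∪ t.2.2) ∪ insert o t.1).card ≤ b + q + 1 :=
      (Finset.card_union_le _ _).trans (by have := Finset.card_insert_le o t.1; omega)
    exact (Nat.pow_le_pow_left h5 _).trans (Nat.pow_le_pow_right (by omega) h4)
  · simp only [I, Finset.card_product, Finset.card_powersetCard, Finset.card_univ]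

/-- A tree with good part `B` is `B` together with the parent edges of the remaining vertices, which
are planted, as are their parents. -/
theorem card_trees_above_le [Fintype α] {k b q a : ℕ} (hb : B.card = b)
    (hq : (edgeVerts o B).card = b + q)
    (ha : (edgeVerts o B ∩ S).card = q + a) (𝒯 : Finset (Finset (Sym2 α)))
    (h𝒯 : ∀ T ∈ 𝒯, ∃ V p, IsTreeOn o V p ∧ V.card = k ∧ T = treeEdges V p ∧ GoodPart S V p B) :
    𝒯.card ≤ ((S.erase o).card.choose (k - b - q) * (q + a).choose q) *
      (k - b + a + 1) ^ (k - b) := by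
  rcases 𝒯.eq_empty_or_nonempty with he | ⟨T₀, hT₀⟩
  · rw [he]; simp
  have hbq : b + q ≤ k := by
    obtain ⟨V, p, h, hV, -, hg⟩ := h𝒯 T₀ hT₀
    rw [← hq, ← hV]
    exact Finset.card_le_card (h.edgeVerts_subset hg.1)
  let P := edgeVerts o B ∩ S
  let I := (S.erase o).powersetCard (k - b - q) ×ˢ P.powersetCard q
  let F : Finset α × Finset α → Finset (Finset (Sym2 α)) := fun t =>
    (Fintype.piFinset fun x => if x ∈ t.1 ∪ t.2 then t.1 ∪ insert o P else {x}).image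
      fun g => B ∪ (t.1 ∪ t.2).image fun x => s(x, g x)
  have hsub : 𝒯 ⊆ I.biUnion F := by
    intro T hT
    obtain ⟨V, p, h, hV, rfl, hg⟩ := h𝒯 T hT
    have h2 := h.card_edgeVerts_sdiff hg.1
    have hEV := h.edgeVerts_subset hg.1
    have hJE := h.lowVerts_subset (B := B)
    have hMP : edgeVerts o B \ lowVerts V p B ⊆ P := fun x hx => by
      obtain ⟨hx, hxJ⟩ := Finset.mem_sdiff.1 hx
      exact Finset.mem_inter.2 ⟨hx, (hg.mem_of_notMem_lowVerts (hEV hx) hxJ).1⟩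
    have hQ : (V \ edgeVerts o B) ∪ (edgeVerts o B \ lowVerts V p B) = V \ lowVerts V p B := by
      ext x
      simp only [Finset.mem_union, Finset.mem_sdiff]
      constructor
      · rintro (⟨hx, hxE⟩ | ⟨hx, hxJ⟩)
        exacts [⟨hx, fun hJ => hxE (hJE hJ)⟩, ⟨hEV hx, hxJ⟩]
      · rintro ⟨hx, hxJ⟩
        by_cases hxE : x ∈ edgeVerts o B
        exacts [Or.inr ⟨hxE, hxJ⟩, Or.inl ⟨hx, hxE⟩]
    refine Finset.mem_biUnion.2 ⟨(V \ edgeVerts o B, edgeVerts o B \ lowVerts V p B), ?_, ?_⟩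
    · refine Finset.mem_product.2 ⟨Finset.mem_powersetCard.2 ⟨?_, ?_⟩,
        Finset.mem_powersetCard.2 ⟨hMP, ?_⟩⟩
      · intro x hx
        obtain ⟨hx, hxE⟩ := Finset.mem_sdiff.1 hx
        exact Finset.mem_erase.2 ⟨fun hxo => h.root_notMem (hxo ▸ hx),
          (hg.mem_of_notMem_lowVerts hx fun hJ => hxE (hJE hJ)).1⟩
      · dsimp only
        rw [Finset.card_sdiff_of_subset hEV]; omega
      · dsimp only; omega
    · simp only [F, hQ]
      refine Finset.mem_image.2 ⟨fun x => if x ∈ V \ lowVerts V p B then p x else x,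
        Fintype.mem_piFinset.2 fun x => ?_, ?_⟩
      · split_ifs with hx
        · obtain ⟨hxV, hxJ⟩ := Finset.mem_sdiff.1 hx
          have hpS := (hg.mem_of_notMem_lowVerts hxV hxJ).2
          rcases Finset.mem_insert.1 (h.map_mem x hxV) with hpo | hpV
          · rw [hpo]; simp
          · by_cases hpE : p x ∈ edgeVerts o B
            · exact Finset.mem_union_right _ (Finset.mem_insert_of_mem
                (Finset.mem_inter.2 ⟨hpE, hpS⟩))
            · exact Finset.mem_union_left _ (Finset.mem_sdiff.2 ⟨hpV, hpE⟩)
        · simp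
      · ext e
        rw [Finset.mem_union, Finset.mem_image]
        constructor
        · rintro (he | ⟨x, hx, rfl⟩)
          · exact hg.1 he
          · dsimp only
            rw [if_pos hx]
            exact Finset.mem_image_of_mem _ (Finset.mem_sdiff.1 hx).1
        · intro he
          by_cases heB : e ∈ B
          · exact Or.inl heB
          · obtain ⟨x, hx, rfl⟩ := Finset.mem_image.1 he
            have hx' : x ∈ V \ lowVerts V p B :=
              Finset.mem_sdiff.2 ⟨hx, fun hJ => heB (mem_lowVerts.1 hJ).2⟩
            exact Or.inr ⟨x, hx', by dsimp only; rw [if_pos hx']⟩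
  refine (Finset.card_le_card hsub).trans ((Finset.card_biUnion_le_card_mul I F
    ((k - b + a + 1) ^ (k - b)) fun t ht => ?_).trans (le_of_eq ?_))
  · obtain ⟨h1, h2⟩ := Finset.mem_product.1 ht
    have h1 := (Finset.mem_powersetCard.1 h1).2
    have h2 := (Finset.mem_powersetCard.1 h2).2
    refine Finset.card_image_le.trans ?_
    rw [Fintype.card_piFinset]
    simp only [apply_ite Finset.card, Finset.card_singleton, Finset.prod_ite_mem,
      Finset.univ_inter, Finset.prod_const]
    have h4 : (t.1 ∪ t.2).card ≤ k - b := (Finset.card_union_le _ _).trans (by omega)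
    have h5 : (t.1 ∪ insert o P).card ≤ k - b + a + 1 :=
      (Finset.card_union_le _ _).trans (by
        have := Finset.card_insert_le o P
        have : P.card = q + a := ha
        omega)
    exact (Nat.pow_le_pow_left h5 _).trans (Nat.pow_le_pow_right (by omega) h4)
  · simp only [I, Finset.card_product, Finset.card_powersetCard]
    rw [show P.card = q + a from ha]
end Trees

/-! ### Trees formed by two branches -/

section Pairs
variable {α : Type*}

/-- The vertices `V` form a branch with top vertex `r` below the vertex `o`. -/
structure IsBranch (o : α) (V : Finset α) (r : α) (p : α → α) : Prop where
  top_mem : r ∈ V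
  root_notMem : o ∉ V
  map_top : p r = o
  map_root : p o = o
  map_mem : ∀ x ∈ V, x ≠ r → p x ∈ V
  reach : ∀ x ∈ V, ∃ m, p^[m] x = r

/-- On the way from a vertex of a branch without property `P` up to the top vertex, which has
property `P`, some edge leads from a vertex without to one with property `P`. -/
theorem IsBranch.exists_step {o : α} {V : Finset α} {p : α → α} {r : α}
    (h : IsBranch o V r p) {P : α → Prop} (hr : P r) {x : α} (hx : x ∈ V)
    (hPx : ¬P x) : ∃ y ∈ V, ¬P y ∧ p y ∈ V ∧ P (p y) := by
  obtain ⟨m, hm⟩ := h.reach x hx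
  induction m generalizing x with
  | zero => exact absurd hr (by rw [← hm]; exact hPx)
  | succ m ih =>
    have hxr : x ≠ r := fun hxr => hPx (hxr ▸ hr)
    have hpx := h.map_mem x hx hxr
    by_cases hP : P (p x)
    · exact ⟨x, hx, hPx, hpx, hP⟩
    · exact ih hpx hP (by rwa [Function.iterate_succ_apply] at hm)

variable [DecidableEq α]

/-- The vertices other than the root of the tree formed by two branches. -/
def pairVerts
    (I : (_ : (_ : Finset α) × (_ : α) × (α → α)) × ((_ : Finset α) × (_ : α) × (α → α))) :
    Finset α := I.1.1 ∪ I.2.1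

/-- The parent function of the tree in which the roots of two branches are children of `o`. -/
def pairParent (o : α)
    (I : (_ : (_ : Finset α) × (_ : α) × (α → α)) × ((_ : Finset α) × (_ : α) × (α → α))) :
    α → α :=
  fun x => if x = I.1.2.1 ∨ x = I.2.2.1 then o else if x ∈ I.1.1 then I.1.2.2 x else I.2.2.2 x

variable {o : α} {S V : Finset α} {p : α → α} {r : α} {B : Finset (Sym2 α)}

theorem IsBranch.iterate_mem (h : IsBranch o V r p) {x : α} (hx : x ∈ V) (m : ℕ) :
    p^[m] x ∈ insert o V := by
  induction m with
  | zero => exact Finset.mem_insert_of_mem hx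
  | succ m ih =>
    rw [Function.iterate_succ_apply']
    rcases Finset.mem_insert.1 ih with h1 | h1
    · rw [h1, h.map_root]; exact Finset.mem_insert_self _ _
    · by_cases hr : p^[m] x = r
      · rw [hr, h.map_top]; exact Finset.mem_insert_self _ _
      · exact Finset.mem_insert_of_mem (h.map_mem _ h1 hr)

/-- If a good part contains the edge above a branch but not the whole branch, then some vertex of
the branch with a parent edge in the good part has a child whose edge is not in it, and so is
planted. -/
theorem IsBranch.exists_planted {W : Finset α} (h : IsBranch o V r p) (hVW : V ⊆ W)
    (hg : GoodPart S W p B) (hr : r ∈ lowVerts W p B)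
    (hcard : (lowVerts W p B).card < V.card) : ∃ z ∈ V, z ∈ lowVerts W p B ∩ S := by
  obtain ⟨x, hx, hxJ⟩ := Finset.exists_mem_notMem_of_card_lt_card hcard
  obtain ⟨y, hy, hyJ, hpV, hpJ⟩ := h.exists_step (P := fun y => y ∈ lowVerts W p B) hr hx hxJ
  exact ⟨p y, hpV, Finset.mem_inter.2 ⟨hpJ, (hg.mem_of_notMem_lowVerts (hVW hy) hyJ).2⟩⟩

variable [Fintype α]

theorem forest_isBranch {V : Finset α} {r : α} {q : α → α}
    (hr : r ∈ V) (ho : o ∉ V) (hq : q ∈ forests (V.erase r) {r}) (hp : ∀ x ∈ V, x ≠ r → p x = q x)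
    (hpr : p r = o) (hpo : p o = o) : IsBranch o V r p := by
  obtain ⟨-, hmap, hreach⟩ := mem_forests.1 hq
  have hm : ∀ x ∈ V, x ≠ r → p x ∈ V := by
    intro x hx hxr
    rw [hp x hx hxr]
    have := hmap x (Finset.mem_erase.2 ⟨hxr, hx⟩)
    rw [Finset.mem_union, Finset.mem_singleton] at this
    rcases this with h | h
    · exact (Finset.mem_erase.1 h).2
    · rw [h]; exact hr
  refine ⟨hr, ho, hpr, hpo, hm, ?_⟩
  have key : ∀ m, ∀ x ∈ V, q^[m] x = r → ∃ m', p^[m'] x = r := by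
    intro m
    induction m with
    | zero => intro x _ h; exact ⟨0, h⟩
    | succ m ih =>
      intro x hx h
      by_cases hxr : x = r
      · exact ⟨0, hxr⟩
      · rw [Function.iterate_succ_apply, ← hp x hx hxr] at h
        obtain ⟨m', hm'⟩ := ih (p x) (hm x hx hxr) h
        exact ⟨m' + 1, by rwa [Function.iterate_succ_apply]⟩
  intro x hx
  by_cases hxr : x = r
  · exact ⟨0, hxr⟩
  · obtain ⟨m, hm⟩ := hreach x (Finset.mem_erase.2 ⟨hxr, hx⟩)
    exact key m x hx (Finset.mem_singleton.1 hm)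

theorem mem_branchPairs {U : Finset α} {d : ℕ}
    {I : (_ : (_ : Finset α) × (_ : α) × (α → α)) × ((_ : Finset α) × (_ : α) × (α → α))} :
    I ∈ branchPairs U d ↔
      ((I.1.1 ⊆ U ∧ I.1.1.card = d) ∧ I.1.2.1 ∈ I.1.1 ∧
        I.1.2.2 ∈ forests (I.1.1.erase I.1.2.1) {I.1.2.1}) ∧
      ((I.2.1 ⊆ U \ I.1.1 ∧ I.2.1.card = d) ∧ I.2.2.1 ∈ I.2.1 ∧
        I.2.2.2 ∈ forests (I.2.1.erase I.2.2.1) {I.2.2.1}) := by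
  simp only [branchPairs, branches, Finset.mem_sigma, Finset.mem_powersetCard]

theorem disjoint_of_mem_branchPairs {U : Finset α} {d : ℕ}
    {I : (_ : (_ : Finset α) × (_ : α) × (α → α)) × ((_ : Finset α) × (_ : α) × (α → α))}
    (hI : I ∈ branchPairs U d) : Disjoint I.1.1 I.2.1 :=
  Finset.disjoint_sdiff.mono_right (mem_branchPairs.1 hI).2.1.1

theorem card_pairVerts {U : Finset α} {d : ℕ}
    {I : (_ : (_ : Finset α) × (_ : α) × (α → α)) × ((_ : Finset α) × (_ : α) × (α → α))}
    (hI : I ∈ branchPairs U d) : (pairVerts I).card = 2 * d := by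
  rw [pairVerts, Finset.card_union_of_disjoint (disjoint_of_mem_branchPairs hI),
    (mem_branchPairs.1 hI).1.1.2, (mem_branchPairs.1 hI).2.1.2]
  ring

theorem isBranch_of_mem_branchPairs {d : ℕ}
    {I : (_ : (_ : Finset α) × (_ : α) × (α → α)) × ((_ : Finset α) × (_ : α) × (α → α))}
    (hI : I ∈ branchPairs (Finset.univ.erase o) d) :
    IsBranch o I.1.1 I.1.2.1 (pairParent o I) ∧ IsBranch o I.2.1 I.2.2.1 (pairParent o I) := by
  have hd := disjoint_of_mem_branchPairs hI
  obtain ⟨⟨⟨hV1, -⟩, hr1, hq1⟩, ⟨⟨hV2, -⟩, hr2, hq2⟩⟩ := mem_branchPairs.1 hI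
  have ho1 : o ∉ I.1.1 := fun h => Finset.notMem_erase o _ (hV1 h)
  have ho2 : o ∉ I.2.1 := fun h => Finset.notMem_erase o _ (Finset.mem_sdiff.1 (hV2 h)).1
  have hpo : pairParent o I o = o := by
    unfold pairParent
    rw [if_neg ho1, (mem_forests.1 hq2).1 o fun h => ho2 (Finset.mem_erase.1 h).2, ite_self]
  refine ⟨forest_isBranch hr1 ho1 hq1 ?_ (by simp [pairParent]) hpo,
    forest_isBranch hr2 ho2 hq2 ?_ (by simp [pairParent]) hpo⟩
  · intro x hx hxr
    have : x ≠ I.2.2.1 := fun h => Finset.disjoint_left.1 hd hx (h ▸ hr2)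
    simp [pairParent, hx, hxr, this]
  · intro x hx hxr
    have h1 : x ≠ I.1.2.1 := fun h => Finset.disjoint_right.1 hd hx (h ▸ hr1)
    have h2 : x ∉ I.1.1 := Finset.disjoint_right.1 hd hx
    simp [pairParent, h1, h2, hxr]

theorem isTreeOn_pairParent {d : ℕ}
    {I : (_ : (_ : Finset α) × (_ : α) × (α → α)) × ((_ : Finset α) × (_ : α) × (α → α))}
    (hI : I ∈ branchPairs (Finset.univ.erase o) d) :
    IsTreeOn o (pairVerts I) (pairParent o I) := by
  obtain ⟨h1, h2⟩ := isBranch_of_mem_branchPairs hI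
  have hreach : ∀ {V r}, IsBranch o V r (pairParent o I) →
      ∀ x ∈ V, ∃ m, (pairParent o I)^[m] x = o := by
    intro V r h x hx
    obtain ⟨m, hm⟩ := h.reach x hx
    exact ⟨m + 1, by rw [Function.iterate_succ_apply', hm, h.map_top]⟩
  have hmap : ∀ {V r}, IsBranch o V r (pairParent o I) →
      ∀ x ∈ V, pairParent o I x ∈ insert o V := fun h x hx => h.iterate_mem hx 1
  refine ⟨?_, ?_, ?_⟩
  · rw [pairVerts, Finset.mem_union, not_or]
    exact ⟨h1.root_notMem, h2.root_notMem⟩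
  · intro x hx
    rcases Finset.mem_union.1 hx with hx | hx
    · exact Finset.insert_subset_insert _ Finset.subset_union_left (hmap h1 x hx)
    · exact Finset.insert_subset_insert _ Finset.subset_union_right (hmap h2 x hx)
  · intro x hx
    rcases Finset.mem_union.1 hx with hx | hx
    exacts [hreach h1 x hx, hreach h2 x hx]

/-- A pair of branches is determined by the edges of the tree and the top vertex of the first
branch. -/
theorem branchPairs_ext {d : ℕ}
    {I I' : (_ : (_ : Finset α) × (_ : α) × (α → α)) × ((_ : Finset α) × (_ : α) × (α → α))}
    (hI : I ∈ branchPairs (Finset.univ.erase o) d) (hI' : I' ∈ branchPairs (Finset.univ.erase o) d)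
    (hT : treeEdges (pairVerts I) (pairParent o I) = treeEdges (pairVerts I') (pairParent o I'))
    (hr : I.1.2.1 = I'.1.2.1) : I = I' := by
  have ht := isTreeOn_pairParent hI
  have ht' := isTreeOn_pairParent hI'
  have hV : pairVerts I = pairVerts I' := by
    rw [← ht.edgeVerts_treeEdges, hT, ht'.edgeVerts_treeEdges]
  rw [← hV] at hT ht'
  have hp := ht.parent_unique hT
  obtain ⟨h1, h2⟩ := isBranch_of_mem_branchPairs hI
  obtain ⟨h1', h2'⟩ := isBranch_of_mem_branchPairs hI'
  have hd := disjoint_of_mem_branchPairs hI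
  have hd' := disjoint_of_mem_branchPairs hI'
  obtain ⟨⟨⟨-, hc1⟩, -, hq1⟩, ⟨-, -, hq2⟩⟩ := mem_branchPairs.1 hI
  obtain ⟨⟨⟨-, hc1'⟩, -, hq1'⟩, ⟨-, -, hq2'⟩⟩ := mem_branchPairs.1 hI'
  have hV1 : I.1.1 ⊆ I'.1.1 := by
    intro x hx
    obtain ⟨m, hm⟩ := h1.reach x hx
    have hit : ∀ i, (pairParent o I')^[i] x = (pairParent o I)^[i] x := by
      intro i
      induction i with
      | zero => rfl
      | succ i ih =>
        rw [Function.iterate_succ_apply', Function.iterate_succ_apply', ih]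
        rcases Finset.mem_insert.1 (h1.iterate_mem hx i) with h | h
        · rw [h, h1.map_root, h1'.map_root]
        · exact (hp _ (Finset.mem_union_left _ h)).symm
    have hxV : x ∈ pairVerts I' := hV ▸ Finset.mem_union_left _ hx
    rcases Finset.mem_union.1 hxV with h | h
    · exact h
    · exfalso
      have h3 := h2'.iterate_mem h m
      rw [hit, hm, hr] at h3
      rcases Finset.mem_insert.1 h3 with h4 | h4
      · exact h1'.root_notMem (h4 ▸ h1'.top_mem)
      · exact Finset.disjoint_left.1 hd' h1'.top_mem h4
  have hV1 : I.1.1 = I'.1.1 := Finset.eq_of_subset_of_card_le hV1 (by rw [hc1, hc1'])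
  have hV2 : I.2.1 = I'.2.1 := by
    have e1 : I.2.1 = pairVerts I \ I.1.1 := by
      rw [pairVerts, Finset.union_sdiff_cancel_left hd]
    have e2 : I'.2.1 = pairVerts I' \ I'.1.1 := by
      rw [pairVerts, Finset.union_sdiff_cancel_left hd']
    rw [e1, e2, hV, hV1]
  have hr2 : I.2.2.1 = I'.2.2.1 := by
    by_contra hne
    have h3 := h2'.map_mem I.2.2.1 (hV2 ▸ h2.top_mem) hne
    rw [← hp _ (Finset.mem_union_right _ h2.top_mem), h2.map_top] at h3
    exact h2'.root_notMem h3
  have hfun : I.1.2.2 = I'.1.2.2 := by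
    funext x
    by_cases hx : x ∈ I.1.1.erase I.1.2.1
    · obtain ⟨hxr, hxV⟩ := Finset.mem_erase.1 hx
      have h3 := hp x (Finset.mem_union_left _ hxV)
      have h4 : x ≠ I.2.2.1 := fun h => Finset.disjoint_left.1 hd hxV (h ▸ h2.top_mem)
      simpa [pairParent, hxr, hxV, h4, ← hr, ← hr2, ← hV1] using h3
    · rw [(mem_forests.1 hq1).1 x hx, (mem_forests.1 hq1').1 x (by rwa [← hV1, ← hr])]
  have hfun2 : I.2.2.2 = I'.2.2.2 := by
    funext x
    by_cases hx : x ∈ I.2.1.erase I.2.2.1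
    · obtain ⟨hxr, hxV⟩ := Finset.mem_erase.1 hx
      have h3 := hp x (Finset.mem_union_right _ hxV)
      have h4 : x ≠ I.1.2.1 := fun h => Finset.disjoint_right.1 hd hxV (h ▸ h1.top_mem)
      have h5 : x ∉ I.1.1 := Finset.disjoint_right.1 hd hxV
      simpa [pairParent, hxr, h5, h4, ← hr, ← hr2, ← hV1] using h3
    · rw [(mem_forests.1 hq2).1 x hx, (mem_forests.1 hq2').1 x (by rwa [← hV2, ← hr2])]
  obtain ⟨⟨V1, r1, q1⟩, V2, r2, q2⟩ := I
  obtain ⟨⟨V1', r1', q1'⟩, V2', r2', q2'⟩ := I'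
  dsimp only at hV1 hV2 hr hr2 hfun hfun2
  subst hV1 hV2 hr hr2 hfun hfun2
  rfl

open Classical in
/-- The pairs of branches whose tree has `B` as a good part. -/
noncomputable def goodPairs (o : α) (S : Finset α) (d : ℕ) (B : Finset (Sym2 α)) :
    Finset ((_ : (_ : Finset α) × (_ : α) × (α → α)) × ((_ : Finset α) × (_ : α) × (α → α))) :=
  (branchPairs (Finset.univ.erase o) d).filter fun I =>
    GoodPart S (pairVerts I) (pairParent o I) B

theorem mem_goodPairs {d : ℕ}
    {I : (_ : (_ : Finset α) × (_ : α) × (α → α)) × ((_ : Finset α) × (_ : α) × (α → α))} :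
    I ∈ goodPairs o S d B ↔ I ∈ branchPairs (Finset.univ.erase o) d ∧
      GoodPart S (pairVerts I) (pairParent o I) B := by
  classical
  simp [goodPairs]

theorem card_goodPairs_le {d b q a : ℕ} (hB : B ∈ goodParts o S b q a) :
    (goodPairs o S d B).card ≤ 2 * (((S.erase o).card.choose (2 * d - b - q) * (q + a).choose q) *
      (2 * d - b + a + 1) ^ (2 * d - b)) := by
  obtain ⟨-, hb, hq, ha⟩ := mem_goodParts.1 hB
  have h1 := card_trees_above_le (k := 2 * d) hb hq ha
    ((goodPairs o S d B).image fun I => treeEdges (pairVerts I) (pairParent o I)) (by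
      intro T hT
      obtain ⟨I, hI, rfl⟩ := Finset.mem_image.1 hT
      obtain ⟨hI, hg⟩ := mem_goodPairs.1 hI
      exact ⟨_, _, isTreeOn_pairParent hI, card_pairVerts hI, rfl, hg⟩)
  refine le_trans ?_ (Nat.mul_le_mul_left 2 h1)
  refine Finset.card_le_mul_card_image _ 2 fun T hT => ?_
  -- the top vertex of the first branch is one of the two children of the root
  obtain ⟨I₀, hI₀, hT₀⟩ := Finset.mem_image.1 hT
  have hb₀ := (mem_goodPairs.1 hI₀).1
  refine le_trans (Finset.card_le_card_of_injOn (t := {I₀.1.2.1, I₀.2.2.1})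
    (fun I => I.1.2.1) ?_ ?_) Finset.card_le_two
  · intro I hI
    obtain ⟨hI, hIT⟩ := Finset.mem_filter.1 (Finset.mem_coe.1 hI)
    have hbI := (mem_goodPairs.1 hI).1
    have ht := isTreeOn_pairParent hbI
    have ht₀ := isTreeOn_pairParent hb₀
    have hV : pairVerts I = pairVerts I₀ := by
      rw [← ht.edgeVerts_treeEdges, hIT, ← hT₀, ht₀.edgeVerts_treeEdges]
    obtain ⟨h1, -⟩ := isBranch_of_mem_branchPairs hbI
    obtain ⟨h1₀, h2₀⟩ := isBranch_of_mem_branchPairs hb₀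
    have hmem : I.1.2.1 ∈ pairVerts I := Finset.mem_union_left _ h1.top_mem
    have hp := ht.parent_unique (hIT.trans (hT₀.symm.trans (by rw [hV]))) _ hmem
    rw [h1.map_top] at hp
    rw [Finset.mem_coe, Finset.mem_insert, Finset.mem_singleton]
    rw [hV] at hmem
    by_contra hne
    push Not at hne
    rcases Finset.mem_union.1 hmem with h | h
    · exact h1₀.root_notMem (hp ▸ h1₀.map_mem _ h hne.1)
    · exact h2₀.root_notMem (hp ▸ h2₀.map_mem _ h hne.2)
  · intro I hI I' hI' hr
    obtain ⟨hI, hIT⟩ := Finset.mem_filter.1 (Finset.mem_coe.1 hI)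
    obtain ⟨hI', hIT'⟩ := Finset.mem_filter.1 (Finset.mem_coe.1 hI')
    exact branchPairs_ext (mem_goodPairs.1 hI).1 (mem_goodPairs.1 hI').1 (hIT.trans hIT'.symm) hr

/-- If the root is not planted, its two edges belong to every good part; a good part that is too
small to contain a whole branch then has a planted vertex with a parent edge in each branch. -/
theorem two_le_of_root_notMem {d b q a : ℕ} (ho : o ∉ S) (hB : B ∈ goodParts o S b q a)
    (hne : (goodPairs o S d B).Nonempty) (hbd : b < d) : 2 ≤ a := by
  obtain ⟨-, hb, hq, ha⟩ := mem_goodParts.1 hB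
  obtain ⟨I, hI⟩ := hne
  obtain ⟨hI, hg⟩ := mem_goodPairs.1 hI
  have ht := isTreeOn_pairParent hI
  obtain ⟨h1, h2⟩ := isBranch_of_mem_branchPairs hI
  have hd := disjoint_of_mem_branchPairs hI
  have hc := ht.card_edgeVerts_inter hg
  have hJ := ht.card_lowVerts hg.1
  have hc1 := (mem_branchPairs.1 hI).1.1.2
  have hc2 := (mem_branchPairs.1 hI).2.1.2
  have htop : ∀ {V r}, IsBranch o V r (pairParent o I) → V ⊆ pairVerts I →
      r ∈ lowVerts (pairVerts I) (pairParent o I) B := by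
    intro V r h hV
    by_contra hr
    have := (hg.mem_of_notMem_lowVerts (hV h.top_mem) hr).2
    rw [h.map_top] at this
    exact ho this
  obtain ⟨z1, hz1, hz1'⟩ := h1.exists_planted (W := pairVerts I) Finset.subset_union_left hg
    (htop h1 Finset.subset_union_left) (by rw [hJ]; omega)
  obtain ⟨z2, hz2, hz2'⟩ := h2.exists_planted (W := pairVerts I) Finset.subset_union_right hg
    (htop h2 Finset.subset_union_right) (by rw [hJ]; omega)
  have hz : z1 ≠ z2 := fun h => Finset.disjoint_left.1 hd hz1 (h ▸ hz2)
  have h3 : 2 ≤ (lowVerts (pairVerts I) (pairParent o I) B ∩ S).card := by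
    rw [← Finset.card_pair hz]
    exact Finset.card_le_card (Finset.insert_subset hz1' (Finset.singleton_subset_iff.2 hz2'))
  omega

/-- A nonempty good part with fewer than `d` edges does not contain a whole branch, so it covers a
planted vertex: either one without a parent edge in it, or one with such an edge. -/
theorem one_le_or_one_le_of_nonempty {d b q a : ℕ} (hB : B ∈ goodParts o S b q a)
    (hne : (goodPairs o S d B).Nonempty) (hb1 : 1 ≤ b) (hbd : b < d) : 1 ≤ q ∨ 1 ≤ a := by
  obtain ⟨-, hb, hq, ha⟩ := mem_goodParts.1 hB
  obtain ⟨I, hI⟩ := hne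
  obtain ⟨hI, hg⟩ := mem_goodPairs.1 hI
  have ht := isTreeOn_pairParent hI
  obtain ⟨h1, h2⟩ := isBranch_of_mem_branchPairs hI
  have hc := ht.card_edgeVerts_inter hg
  have hc' := ht.card_edgeVerts_sdiff hg.1
  have hJ := ht.card_lowVerts hg.1
  have hc1 := (mem_branchPairs.1 hI).1.1.2
  have hc2 := (mem_branchPairs.1 hI).2.1.2
  have key : ∀ {V r}, IsBranch o V r (pairParent o I) → V ⊆ pairVerts I → V.card = d →
      ∀ x ∈ V, x ∈ lowVerts (pairVerts I) (pairParent o I) B → 1 ≤ q ∨ 1 ≤ a := by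
    intro V r h hV hVd x hx hxJ
    by_cases hr : r ∈ lowVerts (pairVerts I) (pairParent o I) B
    · obtain ⟨z, -, hz⟩ := h.exists_planted hV hg hr (by rw [hJ]; omega)
      have := Finset.card_pos.2 ⟨z, hz⟩
      right; omega
    · obtain ⟨y, hy, hyJ, hpV, hpJ⟩ := h.exists_step
        (P := fun y => y ∉ lowVerts (pairVerts I) (pairParent o I) B) hr hx (not_not.2 hxJ)
      have hpo : pairParent o I y ≠ o := fun h' => h.root_notMem (h' ▸ hpV)
      have hmem : pairParent o I y ∈
          edgeVerts o B \ lowVerts (pairVerts I) (pairParent o I) B :=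
        Finset.mem_sdiff.2 ⟨mem_edgeVerts.2 ⟨hpo, _, (mem_lowVerts.1 (not_not.1 hyJ)).2,
          Sym2.mem_mk_right _ _⟩, hpJ⟩
      have := Finset.card_pos.2 ⟨_, hmem⟩
      left; omega
  obtain ⟨x, hx⟩ := Finset.card_pos.1 (show 0 <
    (lowVerts (pairVerts I) (pairParent o I) B).card by omega)
  rcases Finset.mem_union.1 (mem_lowVerts.1 hx).1 with h | h
  · exact key h1 Finset.subset_union_left hc1 x h hx
  · exact key h2 Finset.subset_union_right hc2 x h hx
end Pairs

/-! ### The Hermite expansion of the estimator -/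

theorem prod_eq_prod_realHermite {n : ℕ} (B : Finset (Sym2 (Fin n))) (z : Sym2 (Fin n) → ℝ) :
    ∏ e ∈ B, z e = ∏ e, (realHermite (if e ∈ B then 1 else 0)).eval (z e) := by
  have h : ∀ e, (realHermite (if e ∈ B then 1 else 0)).eval (z e) = if e ∈ B then z e else 1 := by
    intro e
    split_ifs <;> simp [realHermite]
  rw [Finset.prod_congr rfl fun e _ => h e, Finset.prod_ite_mem, Finset.univ_inter]

theorem integrable_prod_mul_prod {n : ℕ} (B B' : Finset (Sym2 (Fin n))) :
    Integrable (fun z => (∏ e ∈ B, z e) * ∏ e ∈ B', z e) (noiseLaw n) := by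
  simp_rw [prod_eq_prod_realHermite B, prod_eq_prod_realHermite B', ← Finset.prod_mul_distrib]
  exact integrable_prod_realHermite_mul _ _

theorem integral_prod_mul_prod {n : ℕ} (B B' : Finset (Sym2 (Fin n))) :
    ∫ z, (∏ e ∈ B, z e) * ∏ e ∈ B', z e ∂(noiseLaw n) = if B = B' then 1 else 0 := by
  simp_rw [prod_eq_prod_realHermite B, prod_eq_prod_realHermite B', ← Finset.prod_mul_distrib]
  rw [integral_prod_realHermite_mul (fun e => if e ∈ B then 1 else 0)
    (fun e => if e ∈ B' then 1 else 0)]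
  by_cases h : B = B'
  · subst h
    rw [if_pos rfl, if_pos rfl]
    exact Finset.prod_eq_one fun e _ => by split_ifs <;> simp
  · rw [if_neg h, if_neg]
    intro h'
    refine h (Finset.ext fun e => ?_)
    have := congrFun h' e
    by_cases h1 : e ∈ B <;> by_cases h2 : e ∈ B' <;> simp_all

theorem integrable_sum_prod_sq {n : ℕ} (c : Finset (Sym2 (Fin n)) → ℝ) :
    Integrable (fun z => (∑ B, c B * ∏ e ∈ B, z e) ^ 2) (noiseLaw n) := by
  simp_rw [sq, Finset.sum_mul_sum, mul_mul_mul_comm]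
  exact integrable_finsetSum _ fun B _ => integrable_finsetSum _ fun B' _ =>
    (integrable_prod_mul_prod B B').const_mul _

theorem integral_sum_prod_sq {n : ℕ} (c : Finset (Sym2 (Fin n)) → ℝ) :
    ∫ z, (∑ B, c B * ∏ e ∈ B, z e) ^ 2 ∂(noiseLaw n) = ∑ B, c B ^ 2 := by
  simp_rw [sq, Finset.sum_mul_sum, mul_mul_mul_comm]
  rw [integral_finsetSum _ fun B _ => integrable_finsetSum _ fun B' _ =>
    (integrable_prod_mul_prod B B').const_mul _]
  refine Finset.sum_congr rfl fun B _ => ?_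
  rw [integral_finsetSum _ fun B' _ => (integrable_prod_mul_prod B B').const_mul _]
  simp [integral_const_mul, integral_prod_mul_prod]

theorem integrable_sum_prod {n : ℕ} (c : Finset (Sym2 (Fin n)) → ℝ) :
    Integrable (fun z => ∑ B, c B * ∏ e ∈ B, z e) (noiseLaw n) := by
  refine integrable_finsetSum _ fun B _ => Integrable.const_mul ?_ _
  simpa using integrable_prod_mul_prod B ∅

theorem integral_sum_prod {n : ℕ} (c : Finset (Sym2 (Fin n)) → ℝ) :
    ∫ z, ∑ B, c B * ∏ e ∈ B, z e ∂(noiseLaw n) = c ∅ := by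
  rw [integral_finsetSum _ fun B _ => Integrable.const_mul
    (by simpa using integrable_prod_mul_prod B ∅) _]
  have h : ∀ B : Finset (Sym2 (Fin n)),
      ∫ z, ∏ e ∈ B, z e ∂(noiseLaw n) = if B = ∅ then 1 else 0 := fun B => by
    simpa using integral_prod_mul_prod B ∅
  simp [integral_const_mul, h]

theorem sum_prod_add {ι E : Type*} [Fintype E] [DecidableEq E] (I : Finset ι) (T : ι → Finset E)
    (t z : E → ℝ) :
    ∑ i ∈ I, ∏ e ∈ T i, (t e + z e)
      = ∑ B, (∑ i ∈ I with B ⊆ T i, ∏ e ∈ T i \ B, t e) * ∏ e ∈ B, z e := by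
  simp_rw [Finset.sum_mul, Finset.sum_filter]
  rw [Finset.sum_comm]
  refine Finset.sum_congr rfl fun i _ => ?_
  simp_rw [add_comm (t _), Finset.prod_add]
  rw [← Finset.sum_filter]
  refine Finset.sum_congr (by ext; simp) fun B _ => mul_comm _ _

/-- The estimator: the sum, over all pairs of branches below the vertex `o`, of the product of the
observations at the edges of the tree. -/
noncomputable def branchPoly {n : ℕ} (o : Fin n) (d : ℕ) : MvPolynomial (Fin n × Fin n) ℝ :=
  ∑ I ∈ branchPairs (Finset.univ.erase o) d,
    ∏ x ∈ pairVerts I, MvPolynomial.X (x, pairParent o I x)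

theorem totalDegree_branchPoly_le {n : ℕ} (o : Fin n) (d : ℕ) :
    (branchPoly o d).totalDegree ≤ 2 * d := by
  refine MvPolynomial.totalDegree_finsetSum_le fun I hI => ?_
  refine (MvPolynomial.totalDegree_finsetProd _ _).trans ?_
  simp [card_pairVerts hI]

theorem evalMatrix_branchPoly {n : ℕ} (o : Fin n) (d : ℕ) (lam : ℝ) (w : Sample n) :
    evalMatrix (branchPoly o d) (obs lam w) = ∑ I ∈ branchPairs (Finset.univ.erase o) d,
      ∏ e ∈ treeEdges (pairVerts I) (pairParent o I), obsEdge lam w e := by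
  rw [evalMatrix, branchPoly, map_sum]
  refine Finset.sum_congr rfl fun I hI => ?_
  rw [map_prod, treeEdges, Finset.prod_image (isTreeOn_pairParent hI).injOn]
  simp [obs_eq_obsEdge]

theorem sum_prod_pairProd_eq_card_goodPairs {n d : ℕ} (o : Fin n) (S : Finset (Fin n))
    (B : Finset (Sym2 (Fin n))) :
    (∑ I ∈ branchPairs (Finset.univ.erase o) d with B ⊆ treeEdges (pairVerts I) (pairParent o I),
      ∏ e ∈ treeEdges (pairVerts I) (pairParent o I) \ B, pairProd (plant S) e)
      = ((goodPairs o S d B).card : ℝ) := by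
  classical
  rw [goodPairs, Finset.card_filter, Finset.sum_filter]
  push_cast
  refine Finset.sum_congr rfl fun I _ => ?_
  by_cases h1 : B ⊆ treeEdges (pairVerts I) (pairParent o I)
  · rw [if_pos h1]
    split_ifs with h2
    · refine Finset.prod_eq_one fun e he => pairProd_plant_eq_one ?_
      obtain ⟨he, heB⟩ := Finset.mem_sdiff.1 he
      exact h2.2 e he heB
    · have : ∃ e ∈ treeEdges (pairVerts I) (pairParent o I), e ∉ B ∧ ∃ v ∈ e, v ∉ S := by
        by_contra hne
        push Not at hne
        exact h2 ⟨h1, hne⟩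
      obtain ⟨e, he, heB, v, hv, hvS⟩ := this
      exact Finset.prod_eq_zero (Finset.mem_sdiff.2 ⟨he, heB⟩) (pairProd_plant_eq_zero hv hvS)
  · rw [if_neg h1, if_neg fun h => h1 h.1]

/-- The Hermite expansion of the estimator for a given planted set. -/
theorem evalMatrix_branchPoly_plant {n : ℕ} (o : Fin n) (d : ℕ) (lam : ℝ) (S : Finset (Fin n))
    (z : Sym2 (Fin n) → ℝ) :
    evalMatrix (branchPoly o d) (obs lam (plant S, z))
      = ∑ B, (lam ^ (2 * d - B.card) * ((goodPairs o S d B).card : ℝ)) * ∏ e ∈ B, z e := by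
  simp_rw [evalMatrix_branchPoly, obsEdge]
  rw [sum_prod_add]
  refine Finset.sum_congr rfl fun B _ => ?_
  rw [← sum_prod_pairProd_eq_card_goodPairs, Finset.mul_sum]
  congr 1
  refine Finset.sum_congr rfl fun I hI => ?_
  obtain ⟨hI, hB⟩ := Finset.mem_filter.1 hI
  rw [Finset.prod_mul_distrib, Finset.prod_const, Finset.card_sdiff_of_subset hB,
    (isTreeOn_pairParent hI).card_treeEdges, card_pairVerts hI]

theorem sum_plantWeight_subset {n : ℕ} (rho : unitInterval) (A : Finset (Fin n)) :
    ∑ S : Finset (Fin n), plantWeight rho S * (if A ⊆ S then 1 else 0)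
      = (rho : ℝ) ^ A.card := by
  have h := sum_plantWeight_mul_prod rho fun (i : Fin n) x => if i ∈ A then x else 1
  simp only [Finset.prod_ite_mem, Finset.univ_inter] at h
  have h2 : ∏ i : Fin n, ((rho : ℝ) * (if i ∈ A then 1 else 1)
      + (1 - (rho : ℝ)) * (if i ∈ A then 0 else 1)) = (rho : ℝ) ^ A.card := by
    have h3 : (rho : ℝ) ^ A.card = ∏ i, if i ∈ A then (rho : ℝ) else 1 := by
      rw [Finset.prod_ite_mem, Finset.univ_inter, Finset.prod_const]
    rw [h3]
    refine Finset.prod_congr rfl fun i _ => ?_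
    split_ifs <;> ring
  rw [← h2, ← h]
  refine Finset.sum_congr rfl fun S _ => ?_
  congr 1
  split_ifs with hA
  · exact (Finset.prod_eq_one fun i hi => by simp [plant, hA hi]).symm
  · obtain ⟨i, hi, hiS⟩ := Finset.not_subset.1 hA
    exact (Finset.prod_eq_zero hi (by simp [plant, hiS])).symm

theorem integral_branchPoly_sq {n : ℕ} (o : Fin n) (d : ℕ) (lam : ℝ) (rho : unitInterval) :
    ∫ w, evalMatrix (branchPoly o d) (obs lam w) ^ 2 ∂(law n rho)
      = ∑ S : Finset (Fin n), plantWeight rho S *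
        ∑ B, (lam ^ (2 * d - B.card) * ((goodPairs o S d B).card : ℝ)) ^ 2 := by
  rw [integral_law ((measurable_evalMatrix_obs lam _).pow_const 2) fun S => by
    simp_rw [evalMatrix_branchPoly_plant]; exact integrable_sum_prod_sq _]
  simp_rw [evalMatrix_branchPoly_plant, integral_sum_prod_sq]

/-- A pair of branches contributes to the mean of the estimator if and only if all vertices of the
tree are planted. -/
theorem goodPart_empty_iff {α : Type*} [Fintype α] [DecidableEq α] {o : α} {S : Finset α} {d : ℕ}
    {I : (_ : (_ : Finset α) × (_ : α) × (α → α)) × ((_ : Finset α) × (_ : α) × (α → α))}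
    (hI : I ∈ branchPairs (Finset.univ.erase o) d) :
    GoodPart S (pairVerts I) (pairParent o I) ∅ ↔ insert o (pairVerts I) ⊆ S := by
  have ht := isTreeOn_pairParent hI
  obtain ⟨h1, -⟩ := isBranch_of_mem_branchPairs hI
  constructor
  · intro h
    have hV : ∀ x ∈ pairVerts I, x ∈ S ∧ pairParent o I x ∈ S := fun x hx =>
      h.mem_of_notMem_lowVerts hx (by simp [lowVerts])
    refine Finset.insert_subset ?_ fun x hx => (hV x hx).1
    have := (hV _ (Finset.mem_union_left _ h1.top_mem)).2
    rwa [h1.map_top] at this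
  · intro h
    refine ⟨Finset.empty_subset _, fun e he _ v hv => ?_⟩
    obtain ⟨x, hx, rfl⟩ := Finset.mem_image.1 he
    rcases Sym2.mem_iff.1 hv with rfl | rfl
    · exact h (Finset.mem_insert_of_mem hx)
    · exact h (ht.map_mem x hx)

theorem integral_branchPoly_mul {n : ℕ} (hn : 0 < n) (d : ℕ) (lam : ℝ)
    (rho : unitInterval) :
    ∫ w, evalMatrix (branchPoly ⟨0, hn⟩ d) (obs lam w) * estimand w ∂(law n rho)
      = lam ^ (2 * d) * (rho : ℝ) ^ (2 * d + 1) *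
        (branchPairs (Finset.univ.erase (⟨0, hn⟩ : Fin n)) d).card := by
  set o : Fin n := ⟨0, hn⟩ with ho
  have hest : ∀ (S : Finset (Fin n)) z, estimand (plant S, z) = if o ∈ S then 1 else 0 := by
    intro S z; simp [estimand, hn, plant, ho]
  rw [integral_law (F := fun w => evalMatrix (branchPoly o d) (obs lam w) * estimand w)
    ((measurable_evalMatrix_obs lam _).mul measurable_estimand) fun S => by
    simp_rw [evalMatrix_branchPoly_plant, hest]
    exact (integrable_sum_prod _).mul_const _]
  simp_rw [evalMatrix_branchPoly_plant, hest, integral_mul_const, integral_sum_prod,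
    Finset.card_empty, Nat.sub_zero]
  classical
  have h1 : ∀ S : Finset (Fin n), plantWeight rho S *
      (lam ^ (2 * d) * ((goodPairs o S d ∅).card : ℝ) * (if o ∈ S then 1 else 0))
      = lam ^ (2 * d) * ∑ I ∈ branchPairs (Finset.univ.erase o) d,
        plantWeight rho S * (if insert o (pairVerts I) ⊆ S then 1 else 0) := by
    intro S
    have h2 : ((goodPairs o S d ∅).card : ℝ) * (if o ∈ S then 1 else 0)
        = ∑ I ∈ branchPairs (Finset.univ.erase o) d,
          if insert o (pairVerts I) ⊆ S then (1 : ℝ) else 0 := by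
      rw [goodPairs, Finset.card_filter]
      push_cast
      rw [Finset.sum_mul]
      refine Finset.sum_congr rfl fun I hI => ?_
      simp only [goodPart_empty_iff hI]
      split_ifs with h3 h4 h4
      · simp
      · exact absurd (h3 (Finset.mem_insert_self _ _)) h4
      all_goals simp
    rw [← Finset.mul_sum, ← h2]; ring
  rw [Finset.sum_congr rfl fun S _ => h1 S, ← Finset.mul_sum, Finset.sum_comm]
  simp_rw [sum_plantWeight_subset]
  have h5 : ∀ I ∈ branchPairs (Finset.univ.erase o) d,
      (rho : ℝ) ^ (insert o (pairVerts I)).card = (rho : ℝ) ^ (2 * d + 1) := by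
    intro I hI
    rw [Finset.card_insert_of_notMem (isTreeOn_pairParent hI).root_notMem, card_pairVerts hI]
  rw [Finset.sum_congr rfl h5, Finset.sum_const, nsmul_eq_mul]
  ring

/-! ### Moments of the planted set and counting estimates -/

/-- Moments of the number of planted vertices, on the event that the vertices of `P` are planted.
The proof expands one factor `|S|` as a sum over the vertices. -/
theorem sum_plantWeight_mul_card_pow_le {n : ℕ} (rho : unitInterval) (P : Finset (Fin n)) (j : ℕ) :
    ∑ S : Finset (Fin n), plantWeight rho S * ((if P ⊆ S then 1 else 0) * (S.card : ℝ) ^ j)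
      ≤ (rho : ℝ) ^ P.card * (n * rho + P.card + j) ^ j := by
  have hr0 : 0 ≤ (rho : ℝ) := rho.2.1
  have hr1 : (rho : ℝ) ≤ 1 := rho.2.2
  induction j generalizing P with
  | zero => simpa using (sum_plantWeight_subset rho P).le
  | succ j ih =>
    have h1 : ∀ S : Finset (Fin n),
        plantWeight rho S * ((if P ⊆ S then 1 else 0) * (S.card : ℝ) ^ (j + 1))
        = ∑ x, plantWeight rho S * ((if insert x P ⊆ S then 1 else 0) * (S.card : ℝ) ^ j) := by
      intro S
      have h2 : ∀ x, (if insert x P ⊆ S then (1 : ℝ) else 0)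
          = (if P ⊆ S then 1 else 0) * (if x ∈ S then 1 else 0) := by
        intro x
        by_cases hx : x ∈ S <;> by_cases hP : P ⊆ S <;> simp [Finset.insert_subset_iff, hx, hP]
      simp_rw [h2, mul_assoc, ← Finset.mul_sum, ← Finset.sum_mul]
      simp [pow_succ']
    simp_rw [h1]
    rw [Finset.sum_comm]
    have h3 : ∀ x, ∑ S : Finset (Fin n), plantWeight rho S *
          ((if insert x P ⊆ S then 1 else 0) * (S.card : ℝ) ^ j)
        ≤ (rho + if x ∈ P then 1 else 0) *
          ((rho : ℝ) ^ P.card * (n * rho + P.card + (j + 1 : ℕ)) ^ j) := by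
      intro x
      refine (ih (insert x P)).trans ?_
      push_cast
      by_cases hx : x ∈ P
      · rw [Finset.insert_eq_of_mem hx, if_pos hx]
        have h4 : (rho : ℝ) ^ P.card * (n * rho + P.card + j) ^ j
            ≤ (rho : ℝ) ^ P.card * (n * rho + P.card + (j + 1)) ^ j := by gcongr; linarith
        refine h4.trans (le_mul_of_one_le_left (by positivity) (by linarith))
      · rw [Finset.card_insert_of_notMem hx, if_neg hx, pow_succ]
        push_cast
        refine le_of_eq ?_
        ring
    refine (Finset.sum_le_sum fun x _ => h3 x).trans ?_
    rw [← Finset.sum_mul, Finset.sum_add_distrib]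
    simp only [Finset.sum_const, Finset.card_univ, Fintype.card_fin, nsmul_eq_mul,
      Finset.sum_ite_mem, Finset.univ_inter, mul_one]
    rw [pow_succ _ j, mul_comm _ (_ * _), ← mul_assoc]
    refine mul_le_mul_of_nonneg_left ?_ (by positivity)
    linarith [Nat.cast_nonneg (α := ℝ) (j + 1)]

/-- The number of good parts with given parameters, times the square of the number of trees above
each of them. The factors `(v + 1) ^ v` from the parent functions are cancelled by the factorials
from the choice of vertices, at the cost of a factor `e` for each edge. -/
theorem sum_sq_card_goodPairs_le {n : ℕ} (o : Fin n) (S : Finset (Fin n)) {d a c q m : ℕ}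
    (hk : 2 * d = a + c + q + m) :
    ∑ B ∈ goodParts o S (a + c) q a, ((goodPairs o S d B).card : ℝ) ^ 2
      ≤ 4 * ((S.card : ℝ) ^ (q + a + 2 * m) * (n : ℝ) ^ c * (2 * d : ℝ) ^ (a + 2 * q) *
        4 ^ (q + a) * Real.exp 1 ^ (3 * a + c + 3 * q + 2 * m + 3)) := by
  set K := (S.erase o).card with hK
  have hKS : (K : ℝ) ≤ S.card := Nat.cast_le.2 Finset.card_erase_le
  have hk' : (2 * d : ℝ) = ((a + c + q + m : ℕ) : ℝ) := by rw [← hk]; push_cast; ring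
  have hM1 : ((goodParts o S (a + c) q a).card : ℝ)
      ≤ (S.card : ℝ) ^ (q + a) * (n : ℝ) ^ c * (2 * d : ℝ) ^ a * Real.exp 1 ^ (a + c + q + 1) := by
    have h1 : ((goodParts o S (a + c) q a).card : ℝ)
        ≤ (K.choose q : ℝ) * ((K.choose a : ℝ) * (n.choose c : ℝ)) * 
          ((a + c + (q + 1) : ℕ) : ℝ) ^ (a + c) := by
      have := card_goodParts_le o S (a + c) q a
      rw [Fintype.card_fin, Nat.add_sub_cancel_left] at this
      exact_mod_cast this
    have h2 : (K.choose q : ℝ) ≤ (K : ℝ) ^ q := by exact_mod_cast Nat.choose_le_pow K q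
    have h3 : (K.choose a : ℝ) ≤ (K : ℝ) ^ a / a.factorial := Nat.choose_le_pow_div a K
    have h4 : (n.choose c : ℝ) ≤ (n : ℝ) ^ c / c.factorial := Nat.choose_le_pow_div c n
    have h5 := add_pow_le_exp_mul_factorial (a + c) (q + 1)
    have h6 : ((a + c).factorial : ℝ) ≤ (2 * d : ℝ) ^ a * (a.factorial * c.factorial) := by
      have h7 : ((a + c).choose c : ℝ) ≤ (2 * d : ℝ) ^ a := by
        rw [← Nat.choose_symm_add]
        calc ((a + c).choose a : ℝ) ≤ ((a + c : ℕ) : ℝ) ^ a := by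
              exact_mod_cast Nat.choose_le_pow (a + c) a
          _ ≤ _ := by
            rw [hk']
            exact pow_le_pow_left₀ (Nat.cast_nonneg _) (Nat.cast_le.2 (by omega)) _
      rw [← Nat.add_choose_mul_factorial_mul_factorial a c]
      push_cast
      rw [mul_assoc]
      gcongr
    calc _ ≤ _ := h1
      _ ≤ (K : ℝ) ^ q * ((K : ℝ) ^ a / a.factorial * ((n : ℝ) ^ c / c.factorial)) *
          (Real.exp 1 ^ (a + c + (q + 1)) *
            ((2 * d : ℝ) ^ a * (a.factorial * c.factorial))) := by
          gcongr
          exact h5.trans (by gcongr)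
      _ = (K : ℝ) ^ (q + a) * (n : ℝ) ^ c * (2 * d : ℝ) ^ a * Real.exp 1 ^ (a + c + q + 1) := by
          rw [pow_add (K : ℝ)]; field_simp; ring
      _ ≤ _ := by gcongr
  have hM2 : ∀ B ∈ goodParts o S (a + c) q a, ((goodPairs o S d B).card : ℝ)
      ≤ 2 * ((S.card : ℝ) ^ m * 2 ^ (q + a) * (2 * d : ℝ) ^ q * Real.exp 1 ^ (m + q + a + 1)) := by
    intro B hB
    have h1 : ((goodPairs o S d B).card : ℝ) ≤ 2 * (((K.choose m : ℝ) * ((q + a).choose q : ℝ)) *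
        ((m + q + (a + 1) : ℕ) : ℝ) ^ (m + q)) := by
      have := card_goodPairs_le (d := d) hB
      rw [show 2 * d - (a + c) = m + q by omega, Nat.add_sub_cancel] at this
      exact_mod_cast this
    have h3 : (K.choose m : ℝ) ≤ (K : ℝ) ^ m / m.factorial := Nat.choose_le_pow_div m K
    have h4 : ((q + a).choose q : ℝ) ≤ 2 ^ (q + a) := by exact_mod_cast Nat.choose_le_two_pow _ _
    have h5 := add_pow_le_exp_mul_factorial (m + q) (a + 1)
    have h6 : ((m + q).factorial : ℝ) ≤ (2 * d : ℝ) ^ q * m.factorial := by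
      have h7 : (m + q).factorial ≤ (m + q) ^ q * m.factorial := by
        have := Nat.factorial_mul_descFactorial (show q ≤ m + q by omega)
        rw [Nat.add_sub_cancel] at this
        rw [← this, mul_comm]
        exact Nat.mul_le_mul_right _ (Nat.descFactorial_le_pow _ _)
      calc ((m + q).factorial : ℝ) ≤ ((m + q : ℕ) : ℝ) ^ q * m.factorial := by exact_mod_cast h7
        _ ≤ _ := by
          rw [hk']
          exact mul_le_mul_of_nonneg_right (pow_le_pow_left₀ (Nat.cast_nonneg _)
            (Nat.cast_le.2 (by omega)) _) (Nat.cast_nonneg _)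
    refine h1.trans ?_
    gcongr 2 * ?_
    calc _ ≤ (K : ℝ) ^ m / m.factorial * 2 ^ (q + a) *
          (Real.exp 1 ^ (m + q + (a + 1)) * ((2 * d : ℝ) ^ q * m.factorial)) := by
          gcongr
          exact h5.trans (by gcongr)
      _ = (K : ℝ) ^ m * 2 ^ (q + a) * (2 * d : ℝ) ^ q * Real.exp 1 ^ (m + q + a + 1) := by
          field_simp; ring
      _ ≤ _ := by gcongr
  calc _ ≤ ∑ B ∈ goodParts o S (a + c) q a,
        (2 * ((S.card : ℝ) ^ m * 2 ^ (q + a) * (2 * d : ℝ) ^ q *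
          Real.exp 1 ^ (m + q + a + 1))) ^ 2 :=
        Finset.sum_le_sum fun B hB => pow_le_pow_left₀ (Nat.cast_nonneg _) (hM2 B hB) 2
    _ = (goodParts o S (a + c) q a).card * (2 * ((S.card : ℝ) ^ m * 2 ^ (q + a) * (2 * d : ℝ) ^ q *
          Real.exp 1 ^ (m + q + a + 1))) ^ 2 := by rw [Finset.sum_const, nsmul_eq_mul]
    _ ≤ ((S.card : ℝ) ^ (q + a) * (n : ℝ) ^ c * (2 * d : ℝ) ^ a * Real.exp 1 ^ (a + c + q + 1)) *
        (2 * ((S.card : ℝ) ^ m * 2 ^ (q + a) * (2 * d : ℝ) ^ q *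
          Real.exp 1 ^ (m + q + a + 1))) ^ 2 := by gcongr
    _ = _ := by
        rw [show (4 : ℝ) ^ (q + a) = (2 ^ (q + a)) ^ 2 by
          rw [← pow_mul, mul_comm, pow_mul]; norm_num]
        ring

/-! ### The contribution of the good parts with given parameters -/

theorem goodPairs_eq_empty_of_lt {α : Type*} [Fintype α] [DecidableEq α] {o : α} {S : Finset α}
    {B : Finset (Sym2 α)} {d b q a : ℕ} (hB : B ∈ goodParts o S b q a) (h : 2 * d < b + q) :
    goodPairs o S d B = ∅ := by
  refine Finset.eq_empty_of_forall_notMem fun I hI => ?_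
  obtain ⟨hI, hg⟩ := mem_goodPairs.1 hI
  obtain ⟨-, -, hq, -⟩ := mem_goodParts.1 hB
  have h1 := Finset.card_le_card ((isTreeOn_pairParent hI).edgeVerts_subset hg.1)
  rw [hq, card_pairVerts hI] at h1
  omega

theorem goodParts_eq_empty_of_lt {α : Type*} [Fintype α] [DecidableEq α] {o : α} {S : Finset α}
    {b q a : ℕ} (h : b < a) : goodParts o S b q a = ∅ := by
  refine Finset.eq_empty_of_forall_notMem fun B hB => ?_
  obtain ⟨⟨V, p, ht, hg⟩, hb, hq, ha⟩ := mem_goodParts.1 hB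
  have h1 := ht.card_edgeVerts_inter hg
  have h2 := Finset.card_le_card (Finset.inter_subset_left (s₁ := lowVerts V p B) (s₂ := S))
  rw [ht.card_lowVerts hg.1] at h2
  omega

/-- The contribution of the good parts with given parameters to the second moment of the
estimator, on the event that the vertices of `P` are planted. -/
theorem sum_plantWeight_mul_sum_goodParts_le {n : ℕ} (hn : 0 < n) (o : Fin n) {lam : ℝ}
    (hlam : 0 < lam) {rho : unitInterval} (hrho : 0 < (rho : ℝ)) {d : ℕ} (P : Finset (Fin n))
    (hmom : ∀ j ≤ 4 * d, ((n : ℝ) * rho + P.card + j) ^ j ≤ 2 * ((n : ℝ) * rho) ^ j)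
    (b q a : ℕ) :
    ∑ S : Finset (Fin n), plantWeight rho S * ((if P ⊆ S then 1 else 0) *
        ∑ B ∈ goodParts o S b q a, (lam ^ (2 * d - B.card) * ((goodPairs o S d B).card : ℝ)) ^ 2)
      ≤ (rho : ℝ) ^ P.card * (8 * Real.exp 1 ^ 3 * (Real.exp 1 * lam * n * rho) ^ (4 * d)) *
        ((4 * Real.exp 1 * (2 * d) ^ 2 / (n * rho)) ^ q *
          (4 * Real.exp 1 ^ 2 * (2 * d) * rho) ^ a *
          (Real.exp 1 * n * lam ^ 2 * (rho : ℝ) ^ 2)⁻¹ ^ b) := by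
  have hpos : 0 ≤ (rho : ℝ) ^ P.card *
      (8 * Real.exp 1 ^ 3 * (Real.exp 1 * lam * n * rho) ^ (4 * d)) *
        ((4 * Real.exp 1 * (2 * d) ^ 2 / (n * rho)) ^ q *
          (4 * Real.exp 1 ^ 2 * (2 * d) * rho) ^ a *
          (Real.exp 1 * n * lam ^ 2 * (rho : ℝ) ^ 2)⁻¹ ^ b) := by positivity
  by_cases hab : b < a
  · simpa [goodParts_eq_empty_of_lt hab] using hpos
  by_cases hbq : 2 * d < b + q
  · refine le_trans (le_of_eq (Finset.sum_eq_zero fun S _ => ?_)) hpos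
    rw [Finset.sum_eq_zero, mul_zero, mul_zero]
    intro B hB
    simp [goodPairs_eq_empty_of_lt hB hbq]
  obtain ⟨c, rfl⟩ : ∃ c, b = a + c := ⟨b - a, by omega⟩
  obtain ⟨m, hm⟩ : ∃ m, 2 * d = a + c + q + m := ⟨2 * d - (a + c) - q, by omega⟩
  have h1 : ∀ S : Finset (Fin n), ∑ B ∈ goodParts o S (a + c) q a,
      (lam ^ (2 * d - B.card) * ((goodPairs o S d B).card : ℝ)) ^ 2
      ≤ (S.card : ℝ) ^ (q + a + 2 * m) * (lam ^ (2 * (m + q)) * (4 * ((n : ℝ) ^ c *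
        (2 * d : ℝ) ^ (a + 2 * q) * 4 ^ (q + a) *
        Real.exp 1 ^ (3 * a + c + 3 * q + 2 * m + 3)))) := by
    intro S
    have h2 : ∀ B ∈ goodParts o S (a + c) q a,
        (lam ^ (2 * d - B.card) * ((goodPairs o S d B).card : ℝ)) ^ 2
        = lam ^ (2 * (m + q)) * ((goodPairs o S d B).card : ℝ) ^ 2 := by
      intro B hB
      rw [(mem_goodParts.1 hB).2.1, show 2 * d - (a + c) = m + q by omega, mul_pow, ← pow_mul,
        mul_comm 2]
    rw [Finset.sum_congr rfl h2, ← Finset.mul_sum]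
    refine (mul_le_mul_of_nonneg_left (sum_sq_card_goodPairs_le o S hm) (by positivity)).trans
      (le_of_eq (by ring))
  set F : ℝ := lam ^ (2 * (m + q)) * (4 * ((n : ℝ) ^ c *
        (2 * d : ℝ) ^ (a + 2 * q) * 4 ^ (q + a) *
        Real.exp 1 ^ (3 * a + c + 3 * q + 2 * m + 3))) with hF
  have hF0 : 0 ≤ F := by positivity
  calc _ ≤ ∑ S : Finset (Fin n), plantWeight rho S * ((if P ⊆ S then 1 else 0) *
        ((S.card : ℝ) ^ (q + a + 2 * m) * F)) := by
        refine Finset.sum_le_sum fun S _ => mul_le_mul_of_nonneg_left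
          (mul_le_mul_of_nonneg_left (h1 S) ?_) (plantWeight_nonneg rho S)
        split_ifs <;> norm_num
    _ = (∑ S : Finset (Fin n), plantWeight rho S * ((if P ⊆ S then 1 else 0) *
        (S.card : ℝ) ^ (q + a + 2 * m))) * F := by
        rw [Finset.sum_mul]
        exact Finset.sum_congr rfl fun S _ => by ring
    _ ≤ ((rho : ℝ) ^ P.card * (2 * ((n : ℝ) * rho) ^ (q + a + 2 * m))) * F := by
        refine mul_le_mul_of_nonneg_right ((sum_plantWeight_mul_card_pow_le rho P _).trans ?_) hF0
        exact mul_le_mul_of_nonneg_left (hmom _ (by omega)) (by positivity)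
    _ = _ := by
        rw [hF, show 4 * d = 2 * (a + c + q + m) by omega]
        generalize (2 * d : ℝ) = x
        simp only [mul_pow, div_pow, inv_pow]
        field_simp
        ring

/-! ### The second moment as a sum over parameters -/

theorem exists_mem_goodParts {α : Type*} [Fintype α] [DecidableEq α] {o : α} {S : Finset α}
    {B : Finset (Sym2 α)} {d : ℕ} (hne : (goodPairs o S d B).Nonempty) :
    ∃ q ≤ 2 * d, ∃ a ≤ 2 * d, B.card ≤ 2 * d ∧ B ∈ goodParts o S B.card q a := by
  obtain ⟨I, hI⟩ := hne
  obtain ⟨hI, hg⟩ := mem_goodPairs.1 hI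
  have ht := isTreeOn_pairParent hI
  have hV := card_pairVerts hI
  have h1 := ht.card_edgeVerts_inter hg
  have h2 := ht.card_edgeVerts_sdiff hg.1
  have h3 := Finset.card_le_card (ht.edgeVerts_subset hg.1)
  have h4 := Finset.card_le_card (Finset.inter_subset_left
    (s₁ := lowVerts (pairVerts I) (pairParent o I) B) (s₂ := S))
  rw [ht.card_lowVerts hg.1] at h4
  refine ⟨(edgeVerts o B \ lowVerts (pairVerts I) (pairParent o I) B).card, by omega,
    (lowVerts (pairVerts I) (pairParent o I) B ∩ S).card, by omega, by omega, ?_⟩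
  exact mem_goodParts.2 ⟨⟨_, _, ht, hg⟩, rfl, by omega, by omega⟩

/-- The square of `d ^ (d - 1) / d!`, where `d ^ (d - 1)` is the number of rooted trees on `d`
labelled vertices: a set of `m ≫ d²` vertices contains about `treeFactor d * m ^ (2 * d)` pairs of
branches. -/
noncomputable def treeFactor (d : ℕ) : ℝ := ((d : ℝ) ^ (d - 1) / d.factorial) ^ 2

theorem card_goodPairs_empty_le {n d : ℕ} (hd : 1 ≤ d) (o : Fin n) (S : Finset (Fin n)) :
    ((goodPairs o S d ∅).card : ℝ) ≤ treeFactor d * (S.card : ℝ) ^ (2 * d) := by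
  have h1 : goodPairs o S d ∅ ⊆ branchPairs (S.erase o) d := by
    intro I hI
    obtain ⟨hI, hg⟩ := mem_goodPairs.1 hI
    have hV := (goodPart_empty_iff hI).1 hg
    have ht := isTreeOn_pairParent hI
    have hsub : pairVerts I ⊆ S.erase o := fun x hx => Finset.mem_erase.2
      ⟨fun h => ht.root_notMem (h ▸ hx), hV (Finset.mem_insert_of_mem hx)⟩
    obtain ⟨⟨⟨h11, h12⟩, h13⟩, ⟨⟨h21, h22⟩, h23⟩⟩ := mem_branchPairs.1 hI
    refine mem_branchPairs.2 ⟨⟨⟨Finset.subset_union_left.trans hsub, h12⟩, h13⟩,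
      ⟨⟨fun x hx => Finset.mem_sdiff.2 ⟨hsub (Finset.mem_union_right _ hx),
        (Finset.mem_sdiff.1 (h21 hx)).2⟩, h22⟩, h23⟩⟩
  have h2 := Finset.card_le_card h1
  rw [card_branchPairs _ hd] at h2
  have hK : ((S.erase o).card : ℝ) ≤ S.card := Nat.cast_le.2 Finset.card_erase_le
  have h3 : ((S.erase o).card.choose d : ℝ) ≤ (S.card : ℝ) ^ d / d.factorial :=
    (Nat.choose_le_pow_div d _).trans (by gcongr)
  have h4 : (((S.erase o).card - d).choose d : ℝ) ≤ (S.card : ℝ) ^ d / d.factorial := by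
    refine le_trans ?_ h3
    exact_mod_cast Nat.choose_le_choose d (Nat.sub_le _ _)
  calc ((goodPairs o S d ∅).card : ℝ)
      ≤ ((S.erase o).card.choose d : ℝ) * (((S.erase o).card - d).choose d : ℝ) *
        ((d : ℝ) ^ (d - 1)) ^ 2 := by exact_mod_cast h2
    _ ≤ ((S.card : ℝ) ^ d / d.factorial) * ((S.card : ℝ) ^ d / d.factorial) *
        ((d : ℝ) ^ (d - 1)) ^ 2 := by gcongr
    _ = _ := by rw [treeFactor]; field_simp; ring

theorem le_card_branchPairs {n d : ℕ} (hd : 1 ≤ d) (hdn : 2 * d ≤ n) (o : Fin n) :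
    treeFactor d * ((n : ℝ) - 2 * d) ^ (2 * d)
      ≤ (branchPairs (Finset.univ.erase o) d).card := by
  have hn : (0 : ℝ) ≤ (n : ℝ) - 2 * d := by
    have : ((2 * d : ℕ) : ℝ) ≤ n := Nat.cast_le.2 hdn
    push_cast at this; linarith
  rw [card_branchPairs _ hd, Finset.card_erase_of_mem (Finset.mem_univ o), Finset.card_univ,
    Fintype.card_fin]
  have h1 : ((n : ℝ) - 2 * d) ^ d / d.factorial ≤ ((n - 1 - d).choose d : ℝ) := by
    refine le_trans ?_ (Nat.pow_le_choose d (n - 1 - d))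
    gcongr
    rw [← Nat.cast_ofNat, ← Nat.cast_mul, ← Nat.cast_sub hdn]
    exact Nat.cast_le.2 (by omega)
  have h2 : ((n : ℝ) - 2 * d) ^ d / d.factorial ≤ ((n - 1).choose d : ℝ) :=
    h1.trans (by exact_mod_cast Nat.choose_le_choose d (Nat.sub_le _ _))
  push_cast
  calc _ = (((n : ℝ) - 2 * d) ^ d / d.factorial) * (((n : ℝ) - 2 * d) ^ d / d.factorial) *
        ((d : ℝ) ^ (d - 1)) ^ 2 := by rw [treeFactor]; field_simp; ring
    _ ≤ _ := by gcongr

/-- The triples `(b, q, a)` of parameters of good parts of trees with `2 * d` edges. -/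
def partParams (d : ℕ) : Finset (ℕ × ℕ × ℕ) :=
  Finset.range (2 * d + 1) ×ˢ Finset.range (2 * d + 1) ×ˢ Finset.range (2 * d + 1)

theorem mem_partParams {d : ℕ} {t : ℕ × ℕ × ℕ} :
    t ∈ partParams d ↔ t.1 ≤ 2 * d ∧ t.2.1 ≤ 2 * d ∧ t.2.2 ≤ 2 * d := by
  simp [partParams]

/-- If the root is planted, every nonempty edge set that contributes has few edges and a positive
`q` or `a`, or at least `d` edges. -/
theorem sum_sq_le_of_root_mem {n d : ℕ} (hd : 1 ≤ d) (o : Fin n) (S : Finset (Fin n)) (lam : ℝ) :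
    ∑ B, (lam ^ (2 * d - B.card) * ((goodPairs o S d B).card : ℝ)) ^ 2
      ≤ (lam ^ (2 * d)) ^ 2 * (treeFactor d ^ 2 * (S.card : ℝ) ^ (4 * d)) +
        ∑ t ∈ partParams d with 1 ≤ t.2.1 ∨ 1 ≤ t.2.2 ∨ d ≤ t.1,
          ∑ B ∈ goodParts o S t.1 t.2.1 t.2.2,
          (lam ^ (2 * d - B.card) * ((goodPairs o S d B).card : ℝ)) ^ 2 := by
  classical
  rw [← Finset.add_sum_erase _ _ (Finset.mem_univ ∅)]
  refine add_le_add ?_ ?_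
  · rw [Finset.card_empty, Nat.sub_zero, mul_pow]
    refine mul_le_mul_of_nonneg_left ?_ (by positivity)
    refine (pow_le_pow_left₀ (Nat.cast_nonneg _) (card_goodPairs_empty_le hd o S) 2).trans
      (le_of_eq (by ring))
  · rw [← Finset.sum_filter_of_ne (p := fun B => (goodPairs o S d B).Nonempty)]
    · refine sum_le_sum_of_cover _ _ (fun B => sq_nonneg _) fun B hB => ?_
      obtain ⟨hB, hne⟩ := Finset.mem_filter.1 hB
      obtain ⟨q, hq, a, ha, hb, hmem⟩ := exists_mem_goodParts hne
      refine ⟨(B.card, q, a), Finset.mem_filter.2 ⟨mem_partParams.2 ⟨hb, hq, ha⟩, ?_⟩, hmem⟩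
      by_cases hbd : d ≤ B.card
      · exact Or.inr (Or.inr hbd)
      · have h1 : 1 ≤ B.card := Finset.card_pos.2
          (Finset.nonempty_iff_ne_empty.2 (Finset.mem_erase.1 hB).1)
        rcases one_le_or_one_le_of_nonempty hmem hne h1 (not_le.1 hbd) with h | h
        exacts [Or.inl h, Or.inr (Or.inl h)]
    · intro B _ hne
      by_contra h
      rw [Finset.not_nonempty_iff_eq_empty] at h
      exact hne (by simp [h])

/-- If the root is not planted, every edge set that contributes has `a ≥ 2` or at least `d` edges;
in particular the empty set does not contribute. -/
theorem sum_sq_le_of_root_notMem {n d : ℕ} {o : Fin n} {S : Finset (Fin n)}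
    (ho : o ∉ S) (lam : ℝ) :
    ∑ B, (lam ^ (2 * d - B.card) * ((goodPairs o S d B).card : ℝ)) ^ 2
      ≤ ∑ t ∈ partParams d with 2 ≤ t.2.2 ∨ d ≤ t.1, ∑ B ∈ goodParts o S t.1 t.2.1 t.2.2,
          (lam ^ (2 * d - B.card) * ((goodPairs o S d B).card : ℝ)) ^ 2 := by
  classical
  rw [← Finset.sum_filter_of_ne (p := fun B => (goodPairs o S d B).Nonempty)]
  · refine sum_le_sum_of_cover _ _ (fun B => sq_nonneg _) fun B hB => ?_
    obtain ⟨-, hne⟩ := Finset.mem_filter.1 hB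
    obtain ⟨q, hq, a, ha, hb, hmem⟩ := exists_mem_goodParts hne
    refine ⟨(B.card, q, a), Finset.mem_filter.2 ⟨mem_partParams.2 ⟨hb, hq, ha⟩, ?_⟩, hmem⟩
    by_cases hbd : d ≤ B.card
    · exact Or.inr hbd
    · exact Or.inl (two_le_of_root_notMem ho hmem hne (not_le.1 hbd))
  · intro B _ hne
    by_contra h
    rw [Finset.not_nonempty_iff_eq_empty] at h
    exact hne (by simp [h])

/-- The second moment of the estimator: the first term comes from the empty edge set, the others
from the parameters that are possible if the root is planted, and if it is not. -/
theorem integral_branchPoly_sq_le {n : ℕ} (hn : 0 < n) (o : Fin n) {lam : ℝ}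
    (hlam : 0 < lam) {rho : unitInterval} (hrho : 0 < (rho : ℝ)) {d : ℕ} (hd : 1 ≤ d)
    (hmom : ∀ j ≤ 4 * d, ((n : ℝ) * rho + 1 + j) ^ j ≤ 2 * ((n : ℝ) * rho) ^ j) {T : ℕ × ℕ × ℕ → ℝ}
    (hT : ∀ t, T t = (4 * Real.exp 1 * (2 * d) ^ 2 / (n * rho)) ^ t.2.1 *
          (4 * Real.exp 1 ^ 2 * (2 * d) * rho) ^ t.2.2 *
          (Real.exp 1 * n * lam ^ 2 * (rho : ℝ) ^ 2)⁻¹ ^ t.1) :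
    ∫ w, evalMatrix (branchPoly o d) (obs lam w) ^ 2 ∂(law n rho)
      ≤ (lam ^ (2 * d)) ^ 2 * treeFactor d ^ 2 *
          (rho * ((n : ℝ) * rho + 1 + (4 * d : ℕ)) ^ (4 * d)) +
        8 * Real.exp 1 ^ 3 * (Real.exp 1 * lam * n * rho) ^ (4 * d) *
        (rho * ∑ t ∈ partParams d with 1 ≤ t.2.1 ∨ 1 ≤ t.2.2 ∨ d ≤ t.1, T t +
          ∑ t ∈ partParams d with 2 ≤ t.2.2 ∨ d ≤ t.1, T t) := by
  rw [integral_branchPoly_sq]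
  set F : Finset (Fin n) → Finset (Sym2 (Fin n)) → ℝ := fun S B =>
    (lam ^ (2 * d - B.card) * ((goodPairs o S d B).card : ℝ)) ^ 2 with hF
  set J1 := (partParams d).filter fun t => 1 ≤ t.2.1 ∨ 1 ≤ t.2.2 ∨ d ≤ t.1 with hJ1
  set J0 := (partParams d).filter fun t => 2 ≤ t.2.2 ∨ d ≤ t.1 with hJ0
  set c : ℝ := (lam ^ (2 * d)) ^ 2 * treeFactor d ^ 2 with hc
  set L : ℝ := 8 * Real.exp 1 ^ 3 * (Real.exp 1 * lam * n * rho) ^ (4 * d) with hL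
  have hG0 : ∀ S (t : ℕ × ℕ × ℕ), 0 ≤ ∑ B ∈ goodParts o S t.1 t.2.1 t.2.2, F S B :=
    fun S t => Finset.sum_nonneg fun B _ => sq_nonneg _
  have hpt : ∀ S : Finset (Fin n), plantWeight rho S * ∑ B, F S B
      ≤ c * (plantWeight rho S * ((if {o} ⊆ S then 1 else 0) * (S.card : ℝ) ^ (4 * d))) +
        (∑ t ∈ J1, plantWeight rho S * ((if {o} ⊆ S then 1 else 0) *
          ∑ B ∈ goodParts o S t.1 t.2.1 t.2.2, F S B) +
        ∑ t ∈ J0, plantWeight rho S * ((if ∅ ⊆ S then 1 else 0) *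
          ∑ B ∈ goodParts o S t.1 t.2.1 t.2.2, F S B)) := by
    intro S
    have hw := plantWeight_nonneg rho S
    simp only [Finset.singleton_subset_iff, Finset.empty_subset, if_true, one_mul,
      ← Finset.mul_sum]
    have h0 : 0 ≤ ∑ t ∈ J0, ∑ B ∈ goodParts o S t.1 t.2.1 t.2.2, F S B :=
      Finset.sum_nonneg fun t _ => hG0 S t
    by_cases ho : o ∈ S
    · have h1 := sum_sq_le_of_root_mem hd o S lam
      simp only [ho, if_true, one_mul]
      calc _ ≤ plantWeight rho S * (c * (S.card : ℝ) ^ (4 * d) +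
              ∑ t ∈ J1, ∑ B ∈ goodParts o S t.1 t.2.1 t.2.2, F S B) :=
            mul_le_mul_of_nonneg_left (h1.trans (le_of_eq (by rw [hc]; ring))) hw
        _ ≤ _ := by nlinarith [mul_nonneg hw h0]
    · have h1 := sum_sq_le_of_root_notMem (d := d) ho lam
      simp only [ho, if_false, zero_mul, mul_zero, zero_add]
      exact mul_le_mul_of_nonneg_left h1 hw
  refine (Finset.sum_le_sum fun S _ => hpt S).trans ?_
  rw [Finset.sum_add_distrib, Finset.sum_add_distrib, ← Finset.mul_sum]
  refine add_le_add ?_ ?_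
  · refine mul_le_mul_of_nonneg_left ?_ (by positivity)
    simpa using sum_plantWeight_mul_card_pow_le rho {o} (4 * d)
  · rw [Finset.sum_comm, Finset.sum_comm (t := J0), mul_add, mul_left_comm, Finset.mul_sum,
      Finset.mul_sum, Finset.mul_sum]
    refine add_le_add (Finset.sum_le_sum fun t _ => ?_) (Finset.sum_le_sum fun t _ => ?_)
    · refine (sum_plantWeight_mul_sum_goodParts_le hn o hlam hrho {o} (by simpa using hmom)
        t.1 t.2.1 t.2.2).trans (le_of_eq ?_)
      rw [hT, Finset.card_singleton, pow_one]; ring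
    · refine (sum_plantWeight_mul_sum_goodParts_le hn o hlam hrho ∅ (fun j hj => ?_)
        t.1 t.2.1 t.2.2).trans (le_of_eq ?_)
      · refine le_trans (pow_le_pow_left₀ (by positivity) ?_ j) (hmom j hj)
        simp
      · rw [hT, Finset.card_empty, pow_zero, one_mul]

theorem sum_partParams_le {d : ℕ} {α β γ g : ℝ} (hα0 : 0 ≤ α) (hβ0 : 0 ≤ β) (hα1 : α ≤ 1)
    (hβ1 : β ≤ 1) (hγ0 : 0 ≤ γ) (hγg : γ ≤ g) (hg : g < 1) {J : Finset (ℕ × ℕ × ℕ)}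
    (hJ : J ⊆ partParams d) {x : ℝ} (hx : 0 ≤ x)
    (h : ∀ t ∈ J, α ^ t.2.1 * β ^ t.2.2 ≤ x ∨ d ≤ t.1) :
    ∑ t ∈ J, α ^ t.2.1 * β ^ t.2.2 * γ ^ t.1
      ≤ (2 * d + 1) ^ 2 * (1 - g)⁻¹ * x + (2 * d + 1) ^ 3 * g ^ d := by
  have hg0 : 0 ≤ g := hγ0.trans hγg
  have h1 : ∀ t ∈ J, α ^ t.2.1 * β ^ t.2.2 * γ ^ t.1 ≤ x * g ^ t.1 + g ^ d := by
    intro t ht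
    have h2 : γ ^ t.1 ≤ g ^ t.1 := pow_le_pow_left₀ hγ0 hγg _
    have h3 : α ^ t.2.1 * β ^ t.2.2 ≤ 1 :=
      mul_le_one₀ (pow_le_one₀ hα0 hα1) (by positivity) (pow_le_one₀ hβ0 hβ1)
    rcases h t ht with h4 | h4
    · have : α ^ t.2.1 * β ^ t.2.2 * γ ^ t.1 ≤ x * g ^ t.1 :=
        mul_le_mul h4 h2 (by positivity) hx
      have : 0 ≤ g ^ d := by positivity
      linarith
    · have h5 : g ^ t.1 ≤ g ^ d := pow_le_pow_of_le_one hg0 hg.le h4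
      have : α ^ t.2.1 * β ^ t.2.2 * γ ^ t.1 ≤ 1 * g ^ d :=
        mul_le_mul h3 (h2.trans h5) (by positivity) zero_le_one
      have : 0 ≤ x * g ^ t.1 := by positivity
      linarith
  have hgeo : ∑ b ∈ Finset.range (2 * d + 1), g ^ b ≤ (1 - g)⁻¹ := by
    rw [← tsum_geometric_of_lt_one hg0 hg]
    exact (summable_geometric_of_lt_one hg0 hg).sum_le_tsum _ fun _ _ => by positivity
  calc _ ≤ ∑ t ∈ J, (x * g ^ t.1 + g ^ d) := Finset.sum_le_sum h1
    _ ≤ ∑ t ∈ partParams d, (x * g ^ t.1 + g ^ d) :=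
        Finset.sum_le_sum_of_subset_of_nonneg hJ fun _ _ _ => by positivity
    _ = (2 * d + 1) ^ 2 * (∑ b ∈ Finset.range (2 * d + 1), g ^ b) * x +
          (2 * d + 1) ^ 3 * g ^ d := by
        rw [partParams, Finset.sum_product]
        simp only [Finset.sum_const, Finset.card_product, Finset.card_range, nsmul_eq_mul]
        rw [← Finset.mul_sum, Finset.sum_add_distrib, ← Finset.mul_sum, Finset.sum_const,
          Finset.card_range, nsmul_eq_mul]
        push_cast
        ring
    _ ≤ _ := by gcongr

/-! ### The second moment above the threshold -/

theorem exp_one_pow_mul_factorial_le (d : ℕ) :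
    Real.exp 1 ^ d * (d + 1).factorial ≤ ((d : ℝ) + 1) ^ (d + 2) := by
  induction d with
  | zero => simp
  | succ d ih =>
    have hd : (0 : ℝ) < (d : ℝ) + 1 := by positivity
    have h1 : Real.exp 1 * ((d : ℝ) + 1) ^ (d + 2) ≤ ((d : ℝ) + 1 + 1) ^ (d + 2) := by
      have h2 := Real.one_sub_div_pow_le_exp_neg (n := d + 2) (t := 1) (by push_cast; linarith)
      rw [Real.exp_neg, show (1 : ℝ) - 1 / ((d + 2 : ℕ) : ℝ) = ((d : ℝ) + 1) / ((d : ℝ) + 1 + 1) by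
        push_cast; field_simp; ring, div_pow, div_le_iff₀ (by positivity)] at h2
      have h3 := mul_le_mul_of_nonneg_left h2 (Real.exp_pos 1).le
      rwa [← mul_assoc, mul_inv_cancel₀ (Real.exp_pos 1).ne', one_mul] at h3
    rw [Nat.factorial_succ (d + 1)]
    push_cast
    calc Real.exp 1 ^ (d + 1) * (((d : ℝ) + 1 + 1) * (d + 1).factorial)
        = ((d : ℝ) + 1 + 1) * (Real.exp 1 * (Real.exp 1 ^ d * (d + 1).factorial)) := by ring
      _ ≤ ((d : ℝ) + 1 + 1) * (Real.exp 1 * ((d : ℝ) + 1) ^ (d + 2)) := by gcongr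
      _ ≤ ((d : ℝ) + 1 + 1) * ((d : ℝ) + 1 + 1) ^ (d + 2) := by gcongr
      _ = _ := by ring

/-- A weak form of Stirling's formula. -/
theorem exp_one_pow_le_treeFactor {d : ℕ} (hd : 1 ≤ d) :
    Real.exp 1 ^ (4 * d) ≤ Real.exp 1 ^ 4 * (d : ℝ) ^ 8 * treeFactor d ^ 2 := by
  obtain ⟨m, rfl⟩ : ∃ m, d = m + 1 := ⟨d - 1, by omega⟩
  have h := exp_one_pow_mul_factorial_le m
  rw [treeFactor, Nat.add_sub_cancel]
  push_cast
  have hf : (0 : ℝ) < (m + 1).factorial := by positivity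
  have hm : (0 : ℝ) < (m : ℝ) + 1 := by positivity
  have h1 : Real.exp 1 ^ m ≤ ((m : ℝ) + 1) ^ 2 * (((m : ℝ) + 1) ^ m / (m + 1).factorial) := by
    rw [← mul_div_assoc, le_div_iff₀ hf]
    exact h.trans (le_of_eq (by ring))
  calc Real.exp 1 ^ (4 * (m + 1)) = Real.exp 1 ^ 4 * (Real.exp 1 ^ m) ^ 4 := by ring
    _ ≤ Real.exp 1 ^ 4 * (((m : ℝ) + 1) ^ 2 * (((m : ℝ) + 1) ^ m / (m + 1).factorial)) ^ 4 := by
        gcongr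
    _ = _ := by ring

/-- The constant in the bound for the second moment. -/
noncomputable def momentConst (g : ℝ) : ℝ :=
  8 * Real.exp 1 ^ 7 * ((1 - g)⁻¹ * (144 * Real.exp 1 + 72 * Real.exp 1 ^ 2 +
    576 * Real.exp 1 ^ 4) + 54)

theorem add_pow_le_of_small {μ s : ℝ} {d j : ℕ} (hμ : 0 < μ) (hd : 1 ≤ d) (hj : j ≤ 4 * d)
    (hs : (d : ℝ) ^ 2 / μ ≤ s) (hs1 : s ≤ 1 / 100) : (μ + 1 + j) ^ j ≤ 2 * μ ^ j := by
  have hd' : (1 : ℝ) ≤ d := by exact_mod_cast hd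
  have hj' : (j : ℝ) ≤ 4 * d := by exact_mod_cast hj
  have h1 : (μ + 1 + j) ≤ μ * Real.exp ((1 + j) / μ) := by
    calc μ + 1 + j = μ * ((1 + j) / μ + 1) := by field_simp; ring
      _ ≤ _ := by gcongr; exact Real.add_one_le_exp _
  have h2 : (j : ℝ) * ((1 + j) / μ) ≤ 1 / 5 := by
    have : (j : ℝ) * (1 + j) ≤ 20 * (d : ℝ) ^ 2 := by
      nlinarith [Nat.cast_nonneg (α := ℝ) j]
    calc (j : ℝ) * ((1 + j) / μ) = (j : ℝ) * (1 + j) / μ := by ring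
      _ ≤ 20 * (d : ℝ) ^ 2 / μ := by gcongr
      _ = 20 * ((d : ℝ) ^ 2 / μ) := by ring
      _ ≤ _ := by linarith
  have h3 : Real.exp (1 / 5) ≤ 2 := by
    have := Real.exp_bound_div_one_sub_of_interval (x := 1 / 5) (by norm_num) (by norm_num)
    linarith
  calc (μ + 1 + j) ^ j ≤ (μ * Real.exp ((1 + j) / μ)) ^ j :=
        pow_le_pow_left₀ (by positivity) h1 j
    _ = μ ^ j * Real.exp (j * ((1 + j) / μ)) := by rw [mul_pow, ← Real.exp_nat_mul]
    _ ≤ μ ^ j * 2 := by gcongr; exact (Real.exp_le_exp.2 h2).trans h3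
    _ = _ := mul_comm _ _

theorem add_pow_le_exp_mul_sub_pow {μ ν s : ℝ} {d : ℕ} (hμ : 0 < μ) (hd : 1 ≤ d)
    (hν : μ - 2 * d ≤ ν) (hs : (d : ℝ) ^ 2 / μ ≤ s) (hs1 : s ≤ 1 / 100) :
    (μ + 1 + (4 * d : ℕ)) ^ (4 * d) ≤ Real.exp (56 * s) * ν ^ (4 * d) := by
  have hd' : (1 : ℝ) ≤ d := by exact_mod_cast hd
  have h0 : (d : ℝ) ^ 2 ≤ s * μ := (div_le_iff₀ hμ).1 hs
  have h4 : 4 * (d : ℝ) ≤ μ := by nlinarith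
  have hν0 : 0 < ν := by linarith
  have h1 : μ + 1 + (4 * d : ℕ) ≤ Real.exp (14 * d / μ) * ν := by
    have h2 : 1 + 14 * d / μ ≤ Real.exp (14 * d / μ) := by
      rw [add_comm]; exact Real.add_one_le_exp _
    have h3 : μ + 1 + (4 * d : ℕ) ≤ (1 + 14 * d / μ) * (μ - 2 * d) := by
      push_cast
      have : (1 + 14 * d / μ) * (μ - 2 * d) = μ + 12 * d - 28 * d * (d / μ) := by
        field_simp; ring
      rw [this]
      have : (d : ℝ) / μ ≤ 1 / 4 := by rw [div_le_iff₀ hμ]; linarith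
      nlinarith
    refine h3.trans (mul_le_mul h2 hν (by linarith) (Real.exp_pos _).le)
  calc _ ≤ (Real.exp (14 * d / μ) * ν) ^ (4 * d) := pow_le_pow_left₀ (by positivity) h1 _
    _ = Real.exp (56 * ((d : ℝ) ^ 2 / μ)) * ν ^ (4 * d) := by
        rw [mul_pow, ← Real.exp_nat_mul]; congr 2; push_cast; ring
    _ ≤ _ := by gcongr

/-- The total contribution of the nonempty good parts, relative to the square of the mean. The
factor `d ^ 8` is the loss from Stirling's formula; the powers `d ^ 12` in `s` also make up for
`(2d + 1)²` values of `(q, a)` and for the powers of `d` in `α` and `β ^ 2`. -/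
theorem sum_partParams_smallness {n d : ℕ} {ρ g s α β γ : ℝ} (hn : 0 < n) (hρ : 0 < ρ) (hr1 : ρ ≤ 1)
    (hd : 1 ≤ d) (hg1 : g < 1) (hγ0 : 0 ≤ γ) (hγ : γ ≤ g) (hgd : g ^ d ≤ ((n : ℝ) ^ 2)⁻¹)
    (hs : s = (d : ℝ) ^ 12 / (n * ρ) + (d : ℝ) ^ 12 * ρ) (hs1 : s ≤ 1 / 100)
    (hα : α = 4 * Real.exp 1 * (2 * d) ^ 2 / (n * ρ))
    (hβ : β = 4 * Real.exp 1 ^ 2 * (2 * d) * ρ) {T : ℕ × ℕ × ℕ → ℝ}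
    (hT : ∀ t, T t = α ^ t.2.1 * β ^ t.2.2 * γ ^ t.1) :
    8 * Real.exp 1 ^ 7 * ((d : ℝ) ^ 8 *
      (ρ * ∑ t ∈ partParams d with 1 ≤ t.2.1 ∨ 1 ≤ t.2.2 ∨ d ≤ t.1, T t +
        ∑ t ∈ partParams d with 2 ≤ t.2.2 ∨ d ≤ t.1, T t)) ≤ ρ * (momentConst g * s) := by
  have hd' : (1 : ℝ) ≤ d := by exact_mod_cast hd
  have hn' : (1 : ℝ) ≤ n := by exact_mod_cast hn
  have he := Real.exp_pos 1
  have he1 : Real.exp 1 ≤ 3 := Real.exp_one_lt_three.le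
  have hμ : 0 < (n : ℝ) * ρ := by positivity
  have hsA : (d : ℝ) ^ 12 / (n * ρ) ≤ s := by
    rw [hs]; linarith [show 0 ≤ (d : ℝ) ^ 12 * ρ by positivity]
  have hsB : (d : ℝ) ^ 12 * ρ ≤ s := by
    rw [hs]; linarith [show 0 ≤ (d : ℝ) ^ 12 / (n * ρ) by positivity]
  have hs0 : 0 ≤ s := le_trans (by positivity) hsA
  have hsa : ∀ j ≤ 12, (d : ℝ) ^ j / (n * ρ) ≤ s := fun j hj =>
    le_trans (by gcongr) hsA
  have hsb : ∀ j ≤ 12, (d : ℝ) ^ j * ρ ≤ s := fun j hj =>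
    le_trans (by gcongr) hsB
  simp only [hT]
  have hα0 : 0 ≤ α := by rw [hα]; positivity
  have hβ0 : 0 ≤ β := by rw [hβ]; positivity
  have hg0 : 0 ≤ g := hγ0.trans hγ
  have hα' : α = 16 * Real.exp 1 * ((d : ℝ) ^ 2 / (n * ρ)) := by rw [hα]; ring
  have hβ' : β = 8 * Real.exp 1 ^ 2 * ((d : ℝ) ^ 1 * ρ) := by rw [hβ]; ring
  have hα1 : α ≤ 1 := by
    rw [hα']
    have h1 := hsa 2 (by norm_num)
    have h2 : 0 ≤ (d : ℝ) ^ 2 / (n * ρ) := by positivity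
    calc _ ≤ 16 * 3 * ((d : ℝ) ^ 2 / (n * ρ)) := by gcongr
      _ ≤ 1 := by linarith
  have hβ1 : β ≤ 1 := by
    rw [hβ']
    have h1 := hsb 1 (by norm_num)
    have h2 : Real.exp 1 ^ 2 ≤ (2.72 : ℝ) ^ 2 := by
      gcongr; exact Real.exp_one_lt_d9.le.trans (by norm_num)
    calc _ ≤ 8 * (2.72 : ℝ) ^ 2 * ((d : ℝ) ^ 1 * ρ) := by gcongr
      _ ≤ 8 * (2.72 : ℝ) ^ 2 * (1 / 100) := by gcongr; exact h1.trans hs1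
      _ ≤ 1 := by norm_num
  have hΓ : 0 ≤ (1 - g)⁻¹ := inv_nonneg.2 (by linarith)
  have hsum1 : ∑ t ∈ partParams d with 1 ≤ t.2.1 ∨ 1 ≤ t.2.2 ∨ d ≤ t.1,
      α ^ t.2.1 * β ^ t.2.2 * γ ^ t.1
      ≤ (2 * d + 1) ^ 2 * (1 - g)⁻¹ * (α + β) + (2 * d + 1) ^ 3 * g ^ d := by
    refine sum_partParams_le hα0 hβ0 hα1 hβ1 hγ0 hγ hg1 (Finset.filter_subset _ _)
      (by positivity) fun t ht => ?_
    rcases (Finset.mem_filter.1 ht).2 with h | h | h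
    · left
      have h1 : α ^ t.2.1 ≤ α := pow_le_of_le_one hα0 hα1 (by omega)
      have h2 : β ^ t.2.2 ≤ 1 := pow_le_one₀ hβ0 hβ1
      calc _ ≤ α * 1 := mul_le_mul h1 h2 (by positivity) hα0
        _ ≤ _ := by linarith
    · left
      have h1 : α ^ t.2.1 ≤ 1 := pow_le_one₀ hα0 hα1
      have h2 : β ^ t.2.2 ≤ β := pow_le_of_le_one hβ0 hβ1 (by omega)
      calc _ ≤ 1 * β := mul_le_mul h1 h2 (by positivity) zero_le_one
        _ ≤ _ := by linarith
    · exact Or.inr h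
  have hsum0 : ∑ t ∈ partParams d with 2 ≤ t.2.2 ∨ d ≤ t.1, α ^ t.2.1 * β ^ t.2.2 * γ ^ t.1
      ≤ (2 * d + 1) ^ 2 * (1 - g)⁻¹ * β ^ 2 + (2 * d + 1) ^ 3 * g ^ d := by
    refine sum_partParams_le hα0 hβ0 hα1 hβ1 hγ0 hγ hg1 (Finset.filter_subset _ _)
      (by positivity) fun t ht => ?_
    rcases (Finset.mem_filter.1 ht).2 with h | h
    · left
      have h1 : α ^ t.2.1 ≤ 1 := pow_le_one₀ hα0 hα1
      have h2 : β ^ t.2.2 ≤ β ^ 2 := pow_le_pow_of_le_one hβ0 hβ1 h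
      calc _ ≤ 1 * β ^ 2 := mul_le_mul h1 h2 (by positivity) zero_le_one
        _ = _ := one_mul _
    · exact Or.inr h
  have h2d : (2 * d + 1 : ℝ) ≤ 3 * d := by linarith
  have hA1 : (d : ℝ) ^ 8 * ((2 * d + 1) ^ 2 * (1 - g)⁻¹ * (α + β) + (2 * d + 1) ^ 3 * g ^ d)
      ≤ ((1 - g)⁻¹ * (144 * Real.exp 1 + 72 * Real.exp 1 ^ 2) + 27) * s := by
    calc _ ≤ (d : ℝ) ^ 8 * ((3 * d) ^ 2 * (1 - g)⁻¹ * (α + β) +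
          (3 * d) ^ 3 * ((n : ℝ) ^ 2)⁻¹) := by gcongr
      _ = (1 - g)⁻¹ * (144 * Real.exp 1 * ((d : ℝ) ^ 12 / (n * ρ)) +
          72 * Real.exp 1 ^ 2 * ((d : ℝ) ^ 11 * ρ)) + 27 * ((d : ℝ) ^ 11 * ((n : ℝ) ^ 2)⁻¹) := by
          rw [hα', hβ']; ring
      _ ≤ (1 - g)⁻¹ * (144 * Real.exp 1 * s + 72 * Real.exp 1 ^ 2 * s) + 27 * s := by
          have h1 := hsa 12 le_rfl
          have h2 := hsb 11 (by norm_num)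
          have h3 : (d : ℝ) ^ 11 * ((n : ℝ) ^ 2)⁻¹ ≤ s := by
            refine le_trans ?_ (hsa 11 (by norm_num))
            rw [div_eq_mul_inv]
            gcongr
            rw [sq]
            exact mul_le_mul_of_nonneg_left (hr1.trans hn') (by linarith)
          gcongr
      _ = _ := by ring
  -- if the root is not planted, the bound must be small even when compared with `ρ`
  have hA0 : (d : ℝ) ^ 8 * ((2 * d + 1) ^ 2 * (1 - g)⁻¹ * β ^ 2 + (2 * d + 1) ^ 3 * g ^ d)
      ≤ ρ * (((1 - g)⁻¹ * (576 * Real.exp 1 ^ 4) + 27) * s) := by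
    calc _ ≤ (d : ℝ) ^ 8 * ((3 * d) ^ 2 * (1 - g)⁻¹ * β ^ 2 +
          (3 * d) ^ 3 * ((n : ℝ) ^ 2)⁻¹) := by gcongr
      _ = (1 - g)⁻¹ * (576 * Real.exp 1 ^ 4) * (ρ * ((d : ℝ) ^ 12 * ρ)) +
          27 * ((d : ℝ) ^ 11 * ((n : ℝ) ^ 2)⁻¹) := by
          rw [hβ']; ring
      _ ≤ (1 - g)⁻¹ * (576 * Real.exp 1 ^ 4) * (ρ * s) + 27 * (ρ * s) := by
          have h1 := hsb 12 le_rfl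
          have h3 : (d : ℝ) ^ 11 * ((n : ℝ) ^ 2)⁻¹ ≤ ρ * s := by
            -- `nρ ≥ 1`, since `s` is small
            have h4 := hsa 1 (by norm_num)
            rw [div_le_iff₀ hμ, pow_one] at h4
            have h5 : 1 ≤ (n : ℝ) * ρ := by
              have := mul_le_mul_of_nonneg_right hs1 hμ.le
              linarith
            calc (d : ℝ) ^ 11 * ((n : ℝ) ^ 2)⁻¹
                ≤ (d : ℝ) ^ 11 * ((n : ℝ) ^ 2)⁻¹ * (n * ρ) :=
                  le_mul_of_one_le_right (by positivity) h5
              _ = ρ * ((d : ℝ) ^ 11 / n) := by field_simp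
              _ ≤ ρ * ((d : ℝ) ^ 11 / (n * ρ)) := by
                  gcongr
                  exact mul_le_of_le_one_right (by linarith) hr1
              _ ≤ _ := by gcongr; exact hsa 11 (by norm_num)
          gcongr
      _ = _ := by ring
  calc _ ≤ 8 * Real.exp 1 ^ 7 * ((d : ℝ) ^ 8 *
        (ρ * ((2 * d + 1) ^ 2 * (1 - g)⁻¹ * (α + β) + (2 * d + 1) ^ 3 * g ^ d) +
          ((2 * d + 1) ^ 2 * (1 - g)⁻¹ * β ^ 2 + (2 * d + 1) ^ 3 * g ^ d))) := by gcongr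
    _ = 8 * Real.exp 1 ^ 7 *
        (ρ * ((d : ℝ) ^ 8 * ((2 * d + 1) ^ 2 * (1 - g)⁻¹ * (α + β) + (2 * d + 1) ^ 3 * g ^ d)) +
          ((d : ℝ) ^ 8 * ((2 * d + 1) ^ 2 * (1 - g)⁻¹ * β ^ 2 + (2 * d + 1) ^ 3 * g ^ d))) := by
        ring
    _ ≤ 8 * Real.exp 1 ^ 7 *
        (ρ * (((1 - g)⁻¹ * (144 * Real.exp 1 + 72 * Real.exp 1 ^ 2) + 27) * s) +
          ρ * (((1 - g)⁻¹ * (576 * Real.exp 1 ^ 4) + 27) * s)) := by gcongr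
    _ = _ := by rw [momentConst]; ring

theorem le_mul_of_second_moment {ρ E M e x L X m d8 : ℝ} (h1 : M ≤ ρ * E ^ 2 * x)
    (h2 : L ≤ e ^ 4 * d8 * x * E ^ 2) (hX : 0 ≤ X) (h3 : 8 * e ^ 7 * (d8 * X) ≤ ρ * m)
    (he : 0 ≤ e) (hx : 0 ≤ x) :
    M + 8 * e ^ 3 * L * X ≤ ρ * E ^ 2 * (x * (1 + m)) := by
  have h4 : 8 * e ^ 3 * L * X ≤ 8 * e ^ 3 * (e ^ 4 * d8 * x * E ^ 2) * X := by gcongr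
  have h5 : E ^ 2 * x * (8 * e ^ 7 * (d8 * X)) ≤ E ^ 2 * x * (ρ * m) := by gcongr
  nlinarith

/-- Above the threshold, the second moment of the estimator is close to the square of its mean on
the event that the root is planted, times the probability of this event. -/
theorem integral_branchPoly_sq_le_mul {n : ℕ} (hn : 0 < n) (o : Fin n) {lam g s : ℝ}
    (hlam : 0 < lam) {rho : unitInterval} (hrho : 0 < (rho : ℝ)) {d : ℕ} (hd : 1 ≤ d)
    (hg1 : g < 1) (hγ : (Real.exp 1 * n * lam ^ 2 * (rho : ℝ) ^ 2)⁻¹ ≤ g)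
    (hgd : g ^ d ≤ ((n : ℝ) ^ 2)⁻¹)
    (hs : s = (d : ℝ) ^ 12 / (n * rho) + (d : ℝ) ^ 12 * rho) (hs1 : s ≤ 1 / 100) :
    ∫ w, evalMatrix (branchPoly o d) (obs lam w) ^ 2 ∂(law n rho)
      ≤ rho * (lam ^ (2 * d) * (rho : ℝ) ^ (2 * d) *
          (branchPairs (Finset.univ.erase o) d).card) ^ 2 *
        (Real.exp (56 * s) * (1 + momentConst g * s)) := by
  have hd' : (1 : ℝ) ≤ d := by exact_mod_cast hd
  have hr1 : (rho : ℝ) ≤ 1 := rho.2.2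
  have he := Real.exp_pos 1
  have hμ : 0 < (n : ℝ) * rho := by positivity
  have hsA : (d : ℝ) ^ 12 / (n * rho) ≤ s := by
    rw [hs]; linarith [show 0 ≤ (d : ℝ) ^ 12 * rho by positivity]
  have hsa : ∀ j ≤ 12, (d : ℝ) ^ j / (n * rho) ≤ s := fun j hj =>
    le_trans (by gcongr) hsA
  have hdn : 2 * d ≤ n := by
    have h1 := hsa 1 (by norm_num)
    rw [div_le_iff₀ hμ, pow_one] at h1
    have : (2 * d : ℝ) ≤ n := by nlinarith
    exact_mod_cast this
  have hdn' : (0 : ℝ) ≤ (n : ℝ) - 2 * d := by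
    have : ((2 * d : ℕ) : ℝ) ≤ n := Nat.cast_le.2 hdn
    push_cast at this; linarith
  have hmom : ∀ j ≤ 4 * d, ((n : ℝ) * rho + 1 + j) ^ j ≤ 2 * ((n : ℝ) * rho) ^ j := fun j hj =>
    add_pow_le_of_small hμ hd hj (hsa 2 (by norm_num)) hs1
  have hratio := add_pow_le_exp_mul_sub_pow (ν := rho * ((n : ℝ) - 2 * d)) hμ hd (by nlinarith)
    (hsa 2 (by norm_num)) hs1
  set N : ℝ := ((branchPairs (Finset.univ.erase o) d).card : ℝ) with hN
  have hNle := le_card_branchPairs hd hdn o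
  rw [← hN] at hNle
  set E : ℝ := lam ^ (2 * d) * (rho : ℝ) ^ (2 * d) * N with hE
  have htf : 0 ≤ treeFactor d := sq_nonneg _
  have hEle : (lam ^ (2 * d)) ^ 2 * treeFactor d ^ 2 * (rho * ((n : ℝ) - 2 * d)) ^ (4 * d)
      ≤ E ^ 2 := by
    calc _ = (lam ^ (2 * d) * (rho : ℝ) ^ (2 * d) *
          (treeFactor d * ((n : ℝ) - 2 * d) ^ (2 * d))) ^ 2 := by
          rw [mul_pow (rho : ℝ)]; ring
      _ ≤ _ := by rw [hE]; gcongr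
  have hfirst : (lam ^ (2 * d)) ^ 2 * treeFactor d ^ 2 *
      (rho * ((n : ℝ) * rho + 1 + (4 * d : ℕ)) ^ (4 * d))
      ≤ rho * E ^ 2 * Real.exp (56 * s) := by
    calc _ ≤ (lam ^ (2 * d)) ^ 2 * treeFactor d ^ 2 *
          (rho * (Real.exp (56 * s) * (rho * ((n : ℝ) - 2 * d)) ^ (4 * d))) := by gcongr
      _ = rho * ((lam ^ (2 * d)) ^ 2 * treeFactor d ^ 2 * (rho * ((n : ℝ) - 2 * d)) ^ (4 * d)) *
          Real.exp (56 * s) := by ring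
      _ ≤ _ := by gcongr
  have hscale : (Real.exp 1 * lam * n * rho) ^ (4 * d)
      ≤ Real.exp 1 ^ 4 * (d : ℝ) ^ 8 * Real.exp (56 * s) * E ^ 2 := by
    have h1 : ((n : ℝ) * rho) ^ (4 * d)
        ≤ Real.exp (56 * s) * (rho * ((n : ℝ) - 2 * d)) ^ (4 * d) := by
      refine le_trans (pow_le_pow_left₀ hμ.le ?_ _) hratio
      have : (0 : ℝ) ≤ (4 * d : ℕ) := Nat.cast_nonneg _
      linarith
    calc _ = (lam ^ (2 * d)) ^ 2 * Real.exp 1 ^ (4 * d) * ((n : ℝ) * rho) ^ (4 * d) := by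
          rw [show Real.exp 1 * lam * n * rho = lam * Real.exp 1 * (n * rho) by ring, mul_pow,
            mul_pow, show 4 * d = 2 * d * 2 by ring, pow_mul lam]
      _ ≤ (lam ^ (2 * d)) ^ 2 * (Real.exp 1 ^ 4 * (d : ℝ) ^ 8 * treeFactor d ^ 2) *
          (Real.exp (56 * s) * (rho * ((n : ℝ) - 2 * d)) ^ (4 * d)) := by
          gcongr
          exact exp_one_pow_le_treeFactor hd
      _ = Real.exp 1 ^ 4 * (d : ℝ) ^ 8 * Real.exp (56 * s) * ((lam ^ (2 * d)) ^ 2 *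
          treeFactor d ^ 2 * (rho * ((n : ℝ) - 2 * d)) ^ (4 * d)) := by ring
      _ ≤ _ := by gcongr
  have hsum := sum_partParams_smallness hn hrho hr1 hd hg1 (by positivity) hγ hgd hs hs1 rfl rfl
    fun t => rfl
  refine (integral_branchPoly_sq_le hn o hlam hrho hd hmom fun t => rfl).trans ?_
  refine le_mul_of_second_moment hfirst hscale ?_ hsum he.le (Real.exp_pos _).le
  exact add_nonneg (mul_nonneg hrho.le (Finset.sum_nonneg fun t _ => by positivity))
    (Finset.sum_nonneg fun t _ => by positivity)

/-! ### The correlation achieved, and the choice of the constant -/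

/-- Above the threshold, the ratio of the geometric decay in the number of edges is bounded away
from `1`. -/
theorem inv_snr_le {n : ℕ} (hn : 0 < n) {ε lam ρ : ℝ} (hε : 0 < ε) (hρ : 0 < ρ)
    (hlam : (1 + ε) * (ρ * √(Real.exp 1 * n))⁻¹ ≤ lam) :
    0 < lam ∧ (Real.exp 1 * n * lam ^ 2 * ρ ^ 2)⁻¹ ≤ ((1 + ε) ^ 2)⁻¹ := by
  have h0 : 0 < Real.exp 1 * n := by positivity
  have hpos : 0 < (1 + ε) * (ρ * √(Real.exp 1 * n))⁻¹ := by positivity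
  refine ⟨hpos.trans_le hlam, ?_⟩
  gcongr
  calc (1 + ε) ^ 2 = Real.exp 1 * n * ((1 + ε) * (ρ * √(Real.exp 1 * n))⁻¹) ^ 2 * ρ ^ 2 := by
        rw [mul_pow, inv_pow, mul_pow ρ, Real.sq_sqrt h0.le]
        field_simp
    _ ≤ _ := by gcongr

/-- The correlation achieved by the estimator. -/
theorem le_corrOf_branchPoly {n : ℕ} (hn : 0 < n) {ε lam s : ℝ} (hε : 0 < ε)
    {rho : unitInterval} (hrho : 0 < (rho : ℝ))
    (hlam : (1 + ε) * ((rho : ℝ) * √(Real.exp 1 * n))⁻¹ ≤ lam) {d : ℕ} (hd : 1 ≤ d)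
    (hgd : ((1 + ε) ^ 2)⁻¹ ^ d ≤ ((n : ℝ) ^ 2)⁻¹)
    (hs : s = (d : ℝ) ^ 12 / (n * rho) + (d : ℝ) ^ 12 * rho) (hs1 : s ≤ 1 / 100) :
    (√(Real.exp (56 * s) * (1 + momentConst ((1 + ε) ^ 2)⁻¹ * s)))⁻¹
      ≤ corrOf n lam rho (branchPoly ⟨0, hn⟩ d) := by
  obtain ⟨hlam0, hγ⟩ := inv_snr_le hn hε hrho hlam
  have hg1 : ((1 + ε) ^ 2)⁻¹ < 1 := inv_lt_one_of_one_lt₀ (by nlinarith)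
  have hM := integral_branchPoly_sq_le_mul hn ⟨0, hn⟩ hlam0 hrho hd hg1 hγ hgd hs hs1
  have hmean := integral_branchPoly_mul hn d lam rho
  rw [corrOf, integral_estimand_sq hn, hmean]
  have hd' : (1 : ℝ) ≤ d := by exact_mod_cast hd
  have hn' : (0 : ℝ) < n := Nat.cast_pos.2 hn
  have hs0 : 0 ≤ s := by rw [hs]; positivity
  have hc0 : 0 ≤ momentConst ((1 + ε) ^ 2)⁻¹ := by
    have : 0 ≤ (1 - ((1 + ε) ^ 2)⁻¹)⁻¹ := inv_nonneg.2 (by linarith)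
    unfold momentConst; positivity
  have hdn : 2 * d < n := by
    have h1 : (d : ℝ) ^ 1 ≤ (d : ℝ) ^ 12 := pow_le_pow_right₀ hd' (by norm_num)
    have h2 : (d : ℝ) ^ 12 / (n * rho) ≤ s := by
      rw [hs]; linarith [show 0 ≤ (d : ℝ) ^ 12 * rho by positivity]
    rw [div_le_iff₀ (by positivity)] at h2
    have h3 : (n : ℝ) * rho ≤ n := mul_le_of_le_one_right hn'.le rho.2.2
    have h4 : s * (n * rho) ≤ 1 / 100 * n := mul_le_mul hs1 h3 (by positivity) (by norm_num)
    have : ((2 * d : ℕ) : ℝ) < n := by push_cast; linarith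
    exact_mod_cast this
  have hN : 0 < ((branchPairs (Finset.univ.erase (⟨0, hn⟩ : Fin n)) d).card : ℝ) := by
    refine lt_of_lt_of_le ?_ (le_card_branchPairs hd hdn.le ⟨0, hn⟩)
    have : (0 : ℝ) < n - 2 * d := by
      have : ((2 * d : ℕ) : ℝ) < n := Nat.cast_lt.2 hdn
      push_cast at this; linarith
    unfold treeFactor; positivity
  set N : ℝ := ((branchPairs (Finset.univ.erase (⟨0, hn⟩ : Fin n)) d).card : ℝ)
  set M := ∫ w, evalMatrix (branchPoly ⟨0, hn⟩ d) (obs lam w) ^ 2 ∂(law n rho) with hMdef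
  set ψ := Real.exp (56 * s) * (1 + momentConst ((1 + ε) ^ 2)⁻¹ * s) with hψ
  have hψ0 : 0 < ψ := by positivity
  set E := lam ^ (2 * d) * (rho : ℝ) ^ (2 * d) * N with hE
  have hE0 : 0 < E := by positivity
  have hA : lam ^ (2 * d) * (rho : ℝ) ^ (2 * d + 1) * N = rho * E := by rw [hE]; ring
  -- the second moment is positive: otherwise the estimator vanishes almost surely, and its mean on
  -- the event that the root is planted would be zero
  have hM0 : 0 < M := by
    have h0 : 0 ≤ M := integral_nonneg fun w => sq_nonneg _
    refine lt_of_le_of_ne h0 fun h => ?_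
    have hint : Integrable (fun w => evalMatrix (branchPoly ⟨0, hn⟩ d) (obs lam w) ^ 2)
        (law n rho) := by
      refine integrable_law ((measurable_evalMatrix_obs lam _).pow_const 2) fun S => ?_
      simp_rw [evalMatrix_branchPoly_plant]
      exact integrable_sum_prod_sq _
    have h2 := (integral_eq_zero_iff_of_nonneg (fun w => sq_nonneg _) hint).1 (hMdef ▸ h.symm)
    have h3 : ∫ w, evalMatrix (branchPoly ⟨0, hn⟩ d) (obs lam w) * estimand w ∂(law n rho) = 0 := by
      rw [← integral_zero (Sample n) ℝ (μ := law n rho)]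
      refine integral_congr_ae ?_
      filter_upwards [h2] with w hw
      have : evalMatrix (branchPoly ⟨0, hn⟩ d) (obs lam w) = 0 := by simpa using hw
      rw [this, zero_mul]
    rw [hmean, hA] at h3
    exact (mul_pos hrho hE0).ne' h3
  rw [hA, inv_le_comm₀ (Real.sqrt_pos.2 hψ0) (by positivity), inv_div,
    div_le_iff₀ (by positivity)]
  have h5 : M * rho ≤ ψ * (rho * E) ^ 2 :=
    (mul_le_mul_of_nonneg_right hM hrho.le).trans (le_of_eq (by ring))
  refine (Real.sqrt_le_sqrt h5).trans (le_of_eq ?_)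
  rw [Real.sqrt_mul hψ0.le, Real.sqrt_sq (by positivity)]

theorem corr_le_one (n : ℕ) (lam : ℝ) (rho : unitInterval) (D : ℕ) : corr n lam rho D ≤ 1 := by
  have : Nonempty {f : MvPolynomial (Fin n × Fin n) ℝ // f.totalDegree ≤ D} := ⟨⟨0, by simp⟩⟩
  exact ciSup_le fun f => corrOf_le_one n lam rho f

/-- Above the threshold, polynomials of logarithmic degree achieve correlation tending to `1`. -/
theorem tendsto_corr_of_above_threshold {ε C : ℝ} (hε : 0 < ε)
    (hC : 2 * ((Real.log (1 + ε))⁻¹ + 1) ≤ C) (lam : ℕ → ℝ) (rho : ℕ → unitInterval)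
    (hlam : ∀ᶠ n : ℕ in atTop, (1 + ε) * ((rho n : ℝ) * √(Real.exp 1 * n))⁻¹ ≤ lam n)
    (h1 : (fun n : ℕ => (n : ℝ)⁻¹ * Real.log n ^ 12) =o[atTop] (fun n : ℕ => (rho n : ℝ)))
    (h2 : (fun n : ℕ => (rho n : ℝ)) =o[atTop] (fun n : ℕ => (Real.log n ^ 12)⁻¹)) :
    Tendsto (fun n : ℕ => corr n (lam n) (rho n) ⌊C * Real.log n⌋₊) atTop (𝓝 1) := by
  set ℓ := Real.log (1 + ε) with hℓ
  have hℓ0 : 0 < ℓ := Real.log_pos (by linarith)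
  set K : ℝ := ℓ⁻¹ + 1 with hK
  -- with this size of the branches, `(1 + ε) ^ (-2 * d)` is at most `n ^ (-2)`
  set d : ℕ → ℕ := fun n => ⌈Real.log n / ℓ⌉₊ with hd
  have hlog : ∀ᶠ n : ℕ in atTop, 1 ≤ Real.log n :=
    (Real.tendsto_log_atTop.comp tendsto_natCast_atTop_atTop).eventually_ge_atTop 1
  have hdle : ∀ n : ℕ, 1 ≤ Real.log n → (d n : ℝ) ≤ K * Real.log n := by
    intro n hn
    have := (Nat.ceil_lt_add_one (a := Real.log n / ℓ) (by positivity)).le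
    refine this.trans ?_
    rw [hK, add_mul, one_mul, inv_mul_eq_div]
    linarith
  have hrho : ∀ᶠ n : ℕ in atTop, 0 < (rho n : ℝ) := by
    filter_upwards [h1.def one_pos, hlog, eventually_gt_atTop 0] with n hn hl hn0
    rw [Real.norm_of_nonneg (by positivity), Real.norm_of_nonneg (rho n).2.1, one_mul] at hn
    have : (0 : ℝ) < n := Nat.cast_pos.2 hn0
    exact lt_of_lt_of_le (by positivity) hn
  set s : ℕ → ℝ := fun n => (d n : ℝ) ^ 12 / (n * rho n) + (d n : ℝ) ^ 12 * rho n with hs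
  have hs0 : Tendsto s atTop (𝓝 0) := by
    have t1 := h1.tendsto_div_nhds_zero
    have t2 := h2.tendsto_div_nhds_zero
    have t3 : Tendsto (fun n : ℕ => K ^ 12 * ((n : ℝ)⁻¹ * Real.log n ^ 12 / rho n +
        rho n / (Real.log n ^ 12)⁻¹)) atTop (𝓝 0) := by
      simpa using (t1.add t2).const_mul (K ^ 12)
    refine squeeze_zero' (Eventually.of_forall fun n => ?_) ?_ t3
    · have := (rho n).2.1
      simp only [hs]; positivity
    · filter_upwards [hlog] with n hn
      have h0 := (rho n).2.1
      have h3 : (d n : ℝ) ^ 12 ≤ (K * Real.log n) ^ 12 :=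
        pow_le_pow_left₀ (Nat.cast_nonneg _) (hdle n hn) 12
      calc s n ≤ (K * Real.log n) ^ 12 / (n * rho n) + (K * Real.log n) ^ 12 * rho n := by
            simp only [hs]; gcongr
        _ = _ := by
            rw [div_inv_eq_mul, mul_pow, div_eq_mul_inv, div_eq_mul_inv, mul_inv]; ring
  have hψ : Tendsto (fun n => (√(Real.exp (56 * s n) *
      (1 + momentConst ((1 + ε) ^ 2)⁻¹ * s n)))⁻¹) atTop (𝓝 1) := by
    have hc : ContinuousAt (fun x : ℝ => (√(Real.exp (56 * x) *
        (1 + momentConst ((1 + ε) ^ 2)⁻¹ * x)))⁻¹) 0 := by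
      refine ContinuousAt.inv₀ (by fun_prop) (by simp)
    simpa [Function.comp_def] using hc.tendsto.comp hs0
  refine tendsto_of_tendsto_of_tendsto_of_le_of_le' hψ tendsto_const_nhds ?_
    (Eventually.of_forall fun n => corr_le_one _ _ _ _)
  filter_upwards [hlam, hrho, hlog, hs0.eventually_le_const (show (0 : ℝ) < 1 / 100 by norm_num),
    eventually_gt_atTop 0] with n hl hr hlg hsn hn
  have hn' : (0 : ℝ) < n := Nat.cast_pos.2 hn
  have hd1 : 1 ≤ d n := Nat.one_le_ceil_iff.2 (by positivity)
  have hgd : ((1 + ε) ^ 2)⁻¹ ^ d n ≤ ((n : ℝ) ^ 2)⁻¹ := by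
    rw [inv_pow]
    refine inv_anti₀ (by positivity) ?_
    rw [← pow_mul, mul_comm, pow_mul]
    refine pow_le_pow_left₀ hn'.le ?_ 2
    rw [← Real.log_le_log_iff hn' (by positivity), Real.log_pow, ← hℓ]
    exact (div_le_iff₀ hℓ0).1 (Nat.le_ceil _)
  refine (le_corrOf_branchPoly hn hε hr hl hd1 hgd rfl hsn).trans ?_
  have hdeg : (branchPoly (⟨0, hn⟩ : Fin n) (d n)).totalDegree ≤ ⌊C * Real.log n⌋₊ := by
    refine (totalDegree_branchPoly_le _ _).trans (Nat.le_floor ?_)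
    push_cast
    have := hdle n hlg
    nlinarith
  exact le_ciSup (bddAbove_range_corrOf n (lam n) (rho n) _) ⟨_, hdeg⟩

/-- The hypothesis of `corr_le_of_below_threshold`, from a bound for the signal strength relative
to the threshold. -/
theorem snr_le {n : ℕ} (hn : 1 ≤ n) {ε lam ρ : ℝ} (hlam0 : 0 ≤ lam) (h0 : 0 < ρ) (h1 : ρ < 1)
    (hlam : lam ≤ (1 - ε) * (ρ * √(Real.exp 1 * n))⁻¹ * √(1 - ρ)) :
    Real.exp 1 * n * (ρ ^ 2 / (1 - ρ)) * lam ^ 2 ≤ max 0 (1 - ε) ^ 2 := by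
  have hρ1 : 0 < 1 - ρ := sub_pos.2 h1
  have h3 : lam ≤ max 0 (1 - ε) * (ρ * √(Real.exp 1 * n))⁻¹ * √(1 - ρ) := by
    refine hlam.trans ?_
    gcongr
    exact le_max_right _ _
  calc _ ≤ Real.exp 1 * n * (ρ ^ 2 / (1 - ρ)) *
        (max 0 (1 - ε) * (ρ * √(Real.exp 1 * n))⁻¹ * √(1 - ρ)) ^ 2 := by gcongr
    _ = _ := by
        rw [mul_pow, mul_pow, inv_pow, mul_pow ρ, Real.sq_sqrt (by positivity),
          Real.sq_sqrt hρ1.le]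
        field_simp

/-- The constant may be enlarged, so that one constant serves below and above the threshold. -/
theorem exists_const_of_lt_one {κ : ℝ} (hκ1 : κ < 1) :
    ∃ C₀ : ℝ, 1 ≤ C₀ ∧ ∀ C, C₀ ≤ C → ∃ r < 1, κ * Real.exp (3 * (1 / C)) ≤ r ∧
      Real.exp 2 / (1 - r) ≤ C ^ 2 := by
  have hr1 : (1 + κ) / 2 < 1 := by linarith
  have h1 : Tendsto (fun C : ℝ => κ * Real.exp (3 * (1 / C))) atTop (𝓝 κ) := by
    have : Tendsto (fun C : ℝ => 3 * (1 / C)) atTop (𝓝 0) := by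
      simpa using (tendsto_inv_atTop_zero (𝕜 := ℝ)).const_mul 3
    simpa using ((Real.continuous_exp.tendsto 0).comp this).const_mul κ
  have h2 := h1.eventually_le_const (show κ < (1 + κ) / 2 by linarith)
  have h3 : ∀ᶠ C : ℝ in atTop, Real.exp 2 / (1 - (1 + κ) / 2) ≤ C ^ 2 :=
    (tendsto_pow_atTop (two_ne_zero)).eventually_ge_atTop _
  obtain ⟨C₀, hC₀⟩ := eventually_atTop.1 (h2.and h3)
  exact ⟨max 1 C₀, le_max_left _ _, fun C hC =>
    ⟨(1 + κ) / 2, hr1, hC₀ C ((le_max_right _ _).trans hC)⟩⟩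

end PlantedSubmatrix

theorem theorem2p1 (ε : ℝ) (hε : 0 < ε) :
    ∃ C : ℝ, 0 < C ∧
      -- (a) lower bound, for every `n ≥ 1`; for `lam = 0` the bound `lam⁻² / C` is infinite
      (∀ (n : ℕ) (lam : ℝ) (rho : unitInterval) (D : ℕ),
        1 ≤ n → 0 ≤ lam → 0 < (rho : ℝ) → (rho : ℝ) < 1 →
        lam ≤ (1 - ε) * ((rho : ℝ) * √(Real.exp 1 * n))⁻¹ * √(1 - (rho : ℝ)) →
        (lam = 0 ∨ (D : ℝ) ≤ (lam ^ 2)⁻¹ / C) →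
        PlantedSubmatrix.corr n lam rho D ≤ C * √((rho : ℝ) / (1 - (rho : ℝ)))) ∧
      -- (b) upper bound, as `n → ∞`
      (∀ (lam : ℕ → ℝ) (rho : ℕ → unitInterval),
        (∀ᶠ n : ℕ in atTop, (1 + ε) * ((rho n : ℝ) * √(Real.exp 1 * n))⁻¹ ≤ lam n) →
        (fun n : ℕ => (n : ℝ)⁻¹ * Real.log n ^ 12) =o[atTop] (fun n : ℕ => (rho n : ℝ)) →
        (fun n : ℕ => (rho n : ℝ)) =o[atTop] (fun n : ℕ => (Real.log n ^ 12)⁻¹) →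
        Tendsto (fun n : ℕ => PlantedSubmatrix.corr n (lam n) (rho n) ⌊C * Real.log n⌋₊)
          atTop (𝓝 1)) := by
  have hκ : max 0 (1 - ε) ^ 2 < 1 :=
    pow_lt_one₀ (le_max_left _ _) (max_lt one_pos (by linarith)) two_ne_zero
  obtain ⟨C₀, hC₀, h⟩ := PlantedSubmatrix.exists_const_of_lt_one hκ
  set C := max C₀ (2 * ((Real.log (1 + ε))⁻¹ + 1)) with hC
  have hC1 : 1 ≤ C := hC₀.trans (le_max_left _ _)
  refine ⟨C, zero_lt_one.trans_le hC1, ?_, ?_⟩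
  · intro n lam rho D hn hlam0 h0 h1 hlam hD
    obtain ⟨r, hr1, hr, hrC⟩ := h C (le_max_left _ _)
    refine PlantedSubmatrix.corr_le_of_below_threshold hn h0 h1 hC1 hr1 ?_ hrC hD
    exact (mul_le_mul_of_nonneg_right (PlantedSubmatrix.snr_le hn hlam0 h0 h1 hlam)
      (Real.exp_pos _).le).trans hr
  · intro lam rho hlam h1 h2
    exact PlantedSubmatrix.tendsto_corr_of_above_threshold hε (le_max_right _ _) lam rho hlam h1 h2
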